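/- **Model.** Let $G$ be the infinite triangular lattice graph. A particle occupies one node of $G$ (it is *contracted*) or two adjacent nodes (*expanded*; the node expanded into last is its *head*, the other one its *tail*; for a contracted particle its node is both); every node is occupied by at most one particle. Every particle has a state from a finite set $Q$, an orientation (one of the six directions), and one flag from a finite alphabet $\Sigma$ for each edge incident to it (not counting the edge between its own two nodes). Its edges are labeled $0,1,\dots$ counter-clockwise, starting with the edge in the direction of its orientation that leads to a node adjacent to only one of its occupied nodes. It reads the flags that neighboring particles hold for the shared edges, and $\varepsilon$ where there is no neighbor. A transition function maps the state and the flags read to a set of turns (new state, new flags, movement: idle, expand, contract, or handover contraction, along a labeled edge). An action is an isolated turn of one particle (an expansion needs a free node; a handover contraction is not allowed in isolation), or a *handover*: a contracted particle expands into a node that an expanded particle contracts out of at the same time, with either kind of contraction. In each step one arbitrary enabled action is executed, as long as there is one. The algorithm *terminates* when the transition function of every particle maps to $\emptyset$. An execution is *fair* if for no particle $p$ there is an infinite set of consecutive configurations in which $p$ could be affected by an enabled action but is not. **Problem.** An object is a set $C$ of nodes occupied by contracted object particles, which are in a special state, never act, and are recognizable by their flags. It is *valid* if $C$ induces a connected subgraph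 and $G-C$ is $2$-connected. Its surface (the set of nodes outside $C$ adjacent to $C$) is assumed to be infinite. A non-object particle *lies on the surface* if it occupies a node adjacent to a node of $C$. A configuration is *connected* if the set of all occupied nodes, including the object, induces a connected subgraph of $G$. **Algorithm.** A non-object particle is *inactive*, a *follower* or a *leader*, and knows its shape. Its flags tell its phase, the edge label, and its shape (and so its contraction direction, from tail to head). A follower stores a direction $d$ at its head and sets a follow indicator on that edge. Every particle has at most one possible turn, given by the first applicable rule; turns set flags without a complaint indicator unless stated otherwise. Phase and $d$ are kept unless stated otherwise. * Inactive: if on the surface, become a leader (idle). If adjacent to a leader or follower, become a follower with $d$ pointing to one of these (idle). * Contracted follower: if on the surface, become a leader (idle). If there is an expanded particle at the node in direction $d$, expand in direction $d$ (as an attempt to a handover) and set $d$ to the contraction direction of that particle. * Contracted leader: let $s$ be the direction computed by starting with an edge leading to the object and decreasing the label modulo $6$ until the edge does not lead to the object. If the node in direction $s$ is neither free nor the tail of an expanded particle, and a follow or complaint indicator is read, set a complaint indicator on the edge in direction $s$ (idle). If no follow indicator and no complaint indicator is read, do nothing. Otherwise expand in direction $s$. * Expanded follower or leader: if a follow indicator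 is read from a contracted neighbor over an edge incident to the tail, do a handover contraction out of the tail. If no follow indicator is read over an edge incident to the tail and there is no inactive neighbor, contract out of the tail. * In all other cases, do nothing. **Theorem.** For every rule for resolving the free choices (the active neighbor that $d$ points to, the starting edge for computing $s$) as a function of the flags read and the candidate labels, the algorithm solves the Infinite Object Coating problem: consider any connected initial configuration consisting of a valid object with infinite surface and finitely many contracted, inactive non-object particles, with arbitrary orientations. Then in every fair execution every configuration is connected, the algorithm eventually terminates, and whenever it has terminated, the configuration is connected and consists of a valid object with infinite surface and finitely many contracted non-object particles that all lie on the surface of the object. -/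

import Mathlib

namespace Amoebot

/-! ## The triangular lattice -/

/-- The nodes of the equilateral triangular graph, in the basis of two unit vectors that enclose
an angle of 60 degrees. -/
abbrev Node := ℤ × ℤ

/-- The six directions, numbered counter-clockwise (direction `d` has angle `60 * d` degrees). -/
abbrev Dir := ZMod 6

/-- The unit vector in a given direction. -/
def vec (d : Dir) : Node :=
  (![(1, 0), (0, 1), (-1, 1), (-1, 0), (0, -1), (1, -1)] : Fin 6 → ℤ × ℤ) d

/-- The equilateral triangular graph. -/
def triGraph : SimpleGraph Node where
  Adj u v := ∃ d : Dir, v = u + vec d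
  symm := ⟨by
    rintro u v ⟨d, rfl⟩
    refine ⟨d + 3, ?_⟩
    have h : vec d + vec (d + 3) = 0 := by revert d; decide
    rw [add_assoc, h, add_zero]⟩
  loopless := ⟨by
    rintro u ⟨d, h⟩
    have h0 : vec d = 0 := by simpa using h
    clear h
    revert d
    decide⟩

/-- A graph is 2-connected if it has at least three vertices, is connected, and stays connected
when any single vertex is removed. -/
def TwoConnected {V : Type*} (G : SimpleGraph V) : Prop :=
  3 ≤ ENat.card V ∧ G.Connected ∧ ∀ v : V, (G.induce {v}ᶜ).Connected

/-- A set of nodes is a valid object if it induces a connected subgraph and its complement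
induces a 2-connected one. -/
def ValidObject (C : Set Node) : Prop :=
  (triGraph.induce C).Connected ∧ TwoConnected (triGraph.induce Cᶜ)

/-- The surface of an object: the nodes outside it that are adjacent to it. -/
def surface (C : Set Node) : Set Node :=
  {v | v ∉ C ∧ ∃ u ∈ C, triGraph.Adj u v}

/-! ## Particles and edge labels -/

/-- The two ends of a particle. The head of an expanded particle is the node it expanded into
last, the tail is its other node. A contracted particle has a single node, its head and tail. -/
inductive End
  | head
  | tail
  deriving DecidableEq

/-- The ten edges incident to an expanded particle whose head lies in direction `a` from its tail,
in counter-clockwise order around the particle. An edge is given by the end of the particle that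
it is incident to and by its direction away from that end. -/
def expandedEdges (a : Dir) : Fin 10 → End × Dir :=
  ![(.head, a - 2), (.head, a - 1), (.head, a), (.head, a + 1), (.head, a + 2),
    (.tail, a + 1), (.tail, a + 2), (.tail, a + 3), (.tail, a + 4), (.tail, a + 5)]

/-- The position in `expandedEdges a` of the edge labeled `0`: the only edge that has direction `0`
and leads to a node adjacent to just one of the two nodes of the particle. -/
def firstEdge (a : Dir) : Fin 10 :=
  (![2, 1, 8, 7, 6, 3] : Fin 6 → Fin 10) a

/-- The edge with a given label, for a particle of shape `x` (`none` for a contracted particle,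
`some a` for an expanded particle whose head lies in direction `a` from its tail). Labels increase
counter-clockwise. Here all directions are relative to the orientation of the particle, which is
the direction of the edge labeled `0`. A contracted particle has the labels `0, ..., 5` only. -/
def edgeAt (x : Option Dir) (i : Fin 10) : Option (End × Dir) :=
  match x with
  | none => if i.val < 6 then some (.head, (i.val : Dir)) else none
  | some a => some (expandedEdges a (firstEdge a + i))

/-- The label of an edge, the inverse of `edgeAt x` (the value `0` is used for non-edges). -/
def labelOf (x : Option Dir) (e : End × Dir) : Fin 10 :=
  ((List.finRange 10).find? fun i => decide (edgeAt x i = some e)).getD 0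

/-- The configuration of a particle with states in `Q` and flags in `A`. The field `axis` is the
direction from tail to head, if the particle is expanded. The fields `axis` and `orient` are
directions of the plane that are not accessible to the particle. -/
structure ParticleConfig (Q A : Type*) where
  /-- The current state. -/
  state : Q
  /-- The flag held for the edge with a given label (irrelevant for labels without an edge). -/
  flags : Fin 10 → A
  /-- The head of the particle. -/
  head : Node
  /-- `none` if contracted, and the direction from tail to head if expanded. -/
  axis : Option Dir
  /-- The orientation, i.e. the direction of the edge labeled `0`. -/
  orient : Dir

namespace ParticleConfig

variable {Q A : Type*}

/-- The particle occupies a single node. -/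
def Contracted (P : ParticleConfig Q A) : Prop := P.axis = none

/-- The node at an end of the particle. -/
def nodeAt (P : ParticleConfig Q A) : End → Node
  | .head => P.head
  | .tail => match P.axis with
    | none => P.head
    | some a => P.head - vec a

/-- The set of one or two nodes that the particle occupies. -/
def occupied (P : ParticleConfig Q A) : Set Node := {P.nodeAt .head, P.nodeAt .tail}

/-- The shape of the particle, relative to its orientation. -/
def localAxis (P : ParticleConfig Q A) : Option Dir := P.axis.map fun a => a - P.orient

/-- The edge with label `i`, as the pair of the occupied node it is incident to and the node
that it leads to. -/
def edge (P : ParticleConfig Q A) (i : Fin 10) : Option (Node × Node) :=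
  (edgeAt P.localAxis i).map fun e => (P.nodeAt e.1, P.nodeAt e.1 + vec (P.orient + e.2))

end ParticleConfig

/-! ## The Amoebot model -/

/-- The movements that a particle can specify. -/
inductive Movement
  | idle
  | expand (i : Fin 10)
  | contract (i : Fin 10)
  | handoverContract (i : Fin 10)

/-- A turn: a state to assume, flags to set (for the edge labels after the movement), and a
movement to execute. -/
structure Turn (Q A : Type*) where
  /-- The state to assume. -/
  state : Q
  /-- The flags to set. -/
  flags : Fin 10 → A
  /-- The movement to execute. -/
  move : Movement

/-- An algorithm is given by finite sets of states and of flags and a transition function, that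
takes the current state and the flags read via the incident edges to a set of turns. The value
`none` (the reserved flag) is read via label `i` if there is no edge with that label or if it leads
to an unoccupied node. -/
structure Algorithm (Q A : Type*) where
  /-- There are finitely many states. -/
  finite_states : Finite Q
  /-- There are finitely many flags. -/
  finite_flags : Finite A
  /-- The transition function. -/
  trans : Q → (Fin 10 → Option A) → Set (Turn Q A)

/-- A configuration of a system of particles that are indexed by `ι`. -/
abbrev Config (ι Q A : Type*) := ι → ParticleConfig Q A

/-- An action: an isolated turn of a particle, or a handover in which `p` expands with the turn
`s` and `q` contracts with the turn `t`. -/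
inductive Action (ι Q A : Type*)
  | solo (p : ι) (t : Turn Q A)
  | handover (p : ι) (s : Turn Q A) (q : ι) (t : Turn Q A)

/-- The action affects the particle `r`. -/
def Action.Affects {ι Q A : Type*} : Action ι Q A → ι → Prop
  | .solo p _, r => r = p
  | .handover p _ q _, r => r = p ∨ r = q

namespace ParticleConfig

variable {Q A : Type*}

/-- The node and the direction in which a contracted particle expands along the edge `i`. -/
def expandTo (P : ParticleConfig Q A) (i : Fin 10) : Option (Node × Dir) :=
  match P.axis with
  | none => (edgeAt none i).map fun e => (P.head + vec (P.orient + e.2), P.orient + e.2)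
  | some _ => none

/-- The node that remains occupied when an expanded particle contracts in the direction of the
edge `i`; the only possible directions are from tail to head (contracting out of the tail) and
from head to tail (contracting out of the head). -/
def contractTo (P : ParticleConfig Q A) (i : Fin 10) : Option Node :=
  match P.axis, edgeAt P.localAxis i with
  | some a, some (e, d) =>
    if (e = .head ∧ P.orient + d = a) ∨ (e = .tail ∧ P.orient + d = a + 3) then some (P.nodeAt e)
    else none
  | _, _ => none

/-- The result of a turn. Turns that are not executable never occur in enabled actions. -/
def execute (P : ParticleConfig Q A) (t : Turn Q A) : ParticleConfig Q A :=
  match t.move with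
  | .idle => { P with state := t.state, flags := t.flags }
  | .expand i => match P.expandTo i with
    | some (w, d) => { P with state := t.state, flags := t.flags, head := w, axis := some d }
    | none => P
  | .contract i | .handoverContract i => match P.contractTo i with
    | some v => { P with state := t.state, flags := t.flags, head := v, axis := none }
    | none => P

end ParticleConfig

section Dynamics

variable {ι Q A : Type*}

/-- The set of all occupied nodes. -/
def occupiedNodes (c : Config ι Q A) : Set Node := {v | ∃ p, v ∈ (c p).occupied}

/-- A connected configuration: every node is occupied by at most one particle, and the occupied
nodes induce a connected subgraph. -/
def ConnectedConfig (c : Config ι Q A) : Prop :=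
  (∀ p q, p ≠ q → Disjoint (c p).occupied (c q).occupied) ∧
    (triGraph.induce (occupiedNodes c)).Connected

open Classical in
/-- The flag that the particle `p` reads via the edge labeled `i`: the flag that the particle at
the other side of this edge holds for the very same edge. -/
noncomputable def view (c : Config ι Q A) (p : ι) (i : Fin 10) : Option A :=
  if h : ∃ r : ι × Fin 10, ∃ u w : Node,
      (c p).edge i = some (u, w) ∧ (c r.1).edge r.2 = some (w, u) then
    some ((c h.choose.1).flags h.choose.2)
  else none

/-- The turns to which the transition function maps for the particle `p`. -/
def turns (alg : Algorithm Q A) (c : Config ι Q A) (p : ι) : Set (Turn Q A) :=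
  alg.trans (c p).state (view c p)

/-- The enabled actions. An expansion in isolation needs a free node, and a handover contraction
is never enabled in isolation. In a handover one particle contracts out of the node that the other
one expands into. -/
def Enabled (alg : Algorithm Q A) (c : Config ι Q A) : Action ι Q A → Prop
  | .solo p t => t ∈ turns alg c p ∧
      match t.move with
      | .idle => True
      | .expand i => ∃ w d, (c p).expandTo i = some (w, d) ∧ w ∉ occupiedNodes c
      | .contract i => ∃ v, (c p).contractTo i = some v
      | .handoverContract _ => False
  | .handover p s q t => p ≠ q ∧ s ∈ turns alg c p ∧ t ∈ turns alg c q ∧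
      ∃ i j w d v, s.move = .expand i ∧ (t.move = .contract j ∨ t.move = .handoverContract j) ∧
        (c p).expandTo i = some (w, d) ∧ (c q).contractTo j = some v ∧
        w ∈ (c q).occupied ∧ w ≠ v

open Classical in
/-- The configuration after an action. -/
noncomputable def perform (c : Config ι Q A) : Action ι Q A → Config ι Q A
  | .solo p t => Function.update c p ((c p).execute t)
  | .handover p s q t =>
      Function.update (Function.update c p ((c p).execute s)) q ((c q).execute t)

/-- An execution: in every step some enabled action is executed, as long as there is one. An
execution that stops is continued by repeating its last configuration. -/
structure Execution (alg : Algorithm Q A) (ι : Type*) where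
  /-- The sequence of configurations. -/
  conf : ℕ → Config ι Q A
  /-- The action executed in each step. -/
  act : ℕ → Option (Action ι Q A)
  /-- The steps follow the rules of the model. -/
  step : ∀ n, match act n with
    | some a => Enabled alg (conf n) a ∧ conf (n + 1) = perform (conf n) a
    | none => (∀ a, ¬ Enabled alg (conf n) a) ∧ conf (n + 1) = conf n

/-- Fairness: there is no particle and no infinite set of consecutive configurations in which the
particle could be affected by an enabled action, but is not. -/
def Execution.Fair {alg : Algorithm Q A} (E : Execution alg ι) : Prop :=
  ∀ (p : ι) (m : ℕ), ∃ n ≥ m,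
    (∀ a, Enabled alg (E.conf n) a → ¬ a.Affects p) ∨ (∃ a, E.act n = some a ∧ a.Affects p)

/-- The transition function of every particle maps to the empty set. -/
def Terminated (alg : Algorithm Q A) (c : Config ι Q A) : Prop :=
  ∀ p, turns alg c p = ∅

/-- A morphing problem: a set of initial and a set of goal configurations. -/
structure MorphingProblem (ι Q A : Type*) where
  /-- The initial configurations. -/
  initial : Set (Config ι Q A)
  /-- The goal configurations. -/
  goal : Set (Config ι Q A)

/-- The algorithm solves the morphing problem under the fairness assumption: in every fair
execution from an initial configuration the system is connected at all times, the algorithm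
terminates, and when it does, a goal configuration is reached. -/
def Solves (alg : Algorithm Q A) (M : MorphingProblem ι Q A) : Prop :=
  ∀ E : Execution alg ι, E.Fair → E.conf 0 ∈ M.initial →
    (∀ n, ConnectedConfig (E.conf n)) ∧
    (∃ n, Terminated alg (E.conf n)) ∧
    (∀ n, Terminated alg (E.conf n) → E.conf n ∈ M.goal)

end Dynamics

/-! ## States and flags of the coating algorithm -/

/-- The three phases. A follower stores the direction `d` of an edge incident to its head, relative
to its orientation. -/
inductive Phase
  | inactive
  | follow (d : Dir)
  | lead
  deriving DecidableEq

/-- The phases without the stored direction, as they are indicated in flags. -/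
inductive PhaseName
  | inactive
  | follow
  | lead
  deriving DecidableEq

/-- The name of a phase. -/
def Phase.name : Phase → PhaseName
  | .inactive => .inactive
  | .follow _ => .follow
  | .lead => .lead

/-- The state of an object particle, or of a particle with a phase and a shape relative to its
orientation (`none` if contracted, the direction from tail to head if expanded). -/
inductive State
  | object
  | particle (phase : Phase) (shape : Option Dir)

/-- The information in a flag of a non-object particle. The label and the shape determine whether
the edge is a head edge or a tail edge, and its direction relative to the sender's orientation. -/
structure FlagData where
  /-- The phase of the sender. -/
  phase : PhaseName
  /-- The label of the edge from the perspective of the sender. -/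
  label : Fin 10
  /-- The shape of the sender, relative to its orientation. -/
  shape : Option Dir
  /-- The follow indicator. -/
  follow : Bool
  /-- The complaint indicator. -/
  complaint : Bool

/-- The flags: object particles are recognizable, other particles send `FlagData`. -/
inductive Flag
  | object
  | particle (f : FlagData)

instance : Finite Phase :=
  Finite.of_injective
    (fun x : Phase => match x with
      | .inactive => (Sum.inl true : Bool ⊕ Dir)
      | .follow d => Sum.inr d
      | .lead => Sum.inl false)
    (by rintro (_ | _ | _) (_ | _ | _) h <;> simp_all)

instance : Finite PhaseName :=
  Finite.of_injective
    (fun x : PhaseName => match x with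
      | .inactive => (0 : Fin 3)
      | .follow => 1
      | .lead => 2)
    (by rintro (_ | _ | _) (_ | _ | _) h <;> simp_all)

instance : Finite State :=
  Finite.of_injective
    (fun x : State => match x with
      | .object => (none : Option (Phase × Option Dir))
      | .particle p s => some (p, s))
    (by rintro (_ | _) (_ | _) h <;> simp_all)

instance : Finite FlagData :=
  Finite.of_injective
    (fun f : FlagData => (f.phase, f.label, f.shape, f.follow, f.complaint))
    (by rintro ⟨⟩ ⟨⟩ h; simp_all)

instance : Finite Flag :=
  Finite.of_injective
    (fun x : Flag => match x with
      | .object => (none : Option FlagData)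
      | .particle f => some f)
    (by rintro (_ | _) (_ | _) h <;> simp_all)

/-- The flags of a particle with a given phase and shape. A follower includes the follow indicator
in the flag for its edge `d`. The complaint indicator is included for the label `s`, if any. -/
def stdFlags (ph : Phase) (x : Option Dir) (s : Option (Fin 10)) (i : Fin 10) : Flag :=
  .particle
    { phase := ph.name
      label := i
      shape := x
      follow := match ph with
        | .follow d => decide (edgeAt x i = some (.head, d))
        | _ => false
      complaint := decide (s = some i) }

/-- The turn that leads to a given phase and shape, without a complaint indicator. -/
def stdTurn (ph : Phase) (x : Option Dir) (m : Movement) : Turn State Flag :=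
  ⟨.particle ph x, stdFlags ph x none, m⟩

/-! ## What a particle recognizes from the flags it reads -/

section Local

/-- The flags read via the incident edges. -/
abbrev View := Fin 10 → Option Flag

/-- The particle is connected to an object particle. -/
def OnSurface (v : View) : Prop := ∃ i, v i = some .object

/-- The label `i` leads to an inactive particle. -/
def InactiveAt (v : View) (i : Fin 10) : Prop :=
  ∃ f, v i = some (.particle f) ∧ f.phase = .inactive

/-- The label `i` leads to a follower or a leader. -/
def ActiveAt (v : View) (i : Fin 10) : Prop :=
  ∃ f, v i = some (.particle f) ∧ f.phase ≠ .inactive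

/-- A follow indicator or a complaint indicator is read. -/
def SeesIndicator (v : View) : Prop :=
  ∃ i f, v i = some (.particle f) ∧ (f.follow = true ∨ f.complaint = true)

/-- A particle of shape `x` reads a follow indicator over a tail edge. -/
def TailFollow (x : Option Dir) (v : View) : Prop :=
  ∃ i d f, edgeAt x i = some (.tail, d) ∧ v i = some (.particle f) ∧ f.follow = true

/-- A particle of shape `x` reads a follow indicator from a contracted neighbor over a tail edge. -/
def TailFollowContracted (x : Option Dir) (v : View) : Prop :=
  ∃ i d f, edgeAt x i = some (.tail, d) ∧ v i = some (.particle f) ∧ f.follow = true ∧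
    f.shape = none

/-- The direction from tail to head (the contraction direction) of an expanded neighbor that sent
the flag `f` over an edge of direction `d`. It is converted to the orientation of the receiver:
the sender sees this edge in the direction opposite to `d`. -/
def contractionDir (d : Dir) (f : FlagData) : Option Dir :=
  match f.shape, edgeAt f.shape f.label with
  | some a, some (_, d') => some (a + (d + 3 - d'))
  | _, _ => none

/-- A contracted particle can hope to expand along the edge `s`: it leads to an unoccupied node, or
to the tail of an expanded particle, so that a handover is possible. -/
def CanExpand (v : View) (s : Fin 10) : Prop :=
  v s = none ∨ ∃ f a d, v s = some (.particle f) ∧ f.shape = some a ∧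
    edgeAt f.shape f.label = some (.tail, d)

/-- A rule that selects a label from every nonempty set of labels (possibly depending on the flags
that the particle reads). -/
def IsTieBreak (pick : View → Finset (Fin 10) → Fin 10) : Prop :=
  ∀ v S, S.Nonempty → pick v S ∈ S

open Classical in
/-- The loop of the procedure for moving along a surface, for a contracted particle: decrease the
label `i` modulo 6 while the edge `i` is connected to the object. Six rounds are enough, since not
all neighbors belong to a valid object. -/
noncomputable def surfaceLoop (v : View) : ℕ → Fin 10 → Fin 10
  | 0, i => i
  | k + 1, i =>
      if v i = some .object then surfaceLoop v k (if i = 0 then 5 else i - 1) else i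

open Classical in
/-- The label of the edge along which a contracted particle moves along the surface. -/
noncomputable def surfaceLabel (pick : View → Finset (Fin 10) → Fin 10) (v : View) : Fin 10 :=
  surfaceLoop v 6 (pick v {i | v i = some .object})

end Local

/-! ## The coating algorithm -/

section Coating

/-- The contraction of an expanded active particle out of its tail, which is the same for followers
and leaders. -/
def contractTurns (ph : Phase) (a : Dir) (v : View) : Set (Turn State Flag) :=
  {t | (TailFollowContracted (some a) v ∧
        t = stdTurn ph none (.handoverContract (labelOf (some a) (.head, a)))) ∨
      (¬ TailFollow (some a) v ∧ (¬ ∃ i, InactiveAt v i) ∧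
        t = stdTurn ph none (.contract (labelOf (some a) (.head, a))))}

open Classical in
/-- An inactive particle becomes a leader if it is on the surface, and otherwise a follower of
an active neighbor, if there is one. -/
noncomputable def inactiveTurns (pick : View → Finset (Fin 10) → Fin 10) (v : View) :
    Set (Turn State Flag) :=
  if OnSurface v then {stdTurn .lead none .idle}
  else if ∃ i, ActiveAt v i then
    {t | ∃ d, edgeAt none (pick v {i | ActiveAt v i}) = some (.head, d) ∧
      t = stdTurn (.follow d) none .idle}
  else ∅

open Classical in
/-- A contracted follower becomes a leader on the surface, and otherwise attempts a handover with
an expanded particle in direction `d`. -/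
noncomputable def contractedFollowTurns (d : Dir) (v : View) : Set (Turn State Flag) :=
  if OnSurface v then {stdTurn .lead none .idle}
  else {t | ∃ f d', v (labelOf none (.head, d)) = some (.particle f) ∧
      contractionDir d f = some d' ∧
      t = stdTurn (.follow d') (some d) (.expand (labelOf none (.head, d)))}

open Classical in
/-- A contracted leader acts only if it sees a follow indicator or a complaint indicator. Then it
moves along the surface, or, if this is impossible, sends a complaint in that direction. -/
noncomputable def contractedLeadTurns (pick : View → Finset (Fin 10) → Fin 10) (v : View) :
    Set (Turn State Flag) :=
  if ¬ CanExpand v (surfaceLabel pick v) ∧ SeesIndicator v then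
    {⟨.particle .lead none, stdFlags .lead none (some (surfaceLabel pick v)), .idle⟩}
  else if ¬ SeesIndicator v then ∅
  else {t | ∃ d, edgeAt none (surfaceLabel pick v) = some (.head, d) ∧
    t = stdTurn .lead (some d) (.expand (surfaceLabel pick v))}

/-- The combination of moving along the surface, spanning forest and complaining. Object particles
never do anything. -/
noncomputable def coatingAlgorithm (pick : View → Finset (Fin 10) → Fin 10) :
    Algorithm State Flag where
  finite_states := inferInstance
  finite_flags := inferInstance
  trans
    | .object, _ => ∅
    | .particle .inactive _, v => inactiveTurns pick v
    | .particle (.follow d) none, v => contractedFollowTurns d v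
    | .particle .lead none, v => contractedLeadTurns pick v
    | .particle ph (some a), v => contractTurns ph a v

end Coating

/-! ## The Infinite Object Coating problem -/

section Problem

variable {ι : Type*}

/-- The object particles. -/
def IsObject (c : Config ι State Flag) (p : ι) : Prop := (c p).state = .object

/-- The nodes of the object. -/
def objectNodes (c : Config ι State Flag) : Set Node :=
  {v | ∃ p, IsObject c p ∧ v ∈ (c p).occupied}

/-- The particle is connected to an object particle. -/
def LiesOnSurface (c : Config ι State Flag) (p : ι) : Prop :=
  ∃ u ∈ (c p).occupied, ∃ w ∈ objectNodes c, triGraph.Adj u w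

/-- A connected configuration of a valid object with an infinite surface, consisting of contracted
object particles, together with finitely many contracted particles. -/
def CoatingConfig (c : Config ι State Flag) : Prop :=
  ConnectedConfig c ∧ (∀ p, (c p).Contracted) ∧
  ValidObject (objectNodes c) ∧ (surface (objectNodes c)).Infinite ∧
  {p | ¬ IsObject c p}.Finite

/-- In an initial configuration all particles are inactive and indicate this in their flags, and
all object particles are recognizable by their flags. The orientations are arbitrary. -/
def InitialConfig (c : Config ι State Flag) : Prop :=
  CoatingConfig c ∧ ∀ p,
    ((c p).state = .object ∧ (c p).flags = fun _ => .object) ∨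
    ((c p).state = .particle .inactive none ∧ (c p).flags = stdFlags .inactive none none)

/-- In a goal configuration all particles lie on the surface of the object. -/
def GoalConfig (c : Config ι State Flag) : Prop :=
  CoatingConfig c ∧ ∀ p, ¬ IsObject c p → LiesOnSurface c p

/-- The Infinite Object Coating problem, for particles indexed by `ι`. -/
def infiniteObjectCoating (ι : Type*) : MorphingProblem ι State Flag where
  initial := {c | InitialConfig c}
  goal := {c | GoalConfig c}

end Problem

end Amoebot

/-!
The proof has a geometric, a local, and a global part.

**The surface is a line.** A particle on the surface moves along it with the object on its left. On
the triangular lattice, a cochain mod 2 whose sum around each triangle vanishes is a coboundary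
(`exists_potential`). Winding numbers around two adjacent nodes, realized as crossing numbers with a
ray, hence differ by the coboundary of an explicit function. As `C` is connected and `G - C` stays
connected without a node `v`, it follows that the neighbors of `v` in `C` are contiguous
(`link_boundary_unique`); otherwise a closed walk through `v` and `C` would separate two neighbors
of `v` outside of `C`. So the next node on the surface does not depend on the edge at which the
search for it starts, and taking the next node is a permutation of the surface. The boundary edges
at a single orbit form a cocycle whose potential is constant on `C` and on its complement, so there
is only one orbit (`surface_induction`). As the surface is infinite, it can be indexed by the
integers (`ValidObject.exists_surfaceLine`).

**Abstraction.** A `Sketch` of a particle keeps only its nodes and its phase, with the direction of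
a follower in global terms. Together with the set of complaining particles, this determines everything
that the flags tell: as long as the flags agree with the states and no two particles share a node,
the actions that are enabled are exactly the steps `AStep` of an abstract system (`exists_aStep`,
`exists_enabled_of_aStep`). Labels, orientations and tie breaking do not occur there.

**Safety.** The invariant `Inv` holds in all reachable configurations. Following the directions of
followers, one gets to leaders since there is a rank that decreases along them; leaders are on the
surface; and inactive particles are never cut off, as an expanded particle with an inactive neighbor
leaves its tail only in a handover. Hence all configurations are connected (`Inv.connected`).

**Liveness.** In a fair execution, phases only change finitely often. After that, a follower whose
target has come to rest rests as well, since it only moves by handovers: if its target is a leader,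
it gets to the surface by the first handover, where it no longer moves as a follower. The position
of a leader along the surface never decreases, and leaders do not overtake each other. A leader that
is beyond all nodes that followers point to only moves if a complaining leader is directly
behind it. This bounds its position by the number of leaders behind it, so leaders come to rest, too
(`Run.exists_static`). From then on, only complaints are possible. By fairness, no particle is
inactive, no contracted follower is on the surface, and no particle is expanded (`Inv.calm`). If a leader
ever read an indicator again, consider the one that is furthest along the surface. It cannot
expand, so the next node on the surface is occupied by another leader, and fairness makes it
complain to that leader, which is further along: a contradiction. So no leader reads an indicator.
Then there are no followers, because one of minimal rank would point to a leader (`Inv.all_lead`),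
and the algorithm has terminated. The last arguments also show that a configuration in which no
particle has a turn is as required.
-/

namespace Amoebot

/-! ### The triangular lattice: connectivity and the vanishing of cocycles -/

@[simp] lemma vec_zero : vec 0 = (1, 0) := rfl
@[simp] lemma vec_one : vec 1 = (0, 1) := rfl
@[simp] lemma vec_two : vec 2 = (-1, 1) := rfl
@[simp] lemma vec_three : vec 3 = (-1, 0) := rfl
@[simp] lemma vec_four : vec 4 = (0, -1) := rfl
@[simp] lemma vec_five : vec 5 = (1, -1) := rfl

lemma dir_cases (d : Dir) : d = 0 ∨ d = 1 ∨ d = 2 ∨ d = 3 ∨ d = 4 ∨ d = 5 := by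
  revert d; decide

lemma vec_injective : Function.Injective vec := by
  unfold Function.Injective; decide

lemma vec_add_three (d : Dir) : vec (d + 3) = -vec d := by
  revert d; decide

lemma adj_add_vec (u : Node) (d : Dir) : triGraph.Adj u (u + vec d) := ⟨d, rfl⟩

lemma connected_induction {V : Type*} {G : SimpleGraph V} (hG : G.Connected) {P : V → Prop}
    {x : V} (hx : P x) (hP : ∀ u w, G.Adj u w → P u → P w) (y : V) : P y := by
  obtain ⟨p⟩ := hG.preconnected x y
  induction p with
  | nil => exact hx
  | cons h _ ih => exact ih (hP _ _ h hx)

lemma induce_connected_induction {s : Set Node} (hs : (triGraph.induce s).Connected)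
    {P : Node → Prop} {x : Node} (hxs : x ∈ s) (hx : P x)
    (hP : ∀ u ∈ s, ∀ w ∈ s, triGraph.Adj u w → P u → P w) {y : Node} (hy : y ∈ s) : P y :=
  connected_induction (P := fun v : s => P v) hs (x := ⟨x, hxs⟩) hx
    (fun u w h hu => hP u u.2 w w.2 h hu) ⟨y, hy⟩

/-- A set of nodes that has a crossing edge from every nonempty proper subset induces a connected
subgraph. -/
lemma induce_connected_of_closed {s : Set Node} {x : Node} (hx : x ∈ s)
    (h : ∀ T ⊆ s, x ∈ T → (∀ u ∈ T, ∀ w ∈ s, triGraph.Adj u w → w ∈ T) → s ⊆ T) :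
    (triGraph.induce s).Connected := by
  have key := h {v | ∃ hv : v ∈ s, (triGraph.induce s).Reachable ⟨x, hx⟩ ⟨v, hv⟩}
    (fun v hv => hv.1) ⟨hx, .refl _⟩
    (fun u hu w hw huw => ⟨hw, hu.2.trans (SimpleGraph.Adj.reachable (by simpa using huw))⟩)
  rw [SimpleGraph.connected_iff_exists_forall_reachable]
  exact ⟨⟨x, hx⟩, fun w => (key w.2).2⟩

lemma exists_antiderivative {M : Type*} [AddCommGroup M] (g : ℤ → M) :
    ∃ F : ℤ → M, ∀ n, F (n + 1) = F n + g n := by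
  refine ⟨fun n => match n with
    | .ofNat k => ∑ i ∈ Finset.range k, g i
    | .negSucc k => -∑ i ∈ Finset.range (k + 1), g (Int.negSucc i), fun n => ?_⟩
  match n with
  | .ofNat k =>
    change ∑ i ∈ Finset.range (k + 1), g i = _
    rw [Finset.sum_range_succ]; rfl
  | .negSucc 0 =>
    change ∑ i ∈ Finset.range 0, g i = -∑ i ∈ Finset.range (0 + 1), g (Int.negSucc i) + _
    simp
  | .negSucc (k + 1) =>
    change -∑ i ∈ Finset.range (k + 1), g (Int.negSucc i) =
      -∑ i ∈ Finset.range (k + 1 + 1), g (Int.negSucc i) + _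
    rw [Finset.sum_range_succ _ (k + 1)]
    abel

lemma zmod_two_add_self (x : ZMod 2) : x + x = 0 := by revert x; decide

/-- A mod 2 cochain on the edges of the triangular lattice whose sum around every triangle vanishes
is the coboundary of a function on the nodes: the lattice, with its triangles filled in, is simply
connected. -/
lemma exists_potential (φ : Node → Node → ZMod 2) (hsymm : ∀ u v, φ u v = φ v u)
    (htri : ∀ u d, φ u (u + vec d) + φ (u + vec d) (u + vec (d + 1)) + φ u (u + vec (d + 1)) = 0) :
    ∃ f : Node → ZMod 2, ∀ u v, triGraph.Adj u v → φ u v = f u + f v := by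
  obtain ⟨H, hH⟩ := exists_antiderivative fun x => φ (x, 0) (x + 1, 0)
  choose V hV using fun x : ℤ => exists_antiderivative fun y => φ (x, y) (x, y + 1)
  have hup (x y : ℤ) : φ (x, y) (x + 1, y) + φ (x + 1, y) (x, y + 1) + φ (x, y) (x, y + 1) = 0 := by
    simpa using htri (x, y) 0
  have hdown (x y : ℤ) :
      φ (x + 1, y) (x + 1, y + 1) + φ (x + 1, y + 1) (x, y + 1) + φ (x + 1, y) (x, y + 1) = 0 := by
    simpa [show (1 + 1 : Dir) = 2 from rfl] using htri (x + 1, y) 1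
  have h2 (x : ZMod 2) : 2 * x = 0 := by revert x; decide
  obtain ⟨f, hf⟩ : ∃ f : Node → ZMod 2, ∀ x y, f (x, y) = H x + V x 0 + V x y :=
    ⟨fun u => H u.1 + V u.1 0 + V u.1 u.2, fun _ _ => rfl⟩
  have fv (x y : ℤ) : φ (x, y) (x, y + 1) = f (x, y) + f (x, y + 1) := by
    simp only [hf, hV]; linear_combination - h2 (H x) - h2 (V x 0) - h2 (V x y)
  have fh (x y : ℤ) : φ (x, y) (x + 1, y) = f (x, y) + f (x + 1, y) := by
    have step (y : ℤ) : φ (x, y + 1) (x + 1, y + 1) - f (x, y + 1) - f (x + 1, y + 1) =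
        φ (x, y) (x + 1, y) - f (x, y) - f (x + 1, y) := by
      have e1 := hup x y
      have e2 := hdown x y
      rw [hsymm (x + 1, y + 1)] at e2
      rw [fv] at e1 e2
      linear_combination e2 - e1 - h2 (f (x + 1, y + 1)) + h2 (f (x, y))
    suffices h : φ (x, y) (x + 1, y) - f (x, y) - f (x + 1, y) = 0 by
      linear_combination h
    induction y using Int.induction_on with
    | zero =>
      simp only [hf, hH]
      linear_combination - h2 (H x) - h2 (V x 0) - h2 (V (x + 1) 0)
    | succ y ih => rw [step, ih]
    | pred y ih => rw [← step, sub_add_cancel, ih]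
  have fd (x y : ℤ) : φ (x + 1, y) (x, y + 1) = f (x + 1, y) + f (x, y + 1) := by
    have e := hup x y
    rw [fv, fh] at e
    linear_combination e - h2 (f (x, y)) - h2 (f (x + 1, y)) - h2 (f (x, y + 1))
  refine ⟨f, ?_⟩
  rintro ⟨x, y⟩ _ ⟨d, rfl⟩
  rcases dir_cases d with rfl | rfl | rfl | rfl | rfl | rfl
  · simpa using fh x y
  · simpa using fv x y
  · simpa [← sub_eq_add_neg] using fd (x - 1) y
  · have := fh (x - 1) y
    rw [hsymm, add_comm (f _)]
    simpa [← sub_eq_add_neg] using this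
  · have := fv x (y - 1)
    rw [hsymm, add_comm (f _)]
    simpa [← sub_eq_add_neg] using this
  · have := fd x (y - 1)
    rw [hsymm, add_comm (f _)]
    simpa [← sub_eq_add_neg] using this

/-! ### The neighbors of a node in the object are contiguous -/

/-- The cochain of edges that cross the ray that starts slightly above `x` and is directed to the
right, as a function of the positions of the two nodes relative to `x`. Its sum along a closed walk
is the winding number mod 2 around `x`. -/
def rayCrossing (u w : Node) : ZMod 2 :=
  (if w.2 = u.2 + 1 ∧ u.2 = 0 ∧ 0 < u.1 then 1 else 0) +
    (if u.2 = w.2 + 1 ∧ w.2 = 0 ∧ 0 < w.1 then 1 else 0)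

/-- A function, in coordinates relative to `x`, whose coboundary is the difference between the ray
cochains of `x` and of `x + vec i` on the edges that avoid these two nodes. -/
def rayShift (i : Dir) (u : Node) : ZMod 2 :=
  match (show Fin 6 from i) with
  | 0 | 3 => 0
  | 1 => if u.2 = 1 ∧ 0 < u.1 then 1 else 0
  | 2 => if u.2 = 1 ∧ -1 < u.1 then 1 else 0
  | 4 => if u.2 = 0 ∧ 0 < u.1 then 1 else 0
  | 5 => if u.2 = 0 ∧ 0 < u.1 then 1 else 0

lemma rayShift_spec (i : Dir) (u w : Node) (h : triGraph.Adj u w) (hu : u ≠ 0) (hw : w ≠ 0)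
    (hu' : u ≠ vec i) (hw' : w ≠ vec i) :
    rayCrossing u w + rayCrossing (u - vec i) (w - vec i) = rayShift i u + rayShift i w := by
  obtain ⟨d, rfl⟩ := h
  obtain ⟨x, y⟩ := u
  have e0 : rayShift 0 = fun _ => 0 := rfl
  have e1 : rayShift 1 = fun u => if u.2 = 1 ∧ 0 < u.1 then 1 else 0 := rfl
  have e2 : rayShift 2 = fun u => if u.2 = 1 ∧ -1 < u.1 then 1 else 0 := rfl
  have e3 : rayShift 3 = fun _ => 0 := rfl
  have e4 : rayShift 4 = fun u => if u.2 = 0 ∧ 0 < u.1 then 1 else 0 := rfl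
  have e5 : rayShift 5 = fun u => if u.2 = 0 ∧ 0 < u.1 then 1 else 0 := rfl
  rcases dir_cases i with rfl | rfl | rfl | rfl | rfl | rfl <;>
  rcases dir_cases d with rfl | rfl | rfl | rfl | rfl | rfl <;>
  simp [rayCrossing, Prod.ext_iff, e0, e1, e2, e3, e4, e5] at * <;>
  grind

/-- The contribution of the edge from `0` to `vec k` and of its end `vec k` to the comparison of
the winding numbers around `0` and `vec i`. -/
def linkSign (i k : Dir) : ZMod 2 :=
  rayCrossing (0 - vec i) (vec k - vec i) + rayShift i (vec k)

/-- A walk that enters `0` from `vec k` and leaves it towards `vec l` separates `vec (k + e)` from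
`vec (l + e)`: on the hexagon around `0`, the nodes `vec k` and `vec l` separate these two. -/
lemma linkSign_sum (e : Dir) (he : e = 1 ∨ e = -1) (k l : Dir) (hkl : k ≠ l) (hk : k ≠ l + e)
    (hl : l ≠ k + e) :
    linkSign (k + e) k + linkSign (k + e) l + linkSign (l + e) k + linkSign (l + e) l = 1 := by
  revert e k l; decide

/-- Winding numbers around nodes of a connected set agree for closed walks outside this set. -/
lemma exists_rayShift_of_connected {X : Set Node}
    (hX : ∀ P : Node → Prop, (∀ u ∈ X, ∀ w ∈ X, triGraph.Adj u w → P u → P w) →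
      ∀ x ∈ X, ∀ y ∈ X, P x → P y) {x y : Node} (hx : x ∈ X) (hy : y ∈ X) :
    ∃ h : Node → ZMod 2, ∀ u w, triGraph.Adj u w → u ∉ X → w ∉ X →
      rayCrossing (u - x) (w - x) + rayCrossing (u - y) (w - y) = h u + h w := by
  refine hX (fun y => ∃ h : Node → ZMod 2, ∀ u w, triGraph.Adj u w → u ∉ X → w ∉ X →
      rayCrossing (u - x) (w - x) + rayCrossing (u - y) (w - y) = h u + h w) ?_ x hx y hy
    ⟨fun _ => 0, fun u w _ _ _ => by rw [zmod_two_add_self, add_zero]⟩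
  rintro a ha _ hb ⟨i, rfl⟩ ⟨h, hh⟩
  refine ⟨fun u => h u + rayShift i (u - a), fun u w huw hu hw => ?_⟩
  have e1 := hh u w huw hu hw
  have e2 := rayShift_spec i (u - a) (w - a)
    (by obtain ⟨d, rfl⟩ := huw; exact ⟨d, by abel⟩)
    (fun h => hu (by rwa [sub_eq_zero.1 h])) (fun h => hw (by rwa [sub_eq_zero.1 h]))
    (fun h => hu (by rwa [sub_eq_iff_eq_add'.1 h])) (fun h => hw (by rwa [sub_eq_iff_eq_add'.1 h]))
  rw [sub_sub, sub_sub] at e2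
  linear_combination e1 + e2 - zmod_two_add_self (rayCrossing (u - a) (w - a))

/-- If `C` is connected and `X`, the complement of `C ∪ {v}`, is connected, then the boundary of the
set of directions from `v` to `C` contains just one clockwise (or counter-clockwise) step. Given two
such steps, a closed walk through `v` and otherwise in `C` would have different winding numbers mod
2 around `v + vec (k + e)` and `v + vec (l + e)`, which are connected in `X`. -/
lemma link_boundary_unique {C X : Set Node} {v : Node} (hC : (triGraph.induce C).Connected)
    (hX : ∀ P : Node → Prop, (∀ u ∈ X, ∀ w ∈ X, triGraph.Adj u w → P u → P w) →
      ∀ x ∈ X, ∀ y ∈ X, P x → P y) (hv : v ∉ C) (hXv : ∀ u, u ∈ X ↔ u ∉ C ∧ u ≠ v)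
    {e : Dir} (he : e = 1 ∨ e = -1) {k l : Dir} (hk : v + vec k ∈ C) (hk' : v + vec (k + e) ∉ C)
    (hl : v + vec l ∈ C) (hl' : v + vec (l + e) ∉ C) : k = l := by
  by_contra hkl
  have hkl1 : k ≠ l + e := fun h => hl' (h ▸ hk)
  have hlk1 : l ≠ k + e := fun h => hk' (h ▸ hl)
  have hne (d : Dir) : v + vec d ≠ v := by
    intro h
    have : vec d = 0 := by simpa using h
    clear h
    revert d; decide
  obtain ⟨h, hh⟩ := exists_rayShift_of_connected hX ((hXv _).2 ⟨hk', hne _⟩)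
    ((hXv _).2 ⟨hl', hne _⟩)
  have hCX : ∀ u ∈ C, u ∉ X := fun u hu hx => ((hXv u).1 hx).1 hu
  have hvX : v ∉ X := fun hx => ((hXv v).1 hx).2 rfl
  -- On edges within `C`, all three terms are the change of the ray cochain from one center to
  -- another, and the changes add up to zero. So `g` is constant on `C`.
  let g : Node → ZMod 2 := fun u => h u + rayShift (k + e) (u - v) + rayShift (l + e) (u - v)
  have hshift (i : Dir) (hi : v + vec i ∉ C) (u w : Node) (huw : triGraph.Adj u w) (hu : u ∈ C)
      (hw : w ∈ C) : rayCrossing (u - v) (w - v) +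
        rayCrossing (u - (v + vec i)) (w - (v + vec i)) =
        rayShift i (u - v) + rayShift i (w - v) := by
    rw [← sub_sub, ← sub_sub]
    exact rayShift_spec i (u - v) (w - v) (by obtain ⟨d, rfl⟩ := huw; exact ⟨d, by abel⟩)
      (fun h => hv (by rwa [← sub_eq_zero.1 h])) (fun h => hv (by rwa [← sub_eq_zero.1 h]))
      (fun h => hi (by rwa [← sub_eq_iff_eq_add'.1 h]))
      (fun h => hi (by rwa [← sub_eq_iff_eq_add'.1 h]))
  have hg : g (v + vec l) = g (v + vec k) := by
    refine induce_connected_induction hC (P := fun u => g u = g (v + vec k)) hk rfl ?_ hl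
    intro u hu w hw huw hgu
    rw [← hgu]
    have e1 := hh u w huw (hCX u hu) (hCX w hw)
    have e2 := hshift _ hk' u w huw hu hw
    have e3 := hshift _ hl' u w huw hu hw
    simp only [g]
    linear_combination e2 + e3 - e1 - zmod_two_add_self (rayCrossing (u - v) (w - v))
      - zmod_two_add_self (h u)
      + zmod_two_add_self (rayShift (k + e) (w - v)) + zmod_two_add_self (rayShift (l + e) (w - v))
  have e1 := hh v (v + vec k) (adj_add_vec v k) hvX (hCX _ hk)
  have e2 := hh v (v + vec l) (adj_add_vec v l) hvX (hCX _ hl)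
  have e3 := linkSign_sum e he k l hkl hkl1 hlk1
  simp only [g, add_sub_cancel_left] at hg
  have r (i d : Dir) : rayCrossing (v - (v + vec i)) (v + vec d - (v + vec i)) =
      rayCrossing (0 - vec i) (vec d - vec i) := by
    congr 1 <;> abel
  rw [r, r] at e1 e2
  simp only [linkSign] at e3
  have : (0 : ZMod 2) = 1 := by
    linear_combination e3 - e1 - e2 - hg - zmod_two_add_self (h v)
      - zmod_two_add_self (h (v + vec k)) - zmod_two_add_self (rayShift (k + e) (vec k))
      - zmod_two_add_self (rayShift (l + e) (vec k))
  exact absurd this (by decide)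

/-! ### The surface is a line -/

/-- The surface of `C` is a line, along which a particle with the object on its left moves in
direction `sd v` from the node `v`, and `pos` is a coordinate on this line. The field `sd_eq` says
that `sd v` does not depend on the edge to the object at which the search for it starts. -/
structure SurfaceLine (C : Set Node) (sd : Node → Dir) (pos : Node → ℤ) : Prop where
  sd_eq : ∀ v ∉ C, ∀ i, v + vec i ∈ C → v + vec (i - 1) ∉ C → sd v = i - 1
  next_mem : ∀ v ∈ surface C, v + vec (sd v) ∈ surface C
  pos_next : ∀ v ∈ surface C, pos (v + vec (sd v)) = pos v + 1
  pos_injOn : Set.InjOn pos (surface C)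
  exists_free : ∀ v ∈ surface C, ∃ i, v + vec i ∉ C

lemma mem_surface {C : Set Node} {v : Node} : v ∈ surface C ↔ v ∉ C ∧ ∃ d, v + vec d ∈ C := by
  refine and_congr_right fun _ => ⟨?_, ?_⟩
  · rintro ⟨u, hu, huv⟩
    obtain ⟨d, rfl⟩ := huv.symm
    exact ⟨d, hu⟩
  · rintro ⟨d, hd⟩
    exact ⟨_, hd, (adj_add_vec v d).symm⟩

lemma ValidObject.induction_erase {C : Set Node} (hC : ValidObject C) {v : Node} (hv : v ∉ C)
    (P : Node → Prop) (hP : ∀ u ∈ {u | u ∉ C ∧ u ≠ v}, ∀ w ∈ {u | u ∉ C ∧ u ≠ v},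
      triGraph.Adj u w → P u → P w) (x : Node) (hx : x ∈ {u | u ∉ C ∧ u ≠ v}) (y : Node)
    (hy : y ∈ {u | u ∉ C ∧ u ≠ v}) (h : P x) : P y := by
  have hconn := hC.2.2.2 ⟨v, hv⟩
  refine connected_induction hconn (P := fun z => P z.1.1)
    (x := ⟨⟨x, hx.1⟩, fun h => hx.2 (congrArg Subtype.val h)⟩) h ?_
    ⟨⟨y, hy.1⟩, fun h => hy.2 (congrArg Subtype.val h)⟩
  rintro ⟨⟨a, ha⟩, ha'⟩ ⟨⟨b, hb⟩, hb'⟩ hab hPa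
  exact hP a ⟨ha, fun h => ha' (Subtype.ext h)⟩ b ⟨hb, fun h => hb' (Subtype.ext h)⟩ hab hPa

lemma ValidObject.exists_free {C : Set Node} (hC : ValidObject C) {v : Node} (hv : v ∉ C) :
    ∃ i, v + vec i ∉ C := by
  by_contra! h
  have hall : ∀ w ∈ Cᶜ, w = v := fun w hw => by
    refine induce_connected_induction hC.2.2.1 (P := fun w => w = v) hv rfl ?_ hw
    rintro u _ w hw ⟨d, rfl⟩ rfl
    exact absurd (h d) hw
  have hsub : Subsingleton ↥Cᶜ := ⟨fun a b => Subtype.ext ((hall a a.2).trans (hall b b.2).symm)⟩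
  have h1 := hC.2.1.trans (ENat.card_le_one_iff_subsingleton _ |>.2 hsub)
  norm_num at h1

/-- Turning from a direction with property `p`, one meets a direction that is the last one with
`p`. -/
lemma exists_boundary_dir (p : Dir → Prop) (e : Dir) (he : e = 1 ∨ e = -1) (h : ∃ i, p i)
    (h' : ∃ i, ¬ p i) : ∃ i, p i ∧ ¬ p (i + e) := by
  by_contra! hstep
  obtain ⟨i, hi⟩ := h
  obtain ⟨j, hj⟩ := h'
  have hn (n : ℕ) : p (i + n * e) := by
    induction n with
    | zero => simpa using hi
    | succ n ih =>
      have := hstep _ ih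
      rwa [add_assoc, ← add_one_mul, ← Nat.cast_succ] at this
  have : ∀ i j : Dir, ∃ n : Fin 6, i + (n.val : ℕ) * e = j := by
    rcases he with rfl | rfl <;> decide
  obtain ⟨n, hn'⟩ := this i j
  exact hj (hn' ▸ hn n)

/-- A permutation with a single, infinite orbit is conjugate to the translation of the integers. -/
lemma zpow_coordinates {α : Type*} (σ : Equiv.Perm α) [Infinite α] (x : α)
    (hx : ∀ y, ∃ k : ℤ, (σ ^ k) x = y) :
    ∃ pos : α → ℤ, (∀ y, pos (σ y) = pos y + 1) ∧ Function.Injective pos := by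
  choose pos hpos using hx
  have hfree (m : ℤ) (hm : (σ ^ m) x = x) : m = 0 := by
    by_contra h0
    have hmul (q : ℤ) : (σ ^ (m * q)) x = x := by
      induction q using Int.induction_on with
      | zero => simp
      | succ q ih => rw [mul_add, mul_one, zpow_add, Equiv.Perm.mul_apply, hm, ih]
      | pred q ih =>
        rw [mul_sub, mul_one, zpow_sub, Equiv.Perm.mul_apply, Equiv.Perm.inv_eq_iff_eq.2 hm.symm, ih]
    refine not_finite_iff_infinite.2 ‹Infinite α› ?_
    refine Set.finite_univ_iff.1 (((Set.finite_Ico 0 |m|).image fun k : ℤ => (σ ^ k) x).subset ?_)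
    intro y _
    refine ⟨pos y % m, ⟨Int.emod_nonneg _ h0, Int.emod_lt_abs _ h0⟩, ?_⟩
    conv_rhs => rw [← hpos y, ← Int.emod_add_mul_ediv (pos y) m, zpow_add, Equiv.Perm.mul_apply,
      hmul]
  refine ⟨pos, fun y => ?_, fun y z h => by rw [← hpos y, h, hpos z]⟩
  have h : (σ ^ (pos (σ y) - (pos y + 1))) x = x := by
    rw [sub_eq_neg_add, zpow_add, Equiv.Perm.mul_apply, hpos, zpow_neg, Equiv.Perm.inv_eq_iff_eq,
      add_comm, zpow_add, Equiv.Perm.mul_apply, hpos, zpow_one]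
  linarith [hfree _ h]

/-- A property of surface nodes that is invariant under steps along the boundary of `C` holds for
the whole surface: the boundary edges at the nodes with this property form a cocycle, and its
potential is constant on `C` and on the complement. -/
lemma surface_induction {C : Set Node} (hC : (triGraph.induce C).Connected)
    (hC' : (triGraph.induce Cᶜ).Connected) {P : Node → Prop}
    (hP : ∀ v d, v + vec d ∉ C → v + vec (d + 1) ∈ C → v ∉ C → (P v ↔ P (v + vec d)))
    {x y : Node} (hx : x ∈ surface C) (hy : y ∈ surface C) (h : P x) : P y := by
  classical
  let φ : Node → Node → ZMod 2 := fun u v =>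
    if (u ∈ C ∧ v ∉ C ∧ P v) ∨ (v ∈ C ∧ u ∉ C ∧ P u) then 1 else 0
  have hφ (u v : Node) : φ u v = φ v u := by
    simp only [φ]; congr 1; exact propext or_comm
  have htri (u : Node) (d : Dir) :
      φ u (u + vec d) + φ (u + vec d) (u + vec (d + 1)) + φ u (u + vec (d + 1)) = 0 := by
    have k1 := hP u d
    have k2 := hP (u + vec d) (d + 2)
    have k3 := hP (u + vec (d + 1)) (d + 4)
    have e1 : u + vec d + vec (d + 2) = u + vec (d + 1) := by
      rw [add_assoc]; congr 1; clear k1 k2 k3; revert d; decide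
    have e2 : u + vec d + vec (d + 2 + 1) = u := by
      rw [add_assoc, show d + 2 + 1 = d + 3 by ring, vec_add_three]; simp
    have e3 : u + vec (d + 1) + vec (d + 4) = u := by
      rw [add_assoc, show d + 4 = d + 1 + 3 by ring, vec_add_three]; simp
    have e4 : u + vec (d + 1) + vec (d + 4 + 1) = u + vec d := by
      rw [add_assoc]; congr 1; clear k1 k2 k3 e1 e2 e3; revert d; decide
    rw [e1, e2] at k2
    rw [e3, e4] at k3
    simp only [φ]
    generalize u + vec d = v at *
    generalize u + vec (d + 1) = w at *
    clear e1 e2 e3 e4 hφ φ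
    by_cases hu : u ∈ C <;> by_cases hv' : v ∈ C <;> by_cases hw' : w ∈ C <;>
      by_cases pu : P u <;> by_cases pv : P v <;> by_cases pw : P w <;>
      simp [hu, hv', hw', pu, pv, pw] at k1 k2 k3 ⊢ <;> decide
  obtain ⟨f, hf⟩ := exists_potential φ hφ htri
  have hconst {a b : Node} (hab : a ∈ C ↔ b ∈ C) : f a = f b := by
    have step (u w : Node) (huw : triGraph.Adj u w) (hm : u ∈ C ↔ w ∈ C) (hu : f u = f b) :
        f w = f b := by
      have : φ u w = 0 := if_neg (by tauto)
      rw [hf u w huw] at this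
      rw [← hu, ← sub_eq_zero, ← this]
      generalize f u = p; generalize f w = q; revert p q; decide
    by_cases hb : b ∈ C
    · exact induce_connected_induction hC (P := fun a => f a = f b) hb rfl
        (fun u hu w hw huw => step u w huw (iff_of_true hu hw)) (hab.2 hb)
    · exact induce_connected_induction hC' (P := fun a => f a = f b) hb rfl
        (fun u hu w hw huw => step u w huw (iff_of_false hu hw)) (fun ha => hb (hab.1 ha))
  obtain ⟨hx, dx, hdx⟩ := mem_surface.1 hx
  obtain ⟨hy, dy, hdy⟩ := mem_surface.1 hy
  have e1 := hf _ _ (adj_add_vec x dx)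
  have e2 := hf _ _ (adj_add_vec y dy)
  rw [hconst (iff_of_false hx hy), hconst (iff_of_true hdx hdy), ← e2] at e1
  by_contra hPy
  have h1 : φ x (x + vec dx) = 1 := if_pos (by tauto)
  have h0 : φ y (y + vec dy) = 0 := if_neg (by tauto)
  rw [h0, h1] at e1
  exact absurd e1 (by decide)

/-- The surface of a valid object is a line if it is infinite: each node outside of `C` has at most
one clockwise and one counter-clockwise boundary step, so that the surface decomposes into orbits of
the permutation that maps a node to the next one, and there is only one orbit. -/
theorem ValidObject.exists_surfaceLine {C : Set Node} (hC : ValidObject C)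
    (hinf : (surface C).Infinite) : ∃ sd pos, SurfaceLine C sd pos := by
  classical
  have huniq {e : Dir} (he : e = 1 ∨ e = -1) {v : Node} (hv : v ∉ C) {k l : Dir} :=
    link_boundary_unique (k := k) (l := l) hC.1 (hC.induction_erase hv) hv (fun _ => Iff.rfl) he
  have hex (v : Node) : ∃ d, v ∈ surface C → v + vec (d + 1) ∈ C ∧ v + vec d ∉ C := by
    by_cases hv : v ∈ surface C
    · obtain ⟨i, hi, hi'⟩ := exists_boundary_dir (fun i => v + vec i ∈ C) (-1) (.inr rfl)
        (mem_surface.1 hv).2 (hC.exists_free hv.1)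
      exact ⟨i - 1, fun _ => ⟨by simpa using hi, by simpa [sub_eq_add_neg] using hi'⟩⟩
    · exact ⟨0, fun h => absurd h hv⟩
  choose sd hsd using hex
  have sd_eq : ∀ v ∉ C, ∀ i, v + vec i ∈ C → v + vec (i - 1) ∉ C → sd v = i - 1 := by
    intro v hv i hi hi'
    have hs : v ∈ surface C := mem_surface.2 ⟨hv, i, hi⟩
    have := huniq (.inr rfl) hv (k := i) (l := sd v + 1) hi
      (by rwa [← sub_eq_add_neg]) (hsd v hs).1
      (by simpa using (hsd v hs).2)
    rw [this, add_sub_cancel_right]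
  have hrot (d : Dir) : vec (d + 1) = vec d + vec (d + 2) := by revert d; decide
  have next_mem : ∀ v ∈ surface C, v + vec (sd v) ∈ surface C := fun v hv =>
    mem_surface.2 ⟨(hsd v hv).2, sd v + 2, by rw [add_assoc, ← hrot]; exact (hsd v hv).1⟩
  -- Two nodes outside of `C` that form a triangle with a node of `C` are consecutive.
  have hcons (u : Node) (hu : u ∈ C) (v : Node) (hv : v ∉ C) (i : Dir) (hi : v + vec i = u)
      (hw : v + vec (i - 1) ∉ C) : v + vec (sd v) = v + vec (i - 1) := by
    rw [sd_eq v hv i (hi ▸ hu) hw]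
  let σ' : surface C → surface C := fun v => ⟨v + vec (sd v), next_mem v v.2⟩
  have hinj : Function.Injective σ' := by
    rintro ⟨v, hv⟩ ⟨v', hv'⟩ h
    have h : v + vec (sd v) = v' + vec (sd v') := congrArg Subtype.val h
    have h3 (v : Node) (d : Dir) : v + vec d + vec (d + 2 + 1) = v := by
      rw [add_assoc, show d + 2 + 1 = d + 3 by ring, vec_add_three]; simp
    have h2 (v : Node) (hv : v ∈ surface C) : v + vec (sd v) + vec (sd v + 2) ∈ C := by
      rw [add_assoc, ← hrot]; exact (hsd v hv).1
    have := huniq (.inl rfl) (hsd v hv).2 (k := sd v + 2) (l := sd v' + 2) (h2 v hv)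
      (by rw [h3]; exact hv.1) (by rw [h]; exact h2 v' hv') (by rw [h, h3]; exact hv'.1)
    rw [add_left_inj] at this
    rw [this, add_left_inj] at h
    exact Subtype.ext h
  have hsurj : Function.Surjective σ' := by
    rintro ⟨w, hw⟩
    obtain ⟨i, hi, hi'⟩ := exists_boundary_dir (fun i => w + vec i ∈ C) 1 (.inl rfl)
        (mem_surface.1 hw).2 (hC.exists_free hw.1)
    have e1 : w + vec (i + 1) + vec (i - 1) = w + vec i := by
      rw [add_assoc]; congr 1; clear hi hi'; revert i; decide
    have e2 : w + vec (i + 1) + vec (i - 1 - 1) = w := by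
      rw [add_assoc]
      have : vec (i + 1) + vec (i - 1 - 1) = 0 := by clear hi hi' e1; revert i; decide
      rw [this, add_zero]
    refine ⟨⟨w + vec (i + 1), mem_surface.2 ⟨hi', i - 1, by rwa [e1]⟩⟩, Subtype.ext ?_⟩
    refine (hcons _ hi _ hi' (i - 1) e1 ?_).trans e2
    rw [e2]; exact hw.1
  let σ : Equiv.Perm (surface C) := Equiv.ofBijective σ' ⟨hinj, hsurj⟩
  obtain ⟨⟨v₀, hv₀⟩⟩ : Nonempty (surface C) := hinf.nonempty.to_subtype
  -- The boundary edges at the nodes of a single orbit form a cocycle.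
  have horbit (y : surface C) : ∃ k : ℤ, (σ ^ k) ⟨v₀, hv₀⟩ = y := by
    let O : Node → Prop := fun v => ∃ hv : v ∈ surface C, ∃ k : ℤ, (σ ^ k) ⟨v₀, hv₀⟩ = ⟨v, hv⟩
    have hO (v : Node) (hv : v ∈ surface C) : O (v + vec (sd v)) ↔ O v := by
      constructor
      · rintro ⟨_, k, hk⟩
        refine ⟨hv, k - 1, ?_⟩
        rw [sub_eq_neg_add, zpow_add, Equiv.Perm.mul_apply, hk, zpow_neg,
          Equiv.Perm.inv_eq_iff_eq, zpow_one]
        rfl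
      · rintro ⟨_, k, hk⟩
        refine ⟨next_mem v hv, k + 1, ?_⟩
        rw [add_comm, zpow_add, Equiv.Perm.mul_apply, hk, zpow_one]
        rfl
    refine (surface_induction hC.1 hC.2.2.1 (P := O) ?_ hv₀ y.2 ⟨hv₀, 0, rfl⟩).2
    intro v d hw hu hv
    rw [← hO v (mem_surface.2 ⟨hv, _, hu⟩), hcons _ hu v hv _ rfl (by simpa using hw),
      add_sub_cancel_right]
  have : Infinite (surface C) := hinf.to_subtype
  obtain ⟨pos, hpos, hposinj⟩ := zpow_coordinates σ ⟨v₀, hv₀⟩ horbit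
  refine ⟨sd, fun v => if h : v ∈ surface C then pos ⟨v, h⟩ else 0, sd_eq, next_mem, ?_, ?_,
    fun v hv => hC.exists_free hv.1⟩
  · intro v hv
    simp only [hv, next_mem v hv, dif_pos]
    exact hpos ⟨v, hv⟩
  · intro v hv w hw h
    simp only [hv, hw, dif_pos] at h
    exact congrArg Subtype.val (hposinj h)

/-! ### Abstract configurations -/

/-- The phase of a particle, where followers store their direction `d` as a global direction. -/
inductive Role
  | object
  | inactive
  | follow (g : Dir)
  | lead

/-- A particle without the data that only serve local communication: its orientation is forgotten
and its directions are global. -/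
@[ext] structure Sketch where
  /-- The phase. -/
  role : Role
  /-- The head. -/
  head : Node
  /-- `none` if contracted, and the direction from tail to head if expanded. -/
  axis : Option Dir

namespace Sketch

/-- The tail of a particle. -/
def tail (x : Sketch) : Node :=
  match x.axis with
  | none => x.head
  | some a => x.head - vec a

/-- The nodes that a particle occupies. -/
def occ (x : Sketch) : Set Node := {x.head, x.tail}

/-- The particle is a follower or a leader. -/
def Active (x : Sketch) : Prop := x.role ≠ .object ∧ x.role ≠ .inactive

/-- The particle is a follower, and its direction leads to the node `v`. -/
def Points (x : Sketch) (v : Node) : Prop := ∃ g, x.role = .follow g ∧ x.head + vec g = v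

lemma head_mem_occ (x : Sketch) : x.head ∈ x.occ := Or.inl rfl

lemma tail_mem_occ (x : Sketch) : x.tail ∈ x.occ := Or.inr rfl

lemma mem_occ {x : Sketch} {v : Node} : v ∈ x.occ ↔ v = x.head ∨ v = x.tail := Iff.rfl

lemma tail_of_none {x : Sketch} (h : x.axis = none) : x.tail = x.head := by
  simp [tail, h]

lemma tail_of_some {x : Sketch} {a : Dir} (h : x.axis = some a) : x.tail = x.head - vec a := by
  simp [tail, h]

lemma occ_of_none {x : Sketch} (h : x.axis = none) : x.occ = {x.head} := by
  simp [occ, tail_of_none h]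

end Sketch

section Abstract

variable {ι : Type*}

/-- The node after `v` along the surface. -/
def next (sd : Node → Dir) (v : Node) : Node := v + vec (sd v)

/-- The node has a neighbor in `C`. -/
def OnSurf (C : Set Node) (v : Node) : Prop := ∃ d, v + vec d ∈ C

/-- The set of occupied nodes. -/
def covered (a : ι → Sketch) : Set Node := {v | ∃ p, v ∈ (a p).occ}

/-- A follower points to the head of `p`, or a leader that complains stands directly behind it.
Here `K` is the set of the particles that complain. -/
def Sees (sd : Node → Dir) (a : ι → Sketch) (K : Set ι) (p : ι) : Prop :=
  (∃ r, (a r).Points (a p).head) ∨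
    ∃ r ∈ K, (a r).role = .lead ∧ next sd (a r).head = (a p).head

/-- A follower points to the tail of `q`. -/
def TailFollowed (a : ι → Sketch) (q : ι) : Prop := ∃ r, (a r).Points (a q).tail

/-- A contracted follower points to the tail of `q`. -/
def TailFollowedContracted (a : ι → Sketch) (q : ι) : Prop :=
  ∃ r, (a r).axis = none ∧ (a r).Points (a q).tail

/-- The particle `q` has an inactive neighbor. -/
def NearInactive (a : ι → Sketch) (q : ι) : Prop :=
  ∃ r, (a r).role = .inactive ∧ ∃ u ∈ (a q).occ, triGraph.Adj u (a r).head

/-- The expanded particle `q` has a turn. -/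
def MayContract (a : ι → Sketch) (q : ι) : Prop :=
  TailFollowedContracted a q ∨ (¬ TailFollowed a q ∧ ¬ NearInactive a q)

/-- The next node on the surface is free or the tail of an expanded particle. -/
def CanMove (sd : Node → Dir) (a : ι → Sketch) (p : ι) : Prop :=
  next sd (a p).head ∉ covered a ∨
    ∃ r, (a r).axis ≠ none ∧ (a r).tail = next sd (a p).head

open Classical in
/-- The effect of an action that affects the particles in `S` on the abstract configuration `a` and
the set `K` of complaining particles. -/
inductive AStep (C : Set Node) (sd : Node → Dir) (a : ι → Sketch) (K : Set ι) :
    Set ι → (ι → Sketch) → Set ι → Prop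
  | toLead (p : ι) (h : (a p).role = .inactive ∨ ∃ g, (a p).role = .follow g)
      (hx : (a p).axis = none) (hs : OnSurf C (a p).head) :
      AStep C sd a K {p} (Function.update a p ⟨.lead, (a p).head, none⟩) (K \ {p})
  | toFollow (p : ι) (g : Dir) (r : ι) (h : (a p).role = .inactive) (hx : (a p).axis = none)
      (hs : ¬ OnSurf C (a p).head) (hr : (a r).Active) (hg : (a p).head + vec g ∈ (a r).occ) :
      AStep C sd a K {p} (Function.update a p ⟨.follow g, (a p).head, none⟩) (K \ {p})
  | complain (p : ι) (h : (a p).role = .lead) (hx : (a p).axis = none) (hv : Sees sd a K p)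
      (hm : ¬ CanMove sd a p) : AStep C sd a K {p} a (insert p K)
  | expand (p : ι) (h : (a p).role = .lead) (hx : (a p).axis = none) (hv : Sees sd a K p)
      (hf : next sd (a p).head ∉ covered a) :
      AStep C sd a K {p}
        (Function.update a p ⟨.lead, next sd (a p).head, some (sd (a p).head)⟩) (K \ {p})
  | contract (q : ι) (hx : (a q).axis ≠ none) (hq : (a q).Active) (ht : ¬ TailFollowed a q)
      (hi : ¬ NearInactive a q) :
      AStep C sd a K {q} (Function.update a q ⟨(a q).role, (a q).head, none⟩) (K \ {q})
  | handoverLead (p q : ι) (hpq : p ≠ q) (h : (a p).role = .lead) (hx : (a p).axis = none)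
      (hv : Sees sd a K p) (hxq : (a q).axis ≠ none) (hq : (a q).Active)
      (hpt : next sd (a p).head = (a q).tail) (hm : MayContract a q) :
      AStep C sd a K {p, q}
        (Function.update
          (Function.update a p ⟨.lead, next sd (a p).head, some (sd (a p).head)⟩)
          q ⟨(a q).role, (a q).head, none⟩) (K \ {p, q})
  | handoverFollow (p q : ι) (g b : Dir) (hpq : p ≠ q) (h : (a p).role = .follow g)
      (hx : (a p).axis = none) (hs : ¬ OnSurf C (a p).head) (hxq : (a q).axis = some b)
      (hq : (a q).Active) (hpt : (a p).head + vec g = (a q).tail) :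
      AStep C sd a K {p, q}
        (Function.update
          (Function.update a p ⟨.follow b, (a p).head + vec g, some g⟩)
          q ⟨(a q).role, (a q).head, none⟩) (K \ {p, q})

end Abstract

/-! ### Edges and the flags read via them -/

instance : Fintype End := ⟨{.head, .tail}, fun e => by cases e <;> simp⟩

/-- The edges of a particle of shape `x`: no tail edges if it is contracted, and not the edge
between its two nodes if it is expanded. -/
def IsEdge (x : Option Dir) (e : End) (d : Dir) : Prop :=
  match x with
  | none => e = .head
  | some a => (e, d) ≠ (.head, a + 3) ∧ (e, d) ≠ (.tail, a)

instance (x : Option Dir) (e : End) (d : Dir) : Decidable (IsEdge x e d) := by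
  unfold IsEdge; split <;> infer_instance

set_option maxRecDepth 10000 in
lemma edgeAt_labelOf {x : Option Dir} {e : End} {d : Dir} (h : IsEdge x e d) :
    edgeAt x (labelOf x (e, d)) = some (e, d) := by
  revert x e d; decide

set_option maxRecDepth 10000 in
lemma isEdge_of_edgeAt {x : Option Dir} {i : Fin 10} {e : End} {d : Dir}
    (h : edgeAt x i = some (e, d)) : IsEdge x e d := by
  revert x i e d; decide

set_option maxRecDepth 10000 in
lemma edgeAt_inj {x : Option Dir} {i j : Fin 10} {z : End × Dir}
    (h : edgeAt x i = some z) (h' : edgeAt x j = some z) : i = j := by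
  have : ∀ (x : Option Dir) (i j : Fin 10), edgeAt x i ≠ none → edgeAt x i = edgeAt x j → i = j := by
    decide
  exact this x i j (by simp [h]) (h.trans h'.symm)

/-! ### The abstraction map, and edges between particles -/

/-- The role of a particle, read off from its state. -/
def roleOf (o : Dir) : State → Role
  | .object => .object
  | .particle .inactive _ => .inactive
  | .particle (.follow d) _ => .follow (o + d)
  | .particle .lead _ => .lead

/-- The abstract version of a particle configuration. -/
def sketch (P : ParticleConfig State Flag) : Sketch := ⟨roleOf P.orient P.state, P.head, P.axis⟩

/-- The particle sends a complaint indicator. -/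
def Complains (P : ParticleConfig State Flag) : Prop :=
  ∃ i f, P.flags i = .particle f ∧ f.complaint = true

/-- The state and the flags agree with the shape of the particle. A complaint is only sent by a
contracted leader, to the next node on the surface. -/
def Consistent (sd : Node → Dir) (P : ParticleConfig State Flag) : Prop :=
  match P.state with
  | .object => (∀ i, P.flags i = .object) ∧ P.axis = none
  | .particle ph x => x = P.localAxis ∧ (ph = .inactive → P.axis = none) ∧
      ∃ s, P.flags = stdFlags ph x s ∧ ∀ i, s = some i → ph = .lead ∧ P.axis = none ∧
        edgeAt none i = some (.head, sd P.head - P.orient)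

@[simp] lemma sketch_head (P : ParticleConfig State Flag) : (sketch P).head = P.head := rfl

lemma nodeAt_tail (P : ParticleConfig State Flag) : P.nodeAt .tail = (sketch P).tail := rfl

lemma occupied_eq (P : ParticleConfig State Flag) : P.occupied = (sketch P).occ := rfl

lemma nodeAt_mem (P : ParticleConfig State Flag) (e : End) : P.nodeAt e ∈ P.occupied := by
  cases e
  · exact Or.inl rfl
  · exact Or.inr rfl

lemma exists_nodeAt {P : ParticleConfig State Flag} {v : Node} (h : v ∈ P.occupied) :
    ∃ e, P.nodeAt e = v ∧ (P.axis = none → e = .head) := by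
  rcases h with h | h
  · exact ⟨.head, h.symm, fun _ => rfl⟩
  · by_cases hx : P.axis = none
    · refine ⟨.head, ?_, fun _ => rfl⟩
      rw [h, nodeAt_tail, Sketch.tail_of_none hx]; rfl
    · exact ⟨.tail, h.symm, fun h => absurd h hx⟩

lemma vec_ne_zero (d : Dir) : vec d ≠ 0 := by revert d; decide

lemma vec_eq_neg {d d' : Dir} (h : vec d = -vec d') : d = d' + 3 := by
  rw [← vec_add_three] at h
  exact vec_injective h

lemma edge_target_not_mem {P : ParticleConfig State Flag} {e : End} {d : Dir}
    (h : IsEdge P.localAxis e d) : P.nodeAt e + vec (P.orient + d) ∉ P.occupied := by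
  have hv (a d : Dir) : vec d ≠ vec a + vec a := by revert a d; decide
  cases hx : P.axis with
  | none =>
    simp only [ParticleConfig.localAxis, hx, Option.map_none, IsEdge] at h
    subst h
    rw [occupied_eq, Sketch.occ_of_none hx]
    intro h
    exact vec_ne_zero _ (by simpa [ParticleConfig.nodeAt] using h)
  | some a =>
    simp only [ParticleConfig.localAxis, hx, Option.map_some, IsEdge] at h
    rintro (h' | h')
    · cases e with
      | head => exact vec_ne_zero _ (by simpa using h')
      | tail =>
        simp only [ParticleConfig.nodeAt, hx] at h'
        have : vec (P.orient + d) = vec a := by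
          rw [sub_add_eq_add_sub, sub_eq_iff_eq_add] at h'
          exact add_left_cancel h'
        have := vec_injective this
        exact h.2 (by rw [← this]; simp)
    · cases e with
      | head =>
        simp only [ParticleConfig.nodeAt, hx] at h'
        have : vec (P.orient + d) = - vec a := by
          rw [sub_eq_add_neg] at h'; exact add_left_cancel h'
        have := vec_eq_neg this
        exact h.1 (by rw [sub_add_eq_add_sub, ← this]; simp)
      | tail => exact vec_ne_zero _ (by simpa using h')

lemma isEdge_of_target_not_mem {P : ParticleConfig State Flag} {e : End} {D : Dir}
    (he : P.axis = none → e = .head) (h : P.nodeAt e + vec D ∉ P.occupied) :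
    IsEdge P.localAxis e (D - P.orient) := by
  cases hx : P.axis with
  | none => simpa [ParticleConfig.localAxis, hx, IsEdge] using he hx
  | some a =>
    simp only [ParticleConfig.localAxis, hx, Option.map_some, IsEdge]
    constructor
    · intro h'
      obtain ⟨rfl, this⟩ := Prod.mk.inj h'
      obtain rfl : D = a + 3 := by
        rw [sub_add_eq_add_sub] at this; exact sub_left_injective this
      refine h (Or.inr ?_)
      simp [ParticleConfig.nodeAt, hx, vec_add_three, sub_eq_add_neg]
    · intro h'
      obtain ⟨rfl, this⟩ := Prod.mk.inj h'
      obtain rfl : D = a := sub_left_injective this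
      refine h (Or.inl ?_)
      simp [ParticleConfig.nodeAt, hx]

lemma nodeAt_injOn {P : ParticleConfig State Flag} {e e' : End} (he : P.axis = none → e = e')
    (h : P.nodeAt e = P.nodeAt e') : e = e' := by
  cases hx : P.axis with
  | none => exact he hx
  | some a =>
    have hne : P.head ≠ P.head - vec a := fun h => vec_ne_zero a (sub_eq_self.1 h.symm)
    simp only [ParticleConfig.nodeAt, hx] at h
    cases e <;> cases e'
    · rfl
    · exact absurd h hne
    · exact absurd h.symm hne
    · rfl

section Views

variable {ι : Type*} {c : Config ι State Flag}

/-- `p` has an edge with label `i`, that is incident to the end `e` and leads in direction `d`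
(relative to its orientation) to the end `e'` of `r`, which labels this edge `j` and sees it in
direction `d'`. -/
structure Meets (c : Config ι State Flag) (p : ι) (i : Fin 10) (e : End) (d : Dir) (r : ι)
    (j : Fin 10) (e' : End) (d' : Dir) : Prop where
  edge_left : edgeAt (c p).localAxis i = some (e, d)
  edge_right : edgeAt (c r).localAxis j = some (e', d')
  node : (c r).nodeAt e' = (c p).nodeAt e + vec ((c p).orient + d)
  dir : (c r).orient + d' = (c p).orient + d + 3

lemma Meets.node' {p i e d r j e' d'} (h : Meets c p i e d r j e' d') :
    (c r).nodeAt e' + vec ((c r).orient + d') = (c p).nodeAt e := by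
  rw [h.dir, h.node, vec_add_three]; abel

/-- Distinct particles occupy distinct nodes. -/
def DisjointNodes (c : Config ι State Flag) : Prop :=
  ∀ p q v, v ∈ (c p).occupied → v ∈ (c q).occupied → p = q

lemma edge_eq {P : ParticleConfig State Flag} {i : Fin 10} {e : End} {d : Dir}
    (h : edgeAt P.localAxis i = some (e, d)) :
    P.edge i = some (P.nodeAt e, P.nodeAt e + vec (P.orient + d)) := by
  simp [ParticleConfig.edge, h]

lemma exists_of_edge {P : ParticleConfig State Flag} {i : Fin 10} {u w : Node}
    (h : P.edge i = some (u, w)) : ∃ e d, edgeAt P.localAxis i = some (e, d) ∧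
      P.nodeAt e = u ∧ u + vec (P.orient + d) = w := by
  simp only [ParticleConfig.edge, Option.map_eq_some_iff, Prod.mk.injEq] at h
  obtain ⟨⟨e, d⟩, h1, rfl, rfl⟩ := h
  exact ⟨e, d, h1, rfl, rfl⟩

lemma end_of_contracted {P : ParticleConfig State Flag} {i : Fin 10} {e : End} {d : Dir}
    (h : edgeAt P.localAxis i = some (e, d)) (hx : P.axis = none) : e = .head := by
  have := isEdge_of_edgeAt h
  simpa [ParticleConfig.localAxis, hx, IsEdge] using this

lemma edge_inj {P : ParticleConfig State Flag} {i j : Fin 10} {z : Node × Node}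
    (h : P.edge i = some z) (h' : P.edge j = some z) : i = j := by
  obtain ⟨u, w⟩ := z
  obtain ⟨e, d, h1, h2, h3⟩ := exists_of_edge h
  obtain ⟨e', d', h1', h2', h3'⟩ := exists_of_edge h'
  obtain rfl : e = e' := nodeAt_injOn
    (fun hx => (end_of_contracted h1 hx).trans (end_of_contracted h1' hx).symm) (h2.trans h2'.symm)
  obtain rfl : d = d' := by
    have := vec_injective (add_left_cancel (h3.trans h3'.symm))
    exact add_left_cancel this
  exact edgeAt_inj h1 h1'

lemma view_of_meets (hd : DisjointNodes c) {p i e d r j e' d'} (h : Meets c p i e d r j e' d') :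
    view c p i = some ((c r).flags j) := by
  have e1 := edge_eq h.edge_left
  have e2 := edge_eq h.edge_right
  rw [h.node'] at e2
  rw [← h.node] at e1
  have hex : ∃ r : ι × Fin 10, ∃ u w : Node,
      (c p).edge i = some (u, w) ∧ (c r.1).edge r.2 = some (w, u) := ⟨(r, j), _, _, e1, e2⟩
  rw [view, dif_pos hex]
  obtain ⟨u, w, h1, h2⟩ := hex.choose_spec
  generalize hex.choose = z at *
  obtain ⟨r', j'⟩ := z
  rw [e1] at h1
  obtain ⟨rfl, rfl⟩ : _ = u ∧ _ = w := by simpa using h1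
  obtain ⟨_, _, _, hn, _⟩ := exists_of_edge h2
  obtain rfl : r = r' := hd r r' _ (nodeAt_mem _ _) (hn ▸ nodeAt_mem _ _)
  obtain rfl : j = j' := edge_inj e2 h2
  rfl

lemma exists_meets_of_view {p i φ} (h : view c p i = some φ) :
    ∃ e d r j e' d', Meets c p i e d r j e' d' ∧ φ = (c r).flags j := by
  unfold view at h
  split_ifs at h with hex
  obtain ⟨u, w, h1, h2⟩ := hex.choose_spec
  obtain ⟨e, d, a1, a2, a3⟩ := exists_of_edge h1
  obtain ⟨e', d', b1, b2, b3⟩ := exists_of_edge h2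
  refine ⟨e, d, hex.choose.1, hex.choose.2, e', d', ⟨a1, b1, ?_, ?_⟩, (Option.some.inj h).symm⟩
  · rw [a2, a3, b2]
  · refine vec_injective ?_
    rw [vec_add_three, eq_neg_iff_add_eq_zero]
    have : u + (vec ((c p).orient + d) + vec ((c hex.choose.1).orient + d')) = u := by
      rw [← add_assoc, a3, b3]
    rw [add_comm]
    simpa using this

lemma exists_meets (hd : DisjointNodes c) {p i e d r} (h : edgeAt (c p).localAxis i = some (e, d))
    (hr : (c p).nodeAt e + vec ((c p).orient + d) ∈ (c r).occupied) :
    ∃ j e' d', Meets c p i e d r j e' d' := by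
  obtain ⟨e', h1, h2⟩ := exists_nodeAt hr
  have hpr : p ≠ r := by
    rintro rfl
    exact edge_target_not_mem (isEdge_of_edgeAt h) hr
  have h3 : IsEdge (c r).localAxis e' ((c p).orient + d + 3 - (c r).orient) := by
    refine isEdge_of_target_not_mem h2 fun h4 => hpr (hd p r _ (nodeAt_mem _ e) ?_)
    rw [h1, vec_add_three] at h4
    simpa using h4
  exact ⟨_, e', _, h, edgeAt_labelOf h3, h1, by simp⟩

/-- An edge to a node in direction `D` from an occupied node, unless that node belongs to the same
particle. -/
lemma exists_edge {P : ParticleConfig State Flag} {v : Node} {D : Dir} (hv : v ∈ P.occupied)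
    (h : v + vec D ∉ P.occupied) : ∃ i e, P.nodeAt e = v ∧ (P.axis = none → e = .head) ∧
      edgeAt P.localAxis i = some (e, D - P.orient) := by
  obtain ⟨e, rfl, h2⟩ := exists_nodeAt hv
  exact ⟨_, e, rfl, h2, edgeAt_labelOf (isEdge_of_target_not_mem h2 h)⟩

end Views

/-! ### The meaning of the flags that are read -/

/-- What the flag `f` tells about its sender `P`, which holds it for the label `i`. -/
structure FlagSpec (sd : Node → Dir) (P : ParticleConfig State Flag) (i : Fin 10)
    (f : FlagData) : Prop where
  inactive : f.phase = .inactive ↔ (sketch P).role = .inactive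
  not_object : (sketch P).role ≠ .object
  label : f.label = i
  shape : f.shape = P.localAxis
  follow : f.follow = true ↔ ∃ g, (sketch P).role = .follow g ∧
    edgeAt P.localAxis i = some (.head, g - P.orient)
  complaint : f.complaint = true ↔ Complains P ∧ (sketch P).role = .lead ∧ P.axis = none ∧
    edgeAt P.localAxis i = some (.head, sd P.head - P.orient)

lemma Consistent.flags_cases {sd : Node → Dir} {P : ParticleConfig State Flag}
    (h : Consistent sd P) (i : Fin 10) :
    ((sketch P).role = .object ∧ P.flags i = .object) ∨
      ∃ f, P.flags i = .particle f ∧ FlagSpec sd P i f := by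
  unfold Consistent at h
  split at h
  · next hs => exact Or.inl ⟨by simp [sketch, hs, roleOf], h.1 i⟩
  · next ph x hs =>
    obtain ⟨rfl, -, s, hf, hsc⟩ := h
    right
    refine ⟨_, by rw [hf]; rfl, ?_, ?_, rfl, rfl, ?_, ?_⟩
    · cases ph <;> simp [sketch, hs, roleOf, Phase.name]
    · cases ph <;> simp [sketch, hs, roleOf]
    · cases ph with
      | inactive => simp [sketch, hs, roleOf]
      | lead => simp [sketch, hs, roleOf]
      | follow d =>
        simp only [sketch, hs, roleOf, decide_eq_true_eq, Role.follow.injEq]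
        constructor
        · intro h; exact ⟨_, rfl, by simpa using h⟩
        · rintro ⟨_, rfl, h⟩; simpa using h
    · simp only [decide_eq_true_eq]
      constructor
      · intro h
        obtain ⟨rfl, hx, he⟩ := hsc i h
        refine ⟨⟨i, _, by rw [hf]; rfl, by simpa using h⟩, by simp [sketch, hs, roleOf], hx, ?_⟩
        simpa [ParticleConfig.localAxis, hx] using he
      · rintro ⟨⟨j, f, hj, hc⟩, -, hx, he⟩
        rw [hf] at hj
        obtain rfl := Flag.particle.inj hj
        have hc : s = some j := by simpa using hc
        obtain ⟨-, -, he'⟩ := hsc j hc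
        rw [hc, edgeAt_inj he' (by simpa [ParticleConfig.localAxis, hx] using he)]

section Reading

variable {ι : Type*} {c : Config ι State Flag} {sd : Node → Dir}

/-- The abstract version of a configuration. -/
def sketches (c : Config ι State Flag) (p : ι) : Sketch := sketch (c p)

/-- The set of particles that send a complaint indicator. -/
def complainers (c : Config ι State Flag) : Set ι := {p | Complains (c p)}

/-- Flags are consistent, no two particles share a node, and no follower points to a node of its
own: what is needed to understand the flags that are read. -/
structure Readable (sd : Node → Dir) (c : Config ι State Flag) : Prop where
  disjoint : DisjointNodes c
  consistent : ∀ p, Consistent sd (c p)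
  not_self : ∀ p v, (sketches c p).Points v → v ∉ (c p).occupied

lemma Readable.of_view (h : Readable sd c) {p i f} (hv : view c p i = some (.particle f)) :
    ∃ e d r j e' d', Meets c p i e d r j e' d' ∧ FlagSpec sd (c r) j f := by
  obtain ⟨e, d, r, j, e', d', hm, hf⟩ := exists_meets_of_view hv
  refine ⟨e, d, r, j, e', d', hm, ?_⟩
  rcases (h.consistent r).flags_cases j with ⟨_, h2⟩ | ⟨f', h2, h3⟩
  · rw [h2] at hf; cases hf
  · rw [h2] at hf; cases hf; exact h3

lemma Readable.view_of_meets (h : Readable sd c) {p i e d r j e' d'}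
    (hm : Meets c p i e d r j e' d') (hr : (sketches c r).role ≠ .object) :
    ∃ f, view c p i = some (.particle f) ∧ FlagSpec sd (c r) j f := by
  rw [Amoebot.view_of_meets h.disjoint hm]
  rcases (h.consistent r).flags_cases j with ⟨h2, _⟩ | ⟨f, h2, h3⟩
  · exact absurd h2 hr
  · exact ⟨f, by rw [h2], h3⟩

lemma contracted_of_object (h : Readable sd c) {r} (hr : (sketches c r).role = .object) :
    (c r).axis = none := by
  have := h.consistent r
  unfold Consistent at this
  split at this
  · exact this.2
  · next ph x hs =>
    cases ph <;> simp [sketches, sketch, hs, roleOf] at hr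

lemma contracted_of_inactive (h : Readable sd c) {r} (hr : (sketches c r).role = .inactive) :
    (c r).axis = none := by
  have := h.consistent r
  unfold Consistent at this
  split at this
  · exact this.2
  · next ph x hs =>
    cases ph with
    | inactive => exact this.2.1 rfl
    | _ => simp [sketches, sketch, hs, roleOf] at hr

lemma role_eq_object {P : ParticleConfig State Flag} :
    (sketch P).role = .object ↔ P.state = .object := by
  unfold sketch
  cases hs : P.state with
  | object => simp [roleOf]
  | particle ph x => cases ph <;> simp [roleOf]

lemma mem_objectNodes (h : Readable sd c) {v : Node} :
    v ∈ objectNodes c ↔ ∃ r, (sketches c r).role = .object ∧ v = (c r).head := by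
  constructor
  · rintro ⟨r, hr, hv⟩
    have hr' : (sketches c r).role = .object := role_eq_object.2 hr
    refine ⟨r, hr', ?_⟩
    rw [occupied_eq, Sketch.occ_of_none (contracted_of_object h hr')] at hv
    exact hv
  · rintro ⟨r, hr, rfl⟩
    exact ⟨r, role_eq_object.1 hr, Or.inl rfl⟩

lemma view_eq_object (h : Readable sd c) {p i e d}
    (hi : edgeAt (c p).localAxis i = some (e, d)) :
    view c p i = some .object ↔ (c p).nodeAt e + vec ((c p).orient + d) ∈ objectNodes c := by
  constructor
  · intro hv
    obtain ⟨e₁, d₁, r, j, e', d', hm, hf⟩ := exists_meets_of_view hv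
    obtain ⟨rfl, rfl⟩ : e₁ = e ∧ d₁ = d := by simpa [hm.edge_left] using hi
    rcases (h.consistent r).flags_cases j with ⟨h1, h2⟩ | ⟨f, h2, h3⟩
    · exact ⟨r, role_eq_object.1 h1, hm.node ▸ nodeAt_mem _ _⟩
    · rw [h2] at hf; cases hf
  · rintro ⟨r, hr, hv⟩
    obtain ⟨j, e', d', hm⟩ := exists_meets h.disjoint hi hv
    rw [Amoebot.view_of_meets h.disjoint hm]
    rcases (h.consistent r).flags_cases j with ⟨h1, h2⟩ | ⟨f, h2, h3⟩
    · rw [h2]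
    · exact absurd (role_eq_object.2 hr) h3.not_object

lemma view_eq_none (h : Readable sd c) {p i e d}
    (hi : edgeAt (c p).localAxis i = some (e, d)) :
    view c p i = none ↔ (c p).nodeAt e + vec ((c p).orient + d) ∉ covered (sketches c) := by
  constructor
  · rintro hv ⟨r, hr⟩
    obtain ⟨j, e', d', hm⟩ := exists_meets h.disjoint hi hr
    rw [Amoebot.view_of_meets h.disjoint hm] at hv
    cases hv
  · intro hn
    by_contra hv
    obtain ⟨φ, hφ⟩ := Option.ne_none_iff_exists'.1 hv
    obtain ⟨e₁, d₁, r, j, e', d', hm, hf⟩ := exists_meets_of_view hφ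
    obtain ⟨rfl, rfl⟩ : e₁ = e ∧ d₁ = d := by simpa [hm.edge_left] using hi
    exact hn ⟨r, hm.node ▸ nodeAt_mem (c r) e'⟩

lemma edgeAt_of_view (hv : view c p i ≠ none) : ∃ e d, edgeAt (c p).localAxis i = some (e, d) := by
  obtain ⟨φ, hφ⟩ := Option.ne_none_iff_exists'.1 hv
  obtain ⟨e, d, r, j, e', d', hm, hf⟩ := exists_meets_of_view hφ
  exact ⟨e, d, hm.edge_left⟩

lemma nodeAt_of_contracted {P : ParticleConfig State Flag} (hx : P.axis = none) (e : End) :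
    P.nodeAt e = P.head := by
  cases e
  · rfl
  · simp [ParticleConfig.nodeAt, hx]

lemma localAxis_of_none {P : ParticleConfig State Flag} (hx : P.axis = none) :
    P.localAxis = none := by simp [ParticleConfig.localAxis, hx]

lemma localAxis_eq_none {P : ParticleConfig State Flag} :
    P.localAxis = none ↔ P.axis = none := by simp [ParticleConfig.localAxis]

lemma exists_label {P : ParticleConfig State Flag} (hx : P.axis = none) (D : Dir) :
    edgeAt P.localAxis (labelOf none (.head, D - P.orient)) = some (.head, D - P.orient) := by
  rw [localAxis_of_none hx]
  exact edgeAt_labelOf (show IsEdge none .head (D - P.orient) from rfl)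

lemma onSurface_iff (h : Readable sd c) {p} (hx : (c p).axis = none) :
    OnSurface (view c p) ↔ OnSurf (objectNodes c) (c p).head := by
  constructor
  · rintro ⟨i, hi⟩
    obtain ⟨e, d, hed⟩ := edgeAt_of_view (by rw [hi]; simp)
    have := (view_eq_object h hed).1 hi
    rw [nodeAt_of_contracted hx] at this
    exact ⟨_, this⟩
  · rintro ⟨D, hD⟩
    refine ⟨_, (view_eq_object h (exists_label hx D)).2 ?_⟩
    simpa [ParticleConfig.nodeAt] using hD

lemma inactiveAt_iff (h : Readable sd c) (p) :
    (∃ i, InactiveAt (view c p) i) ↔ NearInactive (sketches c) p := by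
  constructor
  · rintro ⟨i, f, hv, hf⟩
    obtain ⟨e, d, r, j, e', d', hm, hs⟩ := h.of_view hv
    have hr := hs.inactive.1 hf
    refine ⟨r, hr, _, nodeAt_mem (c p) e, (c p).orient + d, ?_⟩
    rw [← hm.node, nodeAt_of_contracted (contracted_of_inactive h hr)]
    rfl
  · rintro ⟨r, hr, u, hu, D, hD⟩
    have hD' : (c r).head = u + vec D := hD
    have hn : u + vec D ∉ (c p).occupied := by
      intro hn
      obtain rfl : p = r := h.disjoint p r _ hn (hD' ▸ Or.inl rfl)
      have hx := contracted_of_inactive h hr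
      rw [Sketch.occ_of_none hx] at hu
      obtain rfl : u = (c p).head := hu
      exact vec_ne_zero D (by simpa using hD'.symm)
    obtain ⟨i, e, rfl, _, hi⟩ := exists_edge hu hn
    obtain ⟨j, e', d', hm⟩ := exists_meets (r := r) h.disjoint hi (by
      rw [add_sub_cancel, ← hD']; exact Or.inl rfl)
    obtain ⟨f, hv, hf⟩ := h.view_of_meets hm (by rw [hr]; simp)
    exact ⟨i, f, hv, hf.inactive.2 hr⟩

lemma activeAt_iff (h : Readable sd c) {p i e d}
    (hi : edgeAt (c p).localAxis i = some (e, d)) :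
    ActiveAt (view c p) i ↔ ∃ r, (sketches c r).Active ∧
      (c p).nodeAt e + vec ((c p).orient + d) ∈ (sketches c r).occ := by
  constructor
  · rintro ⟨f, hv, hf⟩
    obtain ⟨e₁, d₁, r, j, e', d', hm, hs⟩ := h.of_view hv
    obtain ⟨rfl, rfl⟩ : e₁ = e ∧ d₁ = d := by simpa [hm.edge_left] using hi
    exact ⟨r, ⟨hs.not_object, fun hr => hf (hs.inactive.2 hr)⟩, hm.node ▸ nodeAt_mem (c r) e'⟩
  · rintro ⟨r, hr, hn⟩
    obtain ⟨j, e', d', hm⟩ := exists_meets h.disjoint hi hn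
    obtain ⟨f, hv, hf⟩ := h.view_of_meets hm hr.1
    exact ⟨f, hv, fun hf' => hr.2 (hf.inactive.1 hf')⟩

lemma points_of_follow (h : Readable sd c) {p i f} (hv : view c p i = some (.particle f))
    (hf : f.follow = true) : ∃ e d r, edgeAt (c p).localAxis i = some (e, d) ∧
      (sketches c r).Points ((c p).nodeAt e) ∧ f.shape = (c r).localAxis := by
  obtain ⟨e, d, r, j, e', d', hm, hs⟩ := h.of_view hv
  obtain ⟨g, hg, hj⟩ := hs.follow.1 hf
  obtain ⟨rfl, rfl⟩ : e' = .head ∧ d' = g - (c r).orient := by simpa [hm.edge_right] using hj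
  refine ⟨e, d, r, hm.edge_left, ⟨g, hg, ?_⟩, hs.shape⟩
  have := hm.node'
  rwa [add_sub_cancel] at this

/-- The edge of a particle towards the head of a particle that can be reached in direction `D`. -/
lemma exists_meets_head (h : Readable sd c) {p r u D} (hpr : p ≠ r) (hu : u ∈ (c p).occupied)
    (hr : u + vec D = (c r).head) : ∃ i e d j, (c p).nodeAt e = u ∧
      ((c p).axis = none → e = .head) ∧ Meets c p i e d r j .head (D + 3 - (c r).orient) := by
  have hn : u + vec D ∉ (c p).occupied := fun hn =>
    hpr (h.disjoint p r _ hn (hr ▸ Or.inl rfl))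
  obtain ⟨i, e, rfl, he, hi⟩ := exists_edge hu hn
  obtain ⟨j, e', d', hm⟩ := exists_meets (r := r) h.disjoint hi (by
      rw [add_sub_cancel, hr]; exact Or.inl rfl)
  have hn := hm.node
  rw [add_sub_cancel, hr] at hn
  obtain rfl : e' = .head := nodeAt_injOn (fun hx => end_of_contracted hm.edge_right hx) hn
  have hdir := hm.dir
  rw [add_sub_cancel] at hdir
  rw [← hdir, add_sub_cancel_left]
  exact ⟨i, e, _, j, rfl, he, hm⟩

lemma exists_follow_of_points (h : Readable sd c) {p r u} (hu : u ∈ (c p).occupied)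
    (hr : (sketches c r).Points u) : ∃ i e d f, (c p).nodeAt e = u ∧
      edgeAt (c p).localAxis i = some (e, d) ∧ view c p i = some (.particle f) ∧
      f.follow = true ∧ f.shape = (c r).localAxis := by
  have hpr : p ≠ r := by rintro rfl; exact h.not_self _ _ hr hu
  obtain ⟨g, hg, hgu⟩ := hr
  have hgu : (c r).head + vec g = u := hgu
  obtain ⟨i, e, d, j, h1, h2, hm⟩ := exists_meets_head (D := g + 3) h hpr hu (by
    rw [← hgu, vec_add_three]; abel)
  obtain ⟨f, hv, hf⟩ := h.view_of_meets hm (by rw [hg]; simp)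
  refine ⟨i, e, d, f, h1, hm.edge_left, hv, hf.follow.2 ⟨g, hg, ?_⟩, hf.shape⟩
  rw [hm.edge_right, add_assoc, show (3 + 3 : Dir) = 0 from rfl, add_zero]

lemma eq_tail_of_nodeAt {P : ParticleConfig State Flag} (hx : P.axis ≠ none) {e : End}
    (h : P.nodeAt e = (sketch P).tail) : e = .tail :=
  nodeAt_injOn (fun hx' => absurd hx' hx) h

lemma tailFollow_iff (h : Readable sd c) {p} (hx : (c p).axis ≠ none) :
    TailFollow (c p).localAxis (view c p) ↔ TailFollowed (sketches c) p := by
  constructor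
  · rintro ⟨i, d, f, hi, hv, hf⟩
    obtain ⟨e, d', r, h1, h2, -⟩ := points_of_follow h hv hf
    obtain ⟨rfl, -⟩ : e = .tail ∧ d' = d := by simpa [h1] using hi
    exact ⟨r, h2⟩
  · rintro ⟨r, hr⟩
    obtain ⟨i, e, d, f, h1, h2, h3, h4, -⟩ := exists_follow_of_points h (p := p) (Or.inr rfl) hr
    obtain rfl := eq_tail_of_nodeAt hx h1
    exact ⟨i, d, f, h2, h3, h4⟩

lemma tailFollowContracted_iff (h : Readable sd c) {p} (hx : (c p).axis ≠ none) :
    TailFollowContracted (c p).localAxis (view c p) ↔ TailFollowedContracted (sketches c) p := by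
  constructor
  · rintro ⟨i, d, f, hi, hv, hf, hfs⟩
    obtain ⟨e, d', r, h1, h2, h3⟩ := points_of_follow h hv hf
    obtain ⟨rfl, -⟩ : e = .tail ∧ d' = d := by simpa [h1] using hi
    exact ⟨r, localAxis_eq_none.1 (h3.symm.trans hfs), h2⟩
  · rintro ⟨r, hrx, hr⟩
    obtain ⟨i, e, d, f, h1, h2, h3, h4, h5⟩ := exists_follow_of_points h (p := p) (Or.inr rfl) hr
    obtain rfl := eq_tail_of_nodeAt hx h1
    exact ⟨i, d, f, h2, h3, h4, h5.trans (localAxis_of_none hrx)⟩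

lemma next_ne_self (v : Node) : next sd v ≠ v := fun h => vec_ne_zero _ (add_eq_left.1 h)

lemma seesIndicator_iff (h : Readable sd c) {p} (hx : (c p).axis = none) :
    SeesIndicator (view c p) ↔ Sees sd (sketches c) (complainers c) p := by
  constructor
  · rintro ⟨i, f, hv, hf | hf⟩
    · obtain ⟨e, d', r, h1, h2, -⟩ := points_of_follow h hv hf
      rw [nodeAt_of_contracted hx] at h2
      exact Or.inl ⟨r, h2⟩
    · obtain ⟨e, d, r, j, e', d', hm, hs⟩ := h.of_view hv
      obtain ⟨h1, h2, h3, h4⟩ := hs.complaint.1 hf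
      refine Or.inr ⟨r, h1, h2, ?_⟩
      obtain ⟨rfl, rfl⟩ : e' = .head ∧ d' = sd (c r).head - (c r).orient := by
        simpa [hm.edge_right] using h4
      have := hm.node'
      rw [nodeAt_of_contracted hx, add_sub_cancel] at this
      exact this
  · rintro (⟨r, hr⟩ | ⟨r, h1, h2, h3⟩)
    · obtain ⟨i, e, d, f, -, -, h3, h4, -⟩ := exists_follow_of_points h (p := p) (Or.inl rfl) hr
      exact ⟨i, f, h3, Or.inl h4⟩
    · have h3 : (c r).head + vec (sd (c r).head) = (c p).head := h3
      have hpr : p ≠ r := by rintro rfl; exact next_ne_self _ h3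
      obtain ⟨i, e, d, j, -, -, hm⟩ :=
        exists_meets_head (p := p) (D := sd (c r).head + 3) h hpr (Or.inl rfl) (by
          change (c p).head + _ = _
          rw [← h3, vec_add_three]; exact add_neg_cancel_right _ _)
      obtain ⟨f, hv, hf⟩ := h.view_of_meets hm (by rw [h2]; simp)
      obtain ⟨k, f', hk, hf'⟩ := h1
      have hs : (c r).axis = none := by
        rcases (h.consistent r).flags_cases k with ⟨h4, _⟩ | ⟨f'', h4, h5⟩
        · exact absurd (h2.symm.trans h4) (by simp)
        · rw [hk] at h4
          obtain rfl := Flag.particle.inj h4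
          exact (h5.complaint.1 hf').2.2.1
      refine ⟨i, f, hv, Or.inr (hf.complaint.2 ⟨⟨k, f', hk, hf'⟩, h2, hs, ?_⟩)⟩
      rw [hm.edge_right, add_assoc, show (3 + 3 : Dir) = 0 from rfl, add_zero]

end Reading

/-! ### The turns of the algorithm in abstract terms -/

section Turns

variable {ι : Type*} {c : Config ι State Flag} {sd : Node → Dir} {pos : Node → ℤ}
  {pick : View → Finset (Fin 10) → Fin 10}

lemma edgeAt_none {i : Fin 10} (hi : i.val < 6) : edgeAt none i = some (.head, (i.val : Dir)) := by
  simp [edgeAt, hi]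

lemma lt_six_of_edgeAt {i : Fin 10} {z : End × Dir} (h : edgeAt none i = some z) : i.val < 6 := by
  by_contra hi
  simp [edgeAt, hi] at h

lemma canExpand_iff (h : Readable sd c) {p s}
    (hs : edgeAt (c p).localAxis s = some (.head, sd (c p).head - (c p).orient)) :
    CanExpand (view c p) s ↔ CanMove sd (sketches c) p := by
  have hnode : (c p).nodeAt .head + vec ((c p).orient + (sd (c p).head - (c p).orient)) =
      next sd (sketches c p).head := by rw [add_sub_cancel]; rfl
  refine or_congr ?_ ⟨?_, ?_⟩
  · rw [view_eq_none h hs, hnode]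
  · rintro ⟨f, a, d, hv, hfs, hfl⟩
    obtain ⟨e, d', r, j, e', d'', hm, hf⟩ := h.of_view hv
    obtain ⟨rfl, rfl⟩ : e = .head ∧ d' = sd (c p).head - (c p).orient := by
      simpa [hm.edge_left] using hs
    rw [hf.label, hf.shape, hm.edge_right] at hfl
    obtain ⟨rfl, -⟩ : e' = .tail ∧ d'' = d := by simpa using hfl
    refine ⟨r, fun hn => ?_, ?_⟩
    · rw [hf.shape] at hfs
      have : (c r).axis = none := hn
      simp [ParticleConfig.localAxis, this] at hfs
    · rw [← hnode, ← hm.node]; rfl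
  · rintro ⟨r, hrx, hr⟩
    obtain ⟨j, e', d', hm⟩ := exists_meets (r := r) h.disjoint hs (by
      rw [hnode, ← hr]; exact Or.inr rfl)
    have hrx : (c r).axis ≠ none := hrx
    obtain rfl := eq_tail_of_nodeAt hrx (hm.node.trans (hnode.trans hr.symm))
    obtain ⟨f, hv, hf⟩ := h.view_of_meets hm fun ho => hrx (contracted_of_object h ho)
    obtain ⟨a, ha⟩ := Option.ne_none_iff_exists'.1 (fun h => hrx (localAxis_eq_none.1 h))
    exact ⟨f, a, d', hv, hf.shape.trans ha, by rw [hf.shape, hf.label, hm.edge_right]⟩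

lemma surfaceLoop_of_ne {v : View} {n : ℕ} {i : Fin 10} (h : v i ≠ some .object) :
    surfaceLoop v n i = i := by
  cases n <;> simp [surfaceLoop, h]

/-- The loop, started at a label that leads to the object, stops at the first label in clockwise
order that does not lead to the object. -/
lemma surfaceLoop_spec {v : View} {q : Dir → Prop}
    (hq : ∀ i : Fin 10, i.val < 6 → (v i = some .object ↔ q (i.val : Dir)))
    (n : ℕ) (i : Fin 10) (hi : i.val < 6) (hqi : q (i.val : Dir))
    (hn : ∃ k : ℕ, k ≤ n ∧ ¬ q ((i.val : Dir) - k)) :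
    (surfaceLoop v n i).val < 6 ∧ q (((surfaceLoop v n i).val : Dir) + 1) ∧
      ¬ q ((surfaceLoop v n i).val : Dir) := by
  induction n generalizing i with
  | zero =>
    obtain ⟨k, hk, hk'⟩ := hn
    obtain rfl : k = 0 := by omega
    exact absurd hqi (by simpa using hk')
  | succ n ih =>
    have hpred : ∀ i : Fin 10, i.val < 6 → (if i = 0 then (5 : Fin 10) else i - 1).val < 6 ∧
        (((if i = 0 then (5 : Fin 10) else i - 1).val : ℕ) : Dir) = (i.val : Dir) - 1 := by decide
    obtain ⟨h1, h2⟩ := hpred i hi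
    have hstep : surfaceLoop v (n + 1) i =
        surfaceLoop v n (if i = 0 then (5 : Fin 10) else i - 1) := by
      rw [surfaceLoop, if_pos ((hq i hi).2 hqi)]
    rw [hstep]
    generalize (if i = 0 then (5 : Fin 10) else i - 1) = j at *
    by_cases hj : q ((j.val : ℕ) : Dir)
    · refine ih j h1 hj ?_
      obtain ⟨k, hk, hk'⟩ := hn
      obtain ⟨k, rfl⟩ : ∃ k', k = k' + 1 := by
        cases k with
        | zero => exact absurd hqi (by simpa using hk')
        | succ k => exact ⟨k, rfl⟩
      refine ⟨k, by omega, ?_⟩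
      rw [h2, sub_sub, add_comm]
      simpa using hk'
    · rw [surfaceLoop_of_ne (fun hv => hj ((hq j h1).1 hv))]
      refine ⟨h1, ?_, hj⟩
      rw [h2, sub_add_cancel]
      exact hqi

open Classical in
lemma edgeAt_surfaceLabel (hpick : IsTieBreak pick) (hS : SurfaceLine (objectNodes c) sd pos)
    (h : Readable sd c) {p} (hx : (c p).axis = none) (hp : (c p).head ∈ surface (objectNodes c)) :
    edgeAt (c p).localAxis (surfaceLabel pick (view c p)) =
      some (.head, sd (c p).head - (c p).orient) := by
  have hx' := localAxis_of_none hx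
  have hne : ({i | view c p i = some .object} : Finset (Fin 10)).Nonempty := by
    obtain ⟨i, hi⟩ := (onSurface_iff h hx).2 (mem_surface.1 hp).2
    exact ⟨i, by simpa using hi⟩
  have hstart := hpick (view c p) _ hne
  unfold surfaceLabel
  generalize pick (view c p) _ = i at *
  replace hstart : view c p i = some .object := by simpa using hstart
  obtain ⟨e, d, hi⟩ := edgeAt_of_view (by rw [hstart]; simp)
  have hi6 := lt_six_of_edgeAt (hx' ▸ hi)
  let q : Dir → Prop := fun d => (c p).head + vec ((c p).orient + d) ∈ objectNodes c
  have hq (i : Fin 10) (hi : i.val < 6) : view c p i = some .object ↔ q (i.val : Dir) :=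
    view_eq_object h (hx' ▸ edgeAt_none hi)
  obtain ⟨D, hD⟩ := hS.exists_free _ hp
  obtain ⟨h1, h2, h3⟩ := surfaceLoop_spec hq 6 i hi6 ((hq i hi6).1 hstart) (by
    have : ∀ a b : Dir, ∃ k : Fin 7, a - (k.val : ℕ) = b := by decide
    obtain ⟨k, hk⟩ := this (i.val : Dir) (D - (c p).orient)
    refine ⟨k, by omega, ?_⟩
    simp only [q]
    rwa [hk, add_sub_cancel])
  generalize surfaceLoop _ _ _ = j at *
  have := hS.sd_eq _ hp.1 ((c p).orient + (j.val + 1)) h2 (by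
    rw [← add_assoc, add_sub_cancel_right]; exact h3)
  rw [this, hx', edgeAt_none h1]
  congr 2
  ring

/-- The invariants of reachable configurations as far as they matter for finding the turns of the
particles. -/
structure Regular (sd : Node → Dir) (pos : Node → ℤ) (c : Config ι State Flag) : Prop
    extends Readable sd c where
  line : SurfaceLine (objectNodes c) sd pos
  lead_mem : ∀ p, (sketches c p).role = .lead → (c p).head ∈ surface (objectNodes c)

lemma Consistent.state_inactive {P : ParticleConfig State Flag} (h : Consistent sd P)
    (hr : (sketch P).role = .inactive) : P.state = .particle .inactive none := by
  unfold Consistent at h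
  split at h
  · next hs => simp [sketch, hs, roleOf] at hr
  · next ph x hs =>
    cases ph <;> simp [sketch, hs, roleOf] at hr
    rw [hs, h.1, localAxis_of_none (h.2.1 rfl)]

lemma Consistent.state_follow {P : ParticleConfig State Flag} (h : Consistent sd P) {g : Dir}
    (hr : (sketch P).role = .follow g) :
    P.state = .particle (.follow (g - P.orient)) P.localAxis := by
  unfold Consistent at h
  split at h
  · next hs => simp [sketch, hs, roleOf] at hr
  · next ph x hs =>
    cases ph <;> simp [sketch, hs, roleOf] at hr
    rw [hs, h.1, ← hr, add_sub_cancel_left]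

lemma Consistent.state_lead {P : ParticleConfig State Flag} (h : Consistent sd P)
    (hr : (sketch P).role = .lead) : P.state = .particle .lead P.localAxis := by
  unfold Consistent at h
  split at h
  · next hs => simp [sketch, hs, roleOf] at hr
  · next ph x hs =>
    cases ph <;> simp [sketch, hs, roleOf] at hr
    rw [hs, h.1]

lemma Consistent.state_active {P : ParticleConfig State Flag} (h : Consistent sd P)
    (hr : (sketch P).Active) : ∃ ph, ph ≠ .inactive ∧ P.state = .particle ph P.localAxis := by
  obtain ⟨h1, h2⟩ := hr
  cases hr : (sketch P).role with
  | object => exact absurd hr h1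
  | inactive => exact absurd hr h2
  | follow g => exact ⟨_, by simp, h.state_follow hr⟩
  | lead => exact ⟨_, by simp, h.state_lead hr⟩

variable (pick) in
/-- The turns of a particle in the coating algorithm. -/
abbrev coatingTurns (c : Config ι State Flag) (p : ι) : Set (Turn State Flag) :=
  turns (coatingAlgorithm pick) c p

lemma turns_object {p} (hr : (sketches c p).role = .object) : coatingTurns pick c p = ∅ := by
  have := role_eq_object.1 hr
  simp [coatingTurns, turns, this, coatingAlgorithm]

lemma turns_inactive_surface (h : Readable sd c) {p} (hr : (sketches c p).role = .inactive)
    (hs : OnSurf (objectNodes c) (c p).head) :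
    coatingTurns pick c p = {stdTurn .lead none .idle} := by
  have hx := contracted_of_inactive h hr
  rw [← onSurface_iff h hx] at hs
  simp [coatingTurns, turns, (h.consistent p).state_inactive hr, coatingAlgorithm, inactiveTurns, hs]

open Classical in
lemma mem_turns_inactive (hpick : IsTieBreak pick) (h : Readable sd c) {p} {t : Turn State Flag}
    (hr : (sketches c p).role = .inactive) (hs : ¬ OnSurf (objectNodes c) (c p).head)
    (ht : t ∈ coatingTurns pick c p) : ∃ g r, (sketches c r).Active ∧
      (c p).head + vec g ∈ (sketches c r).occ ∧
      t = stdTurn (.follow (g - (c p).orient)) none .idle := by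
  have hx := contracted_of_inactive h hr
  rw [← onSurface_iff h hx] at hs
  simp only [coatingTurns, turns, (h.consistent p).state_inactive hr, coatingAlgorithm,
    inactiveTurns, hs, if_false] at ht
  split_ifs at ht with hact
  · obtain ⟨d, hd, rfl⟩ := ht
    have := hpick (view c p) {i | ActiveAt (view c p) i} (by
      obtain ⟨i, hi⟩ := hact; exact ⟨i, by simpa using hi⟩)
    generalize pick (view c p) _ = i at *
    have hi : ActiveAt (view c p) i := by simpa using this
    rw [← localAxis_of_none hx] at hd
    obtain ⟨r, h1, h2⟩ := (activeAt_iff h hd).1 hi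
    exact ⟨(c p).orient + d, r, h1, h2, by rw [add_sub_cancel_left]⟩
  · cases ht

open Classical in
lemma turns_inactive_nonempty (hpick : IsTieBreak pick) (h : Readable sd c) {p g r}
    (hr : (sketches c p).role = .inactive) (hs : ¬ OnSurf (objectNodes c) (c p).head)
    (ha : (sketches c r).Active) (hg : (c p).head + vec g ∈ (sketches c r).occ) :
    (coatingTurns pick c p).Nonempty := by
  have hx := contracted_of_inactive h hr
  rw [← onSurface_iff h hx] at hs
  have hact : ∃ i, ActiveAt (view c p) i := by
    refine ⟨_, (activeAt_iff h (exists_label hx g)).2 ⟨r, ha, ?_⟩⟩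
    rwa [add_sub_cancel]
  have := hpick (view c p) {i | ActiveAt (view c p) i} (by
      obtain ⟨i, hi⟩ := hact; exact ⟨i, by simpa using hi⟩)
  simp only [coatingTurns, turns, (h.consistent p).state_inactive hr, coatingAlgorithm,
    inactiveTurns, hs, hact, if_false, if_true]
  generalize hi : pick (view c p) _ = i at *
  have hi : ActiveAt (view c p) i := by simpa using this
  obtain ⟨f, hf, _⟩ := hi
  obtain ⟨e, d, hed⟩ := edgeAt_of_view (by rw [hf]; simp)
  obtain rfl := end_of_contracted hed hx
  rw [localAxis_of_none hx] at hed
  exact ⟨_, d, hed, rfl⟩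

lemma turns_follow_surface (h : Readable sd c) {p g} (hr : (sketches c p).role = .follow g)
    (hx : (c p).axis = none) (hs : OnSurf (objectNodes c) (c p).head) :
    coatingTurns pick c p = {stdTurn .lead none .idle} := by
  rw [← onSurface_iff h hx] at hs
  simp [coatingTurns, turns, (h.consistent p).state_follow hr, localAxis_of_none hx,
    coatingAlgorithm, contractedFollowTurns, hs]

/-- The turn of a contracted follower away from the surface, whose direction leads to the expanded
particle `q`. -/
lemma mem_turns_follow (h : Readable sd c) {p g} (hr : (sketches c p).role = .follow g)
    (hx : (c p).axis = none) (hs : ¬ OnSurf (objectNodes c) (c p).head) {t : Turn State Flag} :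
    t ∈ coatingTurns pick c p ↔ ∃ q b, (sketches c q).axis = some b ∧
      (c p).head + vec g ∈ (sketches c q).occ ∧
      t = stdTurn (.follow (b - (c p).orient)) (some (g - (c p).orient))
        (.expand (labelOf none (.head, g - (c p).orient))) := by
  rw [← onSurface_iff h hx] at hs
  simp only [coatingTurns, turns, (h.consistent p).state_follow hr, localAxis_of_none hx,
    coatingAlgorithm, contractedFollowTurns, hs, if_false]
  have hlab := exists_label hx g
  have hnode : (c p).nodeAt .head + vec ((c p).orient + (g - (c p).orient)) =
    (c p).head + vec g := by rw [add_sub_cancel]; rfl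
  have key {q b j e' d'} (hm : Meets c p (labelOf none (.head, g - (c p).orient)) .head
      (g - (c p).orient) q j e' d') {f} (hf : FlagSpec sd (c q) j f)
      (hb : (c q).axis = some b) :
      contractionDir (g - (c p).orient) f = some (b - (c p).orient) := by
    simp only [contractionDir, hf.shape, hf.label, hm.edge_right]
    have hdir := hm.dir
    simp only [ParticleConfig.localAxis, hb, Option.map_some]
    congr 1
    rw [add_sub_cancel] at hdir
    linear_combination - hdir
  constructor
  · rintro ⟨f, d', hv, hd', rfl⟩
    obtain ⟨e, d, q, j, e', d'', hm, hf⟩ := h.of_view hv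
    obtain ⟨rfl, rfl⟩ : e = .head ∧ d = g - (c p).orient := by simpa [hm.edge_left] using hlab
    cases hb : (c q).axis with
    | none =>
      simp [contractionDir, hf.shape, localAxis_of_none hb] at hd'
    | some b =>
      rw [key hm hf hb] at hd'
      obtain rfl := Option.some.inj hd'
      exact ⟨q, b, hb, hnode ▸ hm.node ▸ nodeAt_mem (c q) e', rfl⟩
  · rintro ⟨q, b, hb, hq, rfl⟩
    obtain ⟨j, e', d', hm⟩ := exists_meets (r := q) h.disjoint hlab (hnode ▸ hq)
    have hb' : (c q).axis = some b := hb
    obtain ⟨f, hv, hf⟩ := h.view_of_meets hm fun ho => by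
      rw [contracted_of_object h ho] at hb'; cases hb'
    exact ⟨f, _, hv, key hm hf hb', rfl⟩

/-- The label along which an expanded particle contracts out of its tail. -/
def contractLabel (P : ParticleConfig State Flag) (b : Dir) : Fin 10 :=
  labelOf P.localAxis (.head, b - P.orient)

lemma mem_turns_expanded (h : Readable sd c) {q b} {t : Turn State Flag}
    (hb : (c q).axis = some b) {ph : Phase} (hph : ph ≠ .inactive)
    (hs : (c q).state = .particle ph (c q).localAxis) :
    t ∈ coatingTurns pick c q ↔
      (TailFollowedContracted (sketches c) q ∧
        t = stdTurn ph none (.handoverContract (contractLabel (c q) b))) ∨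
      (¬ TailFollowed (sketches c) q ∧ ¬ NearInactive (sketches c) q ∧
        t = stdTurn ph none (.contract (contractLabel (c q) b))) := by
  have hl : (c q).localAxis = some (b - (c q).orient) := by simp [ParticleConfig.localAxis, hb]
  have hx : (c q).axis ≠ none := by rw [hb]; simp
  rw [← tailFollowContracted_iff h hx, ← tailFollow_iff h hx, ← inactiveAt_iff h]
  have : coatingTurns pick c q = contractTurns ph (b - (c q).orient) (view c q) := by
    simp only [coatingTurns, turns, hs, hl, coatingAlgorithm]
  rw [this, contractLabel, hl]
  rfl

lemma mem_turns_lead (hpick : IsTieBreak pick) (h : Regular sd pos c) {p} {t : Turn State Flag}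
    (hr : (sketches c p).role = .lead) (hx : (c p).axis = none) :
    t ∈ coatingTurns pick c p ↔ Sees sd (sketches c) (complainers c) p ∧
      ∃ i, edgeAt none i = some (.head, sd (c p).head - (c p).orient) ∧
      ((¬ CanMove sd (sketches c) p ∧
        t = ⟨.particle .lead none, stdFlags .lead none (some i), .idle⟩) ∨
      (CanMove sd (sketches c) p ∧
        t = stdTurn .lead (some (sd (c p).head - (c p).orient)) (.expand i))) := by
  have hl := edgeAt_surfaceLabel hpick h.line h.toReadable hx (h.lead_mem p hr)
  have hx' := localAxis_of_none hx
  rw [← seesIndicator_iff h.toReadable hx, ← canExpand_iff h.toReadable hl]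
  simp only [coatingTurns, turns, (h.consistent p).state_lead hr, hx', coatingAlgorithm,
    contractedLeadTurns]
  rw [hx'] at hl
  have huniq : ∀ i, edgeAt none i = some (.head, sd (c p).head - (c p).orient) →
      i = surfaceLabel pick (view c p) := fun i hi => edgeAt_inj hi hl
  split_ifs with h1 h2
  · simp only [Set.mem_singleton_iff]
    constructor
    · rintro rfl; exact ⟨h1.2, _, hl, Or.inl ⟨h1.1, rfl⟩⟩
    · rintro ⟨-, i, hi, ⟨-, rfl⟩ | ⟨hc, -⟩⟩
      · rw [huniq i hi]
      · exact absurd hc h1.1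
  · have h3 : CanExpand (view c p) (surfaceLabel pick (view c p)) := by
      by_contra h3; exact h1 ⟨h3, h2⟩
    constructor
    · rintro ⟨d, hd, rfl⟩
      rw [hl] at hd
      obtain rfl : _ = d := by simpa using hd
      exact ⟨h2, _, hl, Or.inr ⟨h3, rfl⟩⟩
    · rintro ⟨-, i, hi, ⟨hc, -⟩ | ⟨-, rfl⟩⟩
      · exact absurd h3 hc
      · rw [huniq i hi]
        exact ⟨_, hl, rfl⟩
  · simp [h2]

end Turns

/-! ### Actions in terms of abstract configurations -/

section Actions

variable {ι : Type*} {c : Config ι State Flag} {sd : Node → Dir} {pos : Node → ℤ}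
  {pick : View → Finset (Fin 10) → Fin 10}

/-- A particle after a turn without a complaint. -/
def fresh (ph : Phase) (o : Dir) (h : Node) (x : Option Dir) : ParticleConfig State Flag :=
  ⟨.particle ph (x.map (· - o)), stdFlags ph (x.map (· - o)) none, h, x, o⟩

lemma consistent_fresh {ph : Phase} (hph : ph ≠ .inactive) (o : Dir) (h : Node) (x : Option Dir) :
    Consistent sd (fresh ph o h x) :=
  ⟨rfl, fun h => absurd h hph, none, rfl, fun _ h => by cases h⟩

lemma not_complains_fresh (ph : Phase) (o : Dir) (h : Node) (x : Option Dir) :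
    ¬ Complains (fresh ph o h x) := by
  rintro ⟨i, f, hf, hc⟩
  obtain rfl := Flag.particle.inj hf
  simp at hc

lemma execute_idle {P : ParticleConfig State Flag} (hx : P.axis = none) (ph : Phase) :
    P.execute (stdTurn ph none .idle) = fresh ph P.orient P.head none := by
  cases P; simp_all [ParticleConfig.execute, stdTurn, fresh]

lemma expandTo_eq {P : ParticleConfig State Flag} (hx : P.axis = none) {i : Fin 10} {g : Dir}
    (hi : edgeAt none i = some (.head, g - P.orient)) : P.expandTo i = some (P.head + vec g, g) := by
  simp [ParticleConfig.expandTo, hx, hi]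

lemma execute_expand {P : ParticleConfig State Flag} (hx : P.axis = none) (ph : Phase)
    {i : Fin 10} {g : Dir} (hi : edgeAt none i = some (.head, g - P.orient)) :
    P.execute (stdTurn ph (some (g - P.orient)) (.expand i)) =
      fresh ph P.orient (P.head + vec g) (some g) := by
  have := expandTo_eq hx hi
  cases P; simp_all [ParticleConfig.execute, stdTurn, fresh]

lemma contractTo_eq {P : ParticleConfig State Flag} {b : Dir} (hb : P.axis = some b) :
    P.contractTo (contractLabel P b) = some P.head := by
  have hl : P.localAxis = some (b - P.orient) := by simp [ParticleConfig.localAxis, hb]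
  have h : edgeAt P.localAxis (contractLabel P b) = some (.head, b - P.orient) := by
    refine edgeAt_labelOf ?_
    rw [hl]
    generalize b - P.orient = a
    revert a; decide
  simp [ParticleConfig.contractTo, hb, h, ParticleConfig.nodeAt]

lemma execute_contract {P : ParticleConfig State Flag} {b : Dir} (hb : P.axis = some b) (ph : Phase)
    {m : Movement} (hm : m = .contract (contractLabel P b) ∨
      m = .handoverContract (contractLabel P b)) :
    P.execute (stdTurn ph none m) = fresh ph P.orient P.head none := by
  have := contractTo_eq hb
  rcases hm with rfl | rfl <;> cases P <;> simp_all [ParticleConfig.execute, stdTurn, fresh]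

open Classical in
lemma sketches_update (c : Config ι State Flag) (p : ι) (P : ParticleConfig State Flag) :
    sketches (Function.update c p P) = Function.update (sketches c) p (sketch P) := by
  funext r
  by_cases h : r = p
  · subst h; simp [sketches]
  · simp [sketches, h]

open Classical in
lemma complainers_update {P : ParticleConfig State Flag} (hP : ¬ Complains P)
    (c : Config ι State Flag) (p : ι) :
    complainers (Function.update c p P) = complainers c \ {p} := by
  ext r
  by_cases h : r = p
  · subst h; simp [complainers, hP]
  · simp [complainers, h]

open Classical in
lemma complainers_update_of_complains {P : ParticleConfig State Flag} (hP : Complains P)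
    (c : Config ι State Flag) (p : ι) :
    complainers (Function.update c p P) = insert p (complainers c) := by
  ext r
  by_cases h : r = p
  · subst h; simp [complainers, hP]
  · simp [complainers, h]

open Classical in
lemma consistent_update {P : ParticleConfig State Flag} (hP : Consistent sd P)
    (hc : ∀ r, Consistent sd (c r)) (p r : ι) : Consistent sd (Function.update c p P r) := by
  by_cases h : r = p
  · subst h; simpa using hP
  · simpa [h] using hc r

lemma active_of_expanded (h : Readable sd c) {q} (hx : (c q).axis ≠ none) :
    (sketches c q).Active :=
  ⟨fun ho => hx (contracted_of_object h ho), fun hi => hx (contracted_of_inactive h hi)⟩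

lemma role_of_state (o : Dir) (ph : Phase) (x y : Option Dir) :
    roleOf o (.particle ph x) = roleOf o (.particle ph y) := by
  cases ph <;> rfl

variable (pick) in
/-- An action that is enabled in the coating algorithm. -/
abbrev CoatingEnabled (c : Config ι State Flag) (act : Action ι State Flag) : Prop :=
  Enabled (coatingAlgorithm pick) c act

open Classical in
theorem exists_aStep_solo (hpick : IsTieBreak pick) (h : Regular sd pos c) {p : ι}
    {t : Turn State Flag} (ht : CoatingEnabled pick c (.solo p t)) :
    AStep (objectNodes c) sd (sketches c) (complainers c) {p}
        (sketches (perform c (.solo p t))) (complainers (perform c (.solo p t))) ∧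
      ∀ r, Consistent sd (perform c (.solo p t) r) := by
  have hread := h.toReadable
  obtain ⟨ht, hm⟩ := ht
  replace ht : t ∈ coatingTurns pick c p := ht
  have main {ph : Phase} (hph : ph ≠ .inactive) {v : Node} {x : Option Dir}
      (he : (c p).execute t = fresh ph (c p).orient v x)
      (hstep : AStep (objectNodes c) sd (sketches c) (complainers c) {p}
        (Function.update (sketches c) p ⟨roleOf (c p).orient (.particle ph none), v, x⟩)
        (complainers c \ {p})) :
      AStep (objectNodes c) sd (sketches c) (complainers c) {p}
        (sketches (perform c (.solo p t))) (complainers (perform c (.solo p t))) ∧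
      ∀ r, Consistent sd (perform c (.solo p t) r) := by
    simp only [perform, he]
    rw [sketches_update, complainers_update (not_complains_fresh _ _ _ _)]
    refine ⟨?_, consistent_update (consistent_fresh hph _ _ _) h.consistent p⟩
    simp only [sketch, fresh]
    rw [role_of_state _ _ _ none]
    exact hstep
  by_cases hx : (c p).axis = none
  · cases hr : (sketches c p).role with
    | object => rw [turns_object hr] at ht; cases ht
    | inactive =>
      by_cases hs : OnSurf (objectNodes c) (c p).head
      · rw [turns_inactive_surface hread hr hs] at ht
        obtain rfl : t = _ := ht
        exact main (by simp) (execute_idle hx _) (.toLead p (.inl hr) hx hs)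
      · obtain ⟨g, r, h1, h2, rfl⟩ := mem_turns_inactive hpick hread hr hs ht
        refine main (by simp) (execute_idle hx _) ?_
        have := AStep.toFollow (C := objectNodes c) (sd := sd) (K := complainers c)
          p g r hr hx hs h1 h2
        simp only [roleOf, add_sub_cancel]
        exact this
    | follow g =>
      by_cases hs : OnSurf (objectNodes c) (c p).head
      · rw [turns_follow_surface hread hr hx hs] at ht
        obtain rfl : t = _ := ht
        exact main (by simp) (execute_idle hx _) (.toLead p (.inr ⟨g, hr⟩) hx hs)
      · obtain ⟨q, b, h1, h2, rfl⟩ := (mem_turns_follow hread hr hx hs).1 ht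
        obtain ⟨w, d, hw, hn⟩ := hm
        rw [expandTo_eq hx (edgeAt_labelOf rfl)] at hw
        obtain ⟨rfl, rfl⟩ : _ = w ∧ _ = d := by simpa using hw
        exact absurd ⟨q, h2⟩ hn
    | lead =>
      obtain ⟨hv, i, hi, ⟨hc, rfl⟩ | ⟨hc, rfl⟩⟩ := (mem_turns_lead hpick h hr hx).1 ht
      · have hstate := (h.consistent p).state_lead hr
        have he : (c p).execute ⟨.particle .lead none, stdFlags .lead none (some i), .idle⟩ =
            ⟨.particle .lead none, stdFlags .lead none (some i), (c p).head, none, (c p).orient⟩ := by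
          rw [← hx]; simp [ParticleConfig.execute]
        simp only [perform, he]
        rw [sketches_update, complainers_update_of_complains ⟨i, _, rfl, by simp⟩]
        refine ⟨?_, consistent_update (by
          exact ⟨rfl, fun _ => rfl, some i, rfl, by rintro j ⟨⟩; exact ⟨rfl, rfl, hi⟩⟩)
          h.consistent p⟩
        have : Function.update (sketches c) p (sketch ⟨.particle .lead none,
            stdFlags .lead none (some i), (c p).head, none, (c p).orient⟩) = sketches c := by
          rw [Function.update_eq_self_iff]
          ext1
          · exact hr.symm
          · rfl
          · exact hx.symm
        rw [this]
        exact .complain p hr hx hv hc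
      · obtain ⟨w, d, hw, hn⟩ := hm
        rw [expandTo_eq hx hi] at hw
        obtain ⟨rfl, rfl⟩ : _ = w ∧ _ = d := by simpa using hw
        exact main (by simp) (execute_expand hx _ hi) (.expand p hr hx hv hn)
  · obtain ⟨b, hb⟩ := Option.ne_none_iff_exists'.1 hx
    have hact := active_of_expanded hread hx
    obtain ⟨ph, hph, hs⟩ := (h.consistent p).state_active hact
    rcases (mem_turns_expanded hread hb hph hs).1 ht with ⟨-, rfl⟩ | ⟨h1, h2, rfl⟩
    · exact absurd hm (by simp [stdTurn])
    · refine main hph (execute_contract hb _ (.inl rfl)) ?_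
      have hrole : (sketches c p).role = roleOf (c p).orient (.particle ph none) := by
        rw [role_of_state _ ph none (c p).localAxis, ← hs]; rfl
      rw [← hrole]
      exact .contract p hx hact h1 h2

open Classical in
theorem exists_aStep_handover (hpick : IsTieBreak pick) (h : Regular sd pos c) {p q : ι}
    {s t : Turn State Flag} (ht : CoatingEnabled pick c (.handover p s q t)) :
    AStep (objectNodes c) sd (sketches c) (complainers c) {p, q}
        (sketches (perform c (.handover p s q t)))
        (complainers (perform c (.handover p s q t))) ∧
      ∀ r, Consistent sd (perform c (.handover p s q t) r) := by
  have hread := h.toReadable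
  obtain ⟨hpq, hs, ht, i, j, w, d, v, hsm, htm, hw, hv, hwq, hwv⟩ := ht
  replace hs : s ∈ coatingTurns pick c p := hs
  replace ht : t ∈ coatingTurns pick c q := ht
  have hxp : (c p).axis = none := by
    unfold ParticleConfig.expandTo at hw
    split at hw
    · assumption
    · cases hw
  have hxq : (c q).axis ≠ none := by
    intro hxq
    unfold ParticleConfig.contractTo at hv
    rw [hxq] at hv
    cases hv
  obtain ⟨b, hb⟩ := Option.ne_none_iff_exists'.1 hxq
  have hact := active_of_expanded hread hxq
  obtain ⟨ph, hph, hqs⟩ := (h.consistent q).state_active hact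
  have hq : (c q).execute t = fresh ph (c q).orient (c q).head none ∧ v = (c q).head ∧
      MayContract (sketches c) q := by
    rcases (mem_turns_expanded hread hb hph hqs).1 ht with ⟨h1, rfl⟩ | ⟨h1, h2, rfl⟩
    · refine ⟨execute_contract hb _ (.inr rfl), ?_, .inl h1⟩
      obtain rfl : contractLabel (c q) b = j := by simpa [stdTurn] using htm
      rw [contractTo_eq hb] at hv
      exact (Option.some.inj hv).symm
    · refine ⟨execute_contract hb _ (.inl rfl), ?_, .inr ⟨h1, h2⟩⟩
      obtain rfl : contractLabel (c q) b = j := by simpa [stdTurn] using htm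
      rw [contractTo_eq hb] at hv
      exact (Option.some.inj hv).symm
  obtain ⟨hqe, rfl, hmay⟩ := hq
  have hwt : w = (sketches c q).tail := hwq.resolve_left hwv
  have hrole : (sketches c q).role = roleOf (c q).orient (.particle ph none) := by
    rw [role_of_state _ ph none (c q).localAxis, ← hqs]; rfl
  have main {ph' : Phase} (hph' : ph' ≠ .inactive) {v : Node} {x : Option Dir}
      (he : (c p).execute s = fresh ph' (c p).orient v x)
      (hstep : AStep (objectNodes c) sd (sketches c) (complainers c) {p, q}
        (Function.update (Function.update (sketches c) p
          ⟨roleOf (c p).orient (.particle ph' none), v, x⟩)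
          q ⟨(sketches c q).role, (sketches c q).head, none⟩)
        (complainers c \ {p, q})) :
      AStep (objectNodes c) sd (sketches c) (complainers c) {p, q}
        (sketches (perform c (.handover p s q t)))
        (complainers (perform c (.handover p s q t))) ∧
      ∀ r, Consistent sd (perform c (.handover p s q t) r) := by
    simp only [perform, he, hqe]
    rw [sketches_update, sketches_update, complainers_update (not_complains_fresh _ _ _ _),
      complainers_update (not_complains_fresh _ _ _ _), sdiff_sdiff]
    refine ⟨?_, consistent_update (consistent_fresh hph _ _ _)
      (consistent_update (consistent_fresh hph' _ _ _) h.consistent p) q⟩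
    rw [hrole] at hstep
    simp only [sketch, fresh]
    rw [role_of_state _ _ _ none, role_of_state _ _ _ none]
    exact hstep
  cases hr : (sketches c p).role with
  | object => rw [turns_object hr] at hs; cases hs
  | inactive =>
    exfalso
    by_cases hsurf : OnSurf (objectNodes c) (c p).head
    · rw [turns_inactive_surface hread hr hsurf] at hs
      obtain rfl : s = _ := hs
      cases hsm
    · obtain ⟨g, r, h1, h2, rfl⟩ := mem_turns_inactive hpick hread hr hsurf hs
      cases hsm
  | follow g =>
    by_cases hsurf : OnSurf (objectNodes c) (c p).head
    · rw [turns_follow_surface hread hr hxp hsurf] at hs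
      obtain rfl : s = _ := hs
      cases hsm
    · obtain ⟨q', b', h1, h2, rfl⟩ := (mem_turns_follow hread hr hxp hsurf).1 hs
      obtain rfl : labelOf none (.head, g - (c p).orient) = i := by simpa [stdTurn] using hsm
      rw [expandTo_eq hxp (edgeAt_labelOf rfl)] at hw
      obtain ⟨rfl, rfl⟩ : _ = w ∧ _ = d := by simpa using hw
      obtain rfl := hread.disjoint q q' _ hwq h2
      obtain rfl : b = b' := Option.some.inj (hb.symm.trans h1)
      refine main (by simp) (execute_expand hxp _ (edgeAt_labelOf rfl)) ?_
      have := AStep.handoverFollow (C := objectNodes c) (sd := sd) (K := complainers c)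
          p q g b hpq hr hxp hsurf hb hact hwt
      simp only [roleOf, add_sub_cancel]
      exact this
  | lead =>
    obtain ⟨hsees, i', hi', ⟨hc, rfl⟩ | ⟨hc, rfl⟩⟩ := (mem_turns_lead hpick h hr hxp).1 hs
    · cases hsm
    · obtain rfl : i' = i := by simpa [stdTurn] using hsm
      rw [expandTo_eq hxp hi'] at hw
      obtain ⟨rfl, rfl⟩ : _ = w ∧ _ = d := by simpa using hw
      exact main (by simp) (execute_expand hxp _ hi')
        (.handoverLead p q hpq hr hxp hsees hxq hact hwt hmay)

/-- Every enabled action is a step of the abstract system. -/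
theorem exists_aStep (hpick : IsTieBreak pick) (h : Regular sd pos c) {act : Action ι State Flag}
    (ha : CoatingEnabled pick c act) : ∃ S, (∀ r, act.Affects r ↔ r ∈ S) ∧
      AStep (objectNodes c) sd (sketches c) (complainers c) S
        (sketches (perform c act)) (complainers (perform c act)) ∧
      ∀ r, Consistent sd (perform c act r) := by
  cases act with
  | solo p t => exact ⟨{p}, fun r => Iff.rfl, exists_aStep_solo hpick h ha⟩
  | handover p s q t => exact ⟨{p, q}, fun r => Iff.rfl, exists_aStep_handover hpick h ha⟩

lemma exists_turn_of_mayContract (h : Readable sd c) {q} (hx : (c q).axis ≠ none)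
    (hm : MayContract (sketches c) q) : ∃ t ∈ coatingTurns pick c q, ∃ j,
      (t.move = .contract j ∨ t.move = .handoverContract j) ∧
      (c q).contractTo j = some (c q).head := by
  obtain ⟨b, hb⟩ := Option.ne_none_iff_exists'.1 hx
  obtain ⟨ph, hph, hs⟩ := (h.consistent q).state_active (active_of_expanded h hx)
  rcases hm with hm | ⟨h1, h2⟩
  · exact ⟨_, (mem_turns_expanded h hb hph hs).2 (.inl ⟨hm, rfl⟩), _, .inr rfl, contractTo_eq hb⟩
  · exact ⟨_, (mem_turns_expanded h hb hph hs).2 (.inr ⟨h1, h2, rfl⟩), _, .inl rfl,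
      contractTo_eq hb⟩

lemma tail_ne_head {x : Sketch} (hx : x.axis ≠ none) : x.tail ≠ x.head := by
  obtain ⟨b, hb⟩ := Option.ne_none_iff_exists'.1 hx
  rw [Sketch.tail_of_some hb]
  exact fun h => vec_ne_zero b (sub_eq_self.1 h)

/-- Every step of the abstract system comes from an enabled action. -/
theorem exists_enabled_of_aStep (hpick : IsTieBreak pick) (h : Regular sd pos c) {S : Set ι}
    {a' : ι → Sketch} {K' : Set ι}
    (hstep : AStep (objectNodes c) sd (sketches c) (complainers c) S a' K') :
    ∃ act, CoatingEnabled pick c act ∧ ∀ r, act.Affects r ↔ r ∈ S := by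
  have hread := h.toReadable
  cases hstep with
  | toLead p hr hx hs =>
    refine ⟨.solo p (stdTurn .lead none .idle), ⟨?_, trivial⟩, fun r => Iff.rfl⟩
    change _ ∈ coatingTurns pick c p
    rcases hr with hr | ⟨g, hr⟩
    · rw [turns_inactive_surface hread hr hs]; rfl
    · rw [turns_follow_surface hread hr hx hs]; rfl
  | toFollow p g r hr hx hs ha hg =>
    obtain ⟨t, ht⟩ := turns_inactive_nonempty hpick hread hr hs ha hg
    obtain ⟨g', r', h1, h2, rfl⟩ := mem_turns_inactive hpick hread hr hs ht
    exact ⟨.solo p _, ⟨ht, trivial⟩, fun r => Iff.rfl⟩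
  | complain p hr hx hv hm =>
    have hi := edgeAt_labelOf (x := none) (e := .head) (d := sd (c p).head - (c p).orient) rfl
    exact ⟨.solo p _, ⟨(mem_turns_lead hpick h hr hx).2 ⟨hv, _, hi, .inl ⟨hm, rfl⟩⟩, trivial⟩,
      fun r => Iff.rfl⟩
  | expand p hr hx hv hf =>
    have hi := edgeAt_labelOf (x := none) (e := .head) (d := sd (c p).head - (c p).orient) rfl
    exact ⟨.solo p _, ⟨(mem_turns_lead hpick h hr hx).2 ⟨hv, _, hi, .inr ⟨.inl hf, rfl⟩⟩,
      ⟨_, _, expandTo_eq hx hi, hf⟩⟩, fun r => Iff.rfl⟩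
  | contract q hx hq ht hi =>
    obtain ⟨b, hb⟩ := Option.ne_none_iff_exists'.1 hx
    obtain ⟨ph, hph, hs⟩ := (h.consistent q).state_active hq
    exact ⟨.solo q _, ⟨(mem_turns_expanded hread hb hph hs).2 (.inr ⟨ht, hi, rfl⟩),
      ⟨_, contractTo_eq hb⟩⟩, fun r => Iff.rfl⟩
  | handoverLead p q hpq hr hx hv hxq hq hpt hm =>
    have hi := edgeAt_labelOf (x := none) (e := .head) (d := sd (c p).head - (c p).orient) rfl
    obtain ⟨t, ht, j, hj, hcj⟩ := exists_turn_of_mayContract (pick := pick) hread hxq hm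
    refine ⟨.handover p _ q t, ⟨hpq, (mem_turns_lead hpick h hr hx).2
      ⟨hv, _, hi, .inr ⟨.inr ⟨q, hxq, hpt.symm⟩, rfl⟩⟩, ht, _, j, _, _, _, rfl, hj,
      expandTo_eq hx hi, hcj, .inr hpt, ?_⟩, fun r => Iff.rfl⟩
    change next sd (sketches c p).head ≠ _
    rw [hpt]
    exact tail_ne_head hxq
  | handoverFollow p q g b hpq hr hx hs hxq hq hpt =>
    have hxq' : (c q).axis ≠ none := by
      have : (c q).axis = some b := hxq
      rw [this]; simp
    obtain ⟨t, ht, j, hj, hcj⟩ := exists_turn_of_mayContract (pick := pick) hread hxq'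
      (.inl ⟨p, hx, g, hr, hpt⟩)
    refine ⟨.handover p _ q t, ⟨hpq, (mem_turns_follow hread hr hx hs).2
      ⟨q, b, hxq, .inr hpt, rfl⟩, ht, _, j, _, _, _, rfl, hj,
      expandTo_eq hx (edgeAt_labelOf rfl), hcj, .inr hpt, ?_⟩, fun r => Iff.rfl⟩
    change (sketches c p).head + vec g ≠ _
    rw [hpt]
    exact tail_ne_head hxq'

end Actions

/-! ### Invariants of the abstract system -/

section Invariants

variable {ι : Type*} {C : Set Node} {sd : Node → Dir} {pos : Node → ℤ} {a a' : ι → Sketch}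
  {K K' S : Set ι}

/-- The particle is a follower. -/
def Sketch.IsFollower (x : Sketch) : Prop := ∃ g, x.role = .follow g

/-- The invariants of an abstract configuration with object `C`. The directions of the followers
point to active particles (`target`) without forming a cycle among the followers (`rank`), leaders
stay on the surface, and every nonempty set of nodes of inactive particles has an occupied neighbor
outside of this set (`cut`). The latter keeps inactive particles connected to other particles: an
expanded particle only gives up a node with an inactive neighbor in a handover. -/
structure Inv (C : Set Node) (a : ι → Sketch) : Prop where
  disjoint : ∀ p q v, v ∈ (a p).occ → v ∈ (a q).occ → p = q
  object : ∀ v, v ∈ C ↔ ∃ p, (a p).role = .object ∧ v = (a p).head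
  contracted : ∀ p, (a p).role = .object ∨ (a p).role = .inactive → (a p).axis = none
  target : ∀ p v, (a p).Points v → ∃ r, r ≠ p ∧ (a r).Active ∧ v ∈ (a r).occ
  rank : ∃ rk : ι → ℕ, ∀ p r v, (a p).Points v → v ∈ (a r).occ → (a r).IsFollower → rk r < rk p
  lead_mem : ∀ p, (a p).role = .lead → ∀ v ∈ (a p).occ, v ∈ surface C
  cut : ∀ T ⊆ {v | ∃ p, (a p).role = .inactive ∧ v = (a p).head}, T.Nonempty →
    ∃ v ∈ T, ∃ z ∈ covered a, z ∉ T ∧ triGraph.Adj v z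

lemma Sketch.Points.isFollower {x : Sketch} {v : Node} (h : x.Points v) : x.IsFollower :=
  ⟨_, h.choose_spec.1⟩

lemma Sketch.IsFollower.active {x : Sketch} (h : x.IsFollower) : x.Active := by
  obtain ⟨g, hg⟩ := h
  exact ⟨by simp [hg], by simp [hg]⟩

lemma active_of_lead {x : Sketch} (h : x.role = .lead) : x.Active := ⟨by simp [h], by simp [h]⟩

lemma Sketch.Active.cases {x : Sketch} (h : x.Active) : x.IsFollower ∨ x.role = .lead := by
  obtain ⟨h1, h2⟩ := h
  cases hr : x.role with
  | object => exact absurd hr h1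
  | inactive => exact absurd hr h2
  | follow g => exact .inl ⟨g, hr⟩
  | lead => exact .inr rfl

lemma Sketch.IsFollower.ne_lead {x : Sketch} (h : x.IsFollower) : x.role ≠ .lead := by
  obtain ⟨g, hg⟩ := h; simp [hg]

/-- The invariants carry over if the object stays as it is, no particle gets inactive, and no node
next to an inactive particle gets free: `object`, `contracted` and `cut` do not need to be checked
for each kind of step. -/
lemma Inv.of_change (h : Inv C a) (hobj : ∀ r, ¬ (a r).Active → ¬ (a' r).Active → a' r = a r)
    (hobj' : ∀ r, (a r).Active ∨ (a r).role = .inactive → (a' r).role ≠ .object)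
    (hact : ∀ r, (a r).role = .object ∨ (a r).Active → (a' r).role ≠ .inactive)
    (hobj'' : ∀ r, (a r).role = .object → a' r = a r)
    (hcov : ∀ z ∈ covered a, z ∉ covered a' → ∀ r, (a r).role = .inactive →
      ¬ triGraph.Adj (a r).head z)
    (hdisj : ∀ p q v, v ∈ (a' p).occ → v ∈ (a' q).occ → p = q)
    (htarget : ∀ p v, (a' p).Points v → ∃ r, r ≠ p ∧ (a' r).Active ∧ v ∈ (a' r).occ)
    (hrank : ∃ rk : ι → ℕ, ∀ p r v, (a' p).Points v → v ∈ (a' r).occ → (a' r).IsFollower →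
      rk r < rk p)
    (hlead : ∀ p, (a' p).role = .lead → ∀ v ∈ (a' p).occ, v ∈ surface C) : Inv C a' := by
  have hin (r : ι) (hr : (a' r).role = .inactive) : a' r = a r ∧ (a r).role = .inactive := by
    have h1 : (a r).role = .inactive := by
      by_contra h1
      refine hact r ?_ hr
      by_cases h2 : (a r).role = .object
      · exact .inl h2
      · exact .inr ⟨h2, h1⟩
    exact ⟨hobj r (fun h => h.2 h1) (fun h => h.2 hr), h1⟩
  have hob (r : ι) (hr : (a' r).role = .object) : (a r).role = .object := by
    by_contra h1
    refine hobj' r ?_ hr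
    by_cases h2 : (a r).role = .inactive
    · exact .inr h2
    · exact .inl ⟨h1, h2⟩
  refine ⟨hdisj, fun v => ?_, ?_, htarget, hrank, hlead, ?_⟩
  · rw [h.object]
    refine exists_congr fun p => ?_
    constructor
    · rintro ⟨h1, rfl⟩
      rw [hobj'' p h1]
      exact ⟨h1, rfl⟩
    · rintro ⟨h1, rfl⟩
      have := hob p h1
      rw [hobj'' p this]
      exact ⟨this, rfl⟩
  · rintro p (hp | hp)
    · rw [hobj'' p (hob p hp)]
      exact h.contracted p (.inl (hob p hp))
    · rw [(hin p hp).1]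
      exact h.contracted p (.inr (hin p hp).2)
  · intro T hT hne
    have hT' : T ⊆ {v | ∃ p, (a p).role = .inactive ∧ v = (a p).head} := by
      intro v hv
      obtain ⟨p, hp, rfl⟩ := hT hv
      exact ⟨p, (hin p hp).2, by rw [(hin p hp).1]⟩
    obtain ⟨v, hv, z, hz, hzT, hvz⟩ := h.cut T hT' hne
    refine ⟨v, hv, z, ?_, hzT, hvz⟩
    by_contra hz'
    obtain ⟨p, hp, rfl⟩ := hT' hv
    exact hcov z hz hz' p hp hvz

open Classical in
/-- A particle that becomes a leader or a follower without moving. -/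
lemma Inv.update_role (h : Inv C a) {p : ι} {ρ : Role} (hx : (a p).axis = none)
    (hr : (a p).role = .inactive ∨ (a p).IsFollower)
    (hρ : (ρ = .lead ∧ (a p).head ∈ surface C) ∨ ((a p).role = .inactive ∧
      ∃ g r, ρ = .follow g ∧ (a r).Active ∧ (a p).head + vec g ∈ (a r).occ)) :
    Inv C (Function.update a p ⟨ρ, (a p).head, none⟩) := by
  have hno : (a p).role ≠ .object := by
    rcases hr with hr | ⟨g, hr⟩ <;> simp [hr]
  have hρa : ρ ≠ .object ∧ ρ ≠ .inactive := by
    rcases hρ with ⟨rfl, -⟩ | ⟨-, g, r, rfl, -⟩ <;> simp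
  set a' := Function.update a p ⟨ρ, (a p).head, none⟩ with ha'
  have hp : a' p = ⟨ρ, (a p).head, none⟩ := by simp [ha']
  have hne (r : ι) (hr : r ≠ p) : a' r = a r := by simp [ha', hr]
  have hocc (r : ι) : (a' r).occ = (a r).occ := by
    by_cases hrp : r = p
    · subst hrp; rw [hp, Sketch.occ_of_none rfl, Sketch.occ_of_none hx]
    · rw [hne r hrp]
  have hactp : (a' p).Active := by rw [hp]; exact hρa
  have hact (r : ι) (hr : (a r).Active) : (a' r).Active := by
    by_cases hrp : r = p
    · subst hrp; exact hactp
    · rwa [hne r hrp]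
  refine h.of_change ?_ ?_ ?_ ?_ ?_ ?_ ?_ ?_ ?_
  · intro r _ h2
    by_cases hrp : r = p
    · subst hrp; exact absurd hactp h2
    · exact hne r hrp
  · intro r hr'
    by_cases hrp : r = p
    · subst hrp; exact hactp.1
    · rw [hne r hrp]; rcases hr' with h | h
      · exact h.1
      · simp [h]
  · intro r hr'
    by_cases hrp : r = p
    · subst hrp; exact hactp.2
    · rw [hne r hrp]; rcases hr' with h | h
      · simp [h]
      · exact h.2
  · intro r hr'
    exact hne r (by rintro rfl; exact hno hr')
  · rintro z ⟨r, hz⟩ hz'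
    exact absurd ⟨r, by rwa [hocc]⟩ hz'
  · intro r s v h1 h2
    rw [hocc] at h1 h2
    exact h.disjoint r s v h1 h2
  · intro r v hv
    by_cases hrp : r = p
    · subst hrp
      rw [hp] at hv
      obtain ⟨g, hg, rfl⟩ := hv
      rcases hρ with ⟨rfl, -⟩ | ⟨hi, g', s, rfl, hs, hs'⟩
      · cases hg
      · cases hg
        exact ⟨s, by rintro rfl; exact hs.2 hi, hact s hs, by rwa [hocc]⟩
    · rw [hne r hrp] at hv
      obtain ⟨s, h1, h2, h3⟩ := h.target r v hv
      exact ⟨s, h1, hact s h2, by rwa [hocc]⟩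
  · obtain ⟨rk, hrk⟩ := h.rank
    rcases hρ with ⟨rfl, -⟩ | ⟨hi, g, s, rfl, hs, hs'⟩
    · refine ⟨rk, fun r t v h1 h2 h3 => ?_⟩
      have hrp : r ≠ p := by
        rintro rfl; rw [hp] at h1; exact h1.isFollower.ne_lead rfl
      have htp : t ≠ p := by
        rintro rfl; rw [hp] at h3; exact h3.ne_lead rfl
      rw [hne r hrp] at h1
      rw [hne t htp] at h2 h3
      exact hrk r t v h1 h2 h3
    · have hsp : s ≠ p := by rintro rfl; exact hs.2 hi
      refine ⟨Function.update rk p (rk s + 1), fun r t v h1 h2 h3 => ?_⟩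
      rw [hocc] at h2
      by_cases hrp : r = p
      · subst hrp
        rw [hp] at h1
        obtain ⟨g', hg, rfl⟩ := h1
        cases hg
        obtain rfl := h.disjoint s t _ hs' h2
        simp [hsp]
      · rw [hne r hrp] at h1
        have htp : t ≠ p := by
          rintro rfl
          obtain ⟨t', -, h5, h6⟩ := h.target r v h1
          obtain rfl := h.disjoint t t' v h2 h6
          exact h5.2 hi
        rw [hne t htp] at h3
        simpa [hrp, htp] using hrk r t v h1 h2 h3
  · intro r hr' v hv
    rw [hocc] at hv
    by_cases hrp : r = p
    · subst hrp
      rw [hp] at hr'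
      rcases hρ with ⟨-, hs⟩ | ⟨-, g, s, rfl, -⟩
      · rw [Sketch.occ_of_none hx] at hv
        obtain rfl : v = _ := hv
        exact hs
      · cases hr'
    · rw [hne r hrp] at hr'
      exact h.lead_mem r hr' v hv

open Classical in
lemma Inv.update_expand (h : Inv C a) {p : ι} {g : Dir} (hx : (a p).axis = none)
    (hr : (a p).role = .lead) (hw : (a p).head + vec g ∈ surface C)
    (hfree : (a p).head + vec g ∉ covered a) :
    Inv C (Function.update a p ⟨.lead, (a p).head + vec g, some g⟩) := by
  set a' := Function.update a p ⟨.lead, (a p).head + vec g, some g⟩ with ha'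
  have hp : a' p = ⟨.lead, (a p).head + vec g, some g⟩ := by simp [ha']
  have hne (r : ι) (hr : r ≠ p) : a' r = a r := by simp [ha', hr]
  have hactp : (a' p).Active := by rw [hp]; exact active_of_lead rfl
  have hact (r : ι) (hr : (a r).Active) : (a' r).Active := by
    by_cases hrp : r = p
    · subst hrp; exact hactp
    · rwa [hne r hrp]
  have hoccp (v : Node) : v ∈ (a' p).occ ↔ v = (a p).head + vec g ∨ v = (a p).head := by
    rw [hp, Sketch.mem_occ, Sketch.tail_of_some rfl, add_sub_cancel_right]
  have hocc (r : ι) : (a r).occ ⊆ (a' r).occ := by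
    intro v hv
    by_cases hrp : r = p
    · subst hrp
      rw [Sketch.occ_of_none hx] at hv
      exact (hoccp v).2 (.inr hv)
    · rwa [hne r hrp]
  refine h.of_change ?_ ?_ ?_ ?_ ?_ ?_ ?_ ?_ ?_
  · intro r _ h2
    by_cases hrp : r = p
    · subst hrp; exact absurd hactp h2
    · exact hne r hrp
  · intro r hr'
    by_cases hrp : r = p
    · subst hrp; exact hactp.1
    · rw [hne r hrp]; rcases hr' with h | h
      · exact h.1
      · simp [h]
  · intro r hr'
    by_cases hrp : r = p
    · subst hrp; exact hactp.2
    · rw [hne r hrp]; rcases hr' with h | h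
      · simp [h]
      · exact h.2
  · intro r hr'
    exact hne r (by rintro rfl; rw [hr] at hr'; cases hr')
  · rintro z ⟨r, hz⟩ hz'
    exact absurd ⟨r, hocc r hz⟩ hz'
  · have key (r : ι) (hrp : r ≠ p) (v : Node) (h1 : v ∈ (a' p).occ) (h2 : v ∈ (a' r).occ) :
        False := by
      rw [hne r hrp] at h2
      rcases (hoccp v).1 h1 with rfl | rfl
      · exact hfree ⟨r, h2⟩
      · exact hrp (h.disjoint r p _ h2 (Sketch.head_mem_occ _))
    intro r s v h1 h2
    by_cases hrp : r = p
    · by_contra hrs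
      subst hrp
      exact key s (Ne.symm hrs) v h1 h2
    · by_cases hsp : s = p
      · subst hsp; exact (key r hrp v h2 h1).elim
      · rw [hne r hrp] at h1
        rw [hne s hsp] at h2
        exact h.disjoint r s v h1 h2
  · intro r v hv
    have hrp : r ≠ p := by
      rintro rfl; rw [hp] at hv; exact hv.isFollower.ne_lead rfl
    rw [hne r hrp] at hv
    obtain ⟨s, h1, h2, h3⟩ := h.target r v hv
    exact ⟨s, h1, hact s h2, hocc s h3⟩
  · obtain ⟨rk, hrk⟩ := h.rank
    refine ⟨rk, fun r t v h1 h2 h3 => ?_⟩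
    have hrp : r ≠ p := by
      rintro rfl; rw [hp] at h1; exact h1.isFollower.ne_lead rfl
    have htp : t ≠ p := by
      rintro rfl; rw [hp] at h3; exact h3.ne_lead rfl
    rw [hne r hrp] at h1
    rw [hne t htp] at h2 h3
    exact hrk r t v h1 h2 h3
  · intro r hr' v hv
    by_cases hrp : r = p
    · subst hrp
      rcases (hoccp v).1 hv with rfl | rfl
      · exact hw
      · exact h.lead_mem r hr _ (Sketch.head_mem_occ _)
    · rw [hne r hrp] at hr' hv
      exact h.lead_mem r hr' v hv

open Classical in
lemma Inv.update_contract (h : Inv C a) {q : ι} (hq : (a q).Active) (ht : ¬ TailFollowed a q)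
    (hi : ¬ NearInactive a q) :
    Inv C (Function.update a q ⟨(a q).role, (a q).head, none⟩) := by
  set a' := Function.update a q ⟨(a q).role, (a q).head, none⟩ with ha'
  have hq' : a' q = ⟨(a q).role, (a q).head, none⟩ := by simp [ha']
  have hne (r : ι) (hr : r ≠ q) : a' r = a r := by simp [ha', hr]
  have hrole (r : ι) : (a' r).role = (a r).role := by
    by_cases hrq : r = q
    · subst hrq; rw [hq']
    · rw [hne r hrq]
  have hhead (r : ι) : (a' r).head = (a r).head := by
    by_cases hrq : r = q
    · subst hrq; rw [hq']
    · rw [hne r hrq]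
  have hact (r : ι) : (a' r).Active ↔ (a r).Active := by unfold Sketch.Active; rw [hrole]
  have hpts (r : ι) (v : Node) : (a' r).Points v ↔ (a r).Points v := by
    unfold Sketch.Points; rw [hrole, hhead]
  have hfol (r : ι) : (a' r).IsFollower ↔ (a r).IsFollower := by
    unfold Sketch.IsFollower; rw [hrole]
  have hocc (r : ι) : (a' r).occ ⊆ (a r).occ := by
    intro v hv
    by_cases hrq : r = q
    · subst hrq
      rw [hq', Sketch.occ_of_none rfl] at hv
      exact .inl hv
    · rwa [hne r hrq] at hv
  have hlost (v : Node) (r : ι) (hv : v ∈ (a r).occ) (hv' : v ∉ (a' r).occ) :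
      r = q ∧ v = (a q).tail := by
    by_cases hrq : r = q
    · subst hrq
      refine ⟨rfl, hv.resolve_left ?_⟩
      rintro rfl
      exact hv' (.inl (hhead r).symm)
    · rw [hne r hrq] at hv'
      exact absurd hv hv'
  refine h.of_change ?_ ?_ ?_ ?_ ?_ ?_ ?_ ?_ ?_
  · intro r h1 _
    exact hne r (by rintro rfl; exact h1 hq)
  · intro r hr'
    rw [hrole]
    rcases hr' with h | h
    · exact h.1
    · simp [h]
  · intro r hr'
    rw [hrole]
    rcases hr' with h | h
    · simp [h]
    · exact h.2
  · intro r hr'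
    exact hne r (by rintro rfl; exact hq.1 hr')
  · rintro z ⟨r, hz⟩ hz' s hs hadj
    obtain ⟨rfl, rfl⟩ := hlost z r hz (fun h => hz' ⟨r, h⟩)
    exact hi ⟨s, hs, _, Sketch.tail_mem_occ _, hadj.symm⟩
  · intro r s v h1 h2
    exact h.disjoint r s v (hocc r h1) (hocc s h2)
  · intro r v hv
    rw [hpts] at hv
    obtain ⟨s, h1, h2, h3⟩ := h.target r v hv
    refine ⟨s, h1, (hact s).2 h2, ?_⟩
    by_contra h4
    obtain ⟨rfl, rfl⟩ := hlost v s h3 h4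
    exact ht ⟨r, hv⟩
  · obtain ⟨rk, hrk⟩ := h.rank
    refine ⟨rk, fun r t v h1 h2 h3 => ?_⟩
    exact hrk r t v ((hpts r v).1 h1) (hocc t h2) ((hfol t).1 h3)
  · intro r hr' v hv
    rw [hrole] at hr'
    exact h.lead_mem r hr' v (hocc r hv)

open Classical in
/-- A handover. If `p` is a follower, then it points to the head of `q` afterwards, since its new
direction is the contraction direction `b` of `q`. -/
lemma Inv.update_handover (h : Inv C a) {p q : ι} {g : Dir} {ρ : Role} (hpq : p ≠ q)
    (hx : (a p).axis = none) (hxq : (a q).axis ≠ none) (hq : (a q).Active) (hpa : (a p).Active)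
    (hw : (a p).head + vec g = (a q).tail)
    (hρ : ((a p).role = .lead ∧ ρ = .lead ∧ (a p).head + vec g ∈ surface C) ∨
      ((a p).role = .follow g ∧ ∃ b, (a q).axis = some b ∧ ρ = .follow b)) :
    Inv C (Function.update (Function.update a p ⟨ρ, (a p).head + vec g, some g⟩)
      q ⟨(a q).role, (a q).head, none⟩) := by
  set a' := Function.update (Function.update a p ⟨ρ, (a p).head + vec g, some g⟩)
      q ⟨(a q).role, (a q).head, none⟩ with ha'
  have hp' : a' p = ⟨ρ, (a p).head + vec g, some g⟩ := by simp [ha', hpq]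
  have hq' : a' q = ⟨(a q).role, (a q).head, none⟩ := by simp [ha']
  have hne (r : ι) (hr : r ≠ p) (hr' : r ≠ q) : a' r = a r := by simp [ha', hr, hr']
  have hρa : ρ ≠ .object ∧ ρ ≠ .inactive := by
    rcases hρ with ⟨-, rfl, -⟩ | ⟨-, b, -, rfl⟩ <;> simp
  have hactp : (a' p).Active := by rw [hp']; exact hρa
  have hactq : (a' q).Active := by rw [hq']; exact hq
  have hact (r : ι) (hr : (a r).Active) : (a' r).Active := by
    by_cases hrp : r = p
    · rwa [hrp]
    · by_cases hrq : r = q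
      · rwa [hrq]
      · rwa [hne r hrp hrq]
  have hrole (r : ι) (hrp : r ≠ p) : (a' r).role = (a r).role := by
    by_cases hrq : r = q
    · subst hrq; rw [hq']
    · rw [hne r hrp hrq]
  have hhead (r : ι) (hrp : r ≠ p) : (a' r).head = (a r).head := by
    by_cases hrq : r = q
    · subst hrq; rw [hq']
    · rw [hne r hrp hrq]
  have hoccp (v : Node) : v ∈ (a' p).occ ↔ v = (a q).tail ∨ v = (a p).head := by
    rw [hp', Sketch.mem_occ, Sketch.tail_of_some rfl, add_sub_cancel_right, hw]
  have hoccq (v : Node) : v ∈ (a' q).occ ↔ v = (a q).head := by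
    rw [hq', Sketch.occ_of_none rfl]; rfl
  have hocc (r : ι) (hrp : r ≠ p) : (a' r).occ ⊆ (a r).occ := by
    intro v hv
    by_cases hrq : r = q
    · subst hrq
      exact .inl ((hoccq v).1 hv)
    · rwa [hne r hrp hrq] at hv
  have htail := tail_ne_head hxq
  -- The owner of a node only changes for the tail of `q`, which `p` takes over.
  have hkeep (v : Node) (r : ι) (hv : v ∈ (a r).occ) :
      v ∈ (a' r).occ ∨ (r = q ∧ v = (a q).tail ∧ v ∈ (a' p).occ) := by
    by_cases hrp : r = p
    · subst hrp
      rw [Sketch.occ_of_none hx] at hv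
      exact .inl ((hoccp v).2 (.inr hv))
    · by_cases hrq : r = q
      · subst hrq
        rcases hv with rfl | rfl
        · exact .inl ((hoccq _).2 rfl)
        · exact .inr ⟨rfl, rfl, (hoccp _).2 (.inl rfl)⟩
      · rw [hne r hrp hrq]; exact .inl hv
  have hfol (r : ι) (hr : (a' r).IsFollower) : (a r).IsFollower := by
    by_cases hrp : r = p
    · subst hrp
      rw [hp'] at hr
      rcases hρ with ⟨-, rfl, -⟩ | ⟨h1, -⟩
      · exact absurd rfl hr.ne_lead
      · exact ⟨g, h1⟩
    · obtain ⟨g', hg⟩ := hr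
      exact ⟨g', by rwa [hrole r hrp] at hg⟩
  have hpts (r : ι) (hrp : r ≠ p) (v : Node) : (a' r).Points v ↔ (a r).Points v := by
    unfold Sketch.Points; rw [hrole r hrp, hhead r hrp]
  have hptsp (v : Node) (hv : (a' p).Points v) : v = (a q).head := by
    rw [hp'] at hv
    obtain ⟨b', hb', rfl⟩ := hv
    rcases hρ with ⟨-, rfl, -⟩ | ⟨h1, b, hb, rfl⟩
    · cases hb'
    · cases hb'
      change (a p).head + vec g + vec b' = _
      rw [hw, Sketch.tail_of_some hb, sub_add_cancel]
  have hdisj : ∀ r s v, v ∈ (a' r).occ → v ∈ (a' s).occ → r = s := by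
    have key (r : ι) (hrp : r ≠ p) (v : Node) (h1 : v ∈ (a' p).occ) (h2 : v ∈ (a' r).occ) :
        False := by
      rcases (hoccp v).1 h1 with rfl | rfl
      · obtain rfl := h.disjoint r q _ (hocc r hrp h2) (Sketch.tail_mem_occ _)
        exact htail ((hoccq _).1 h2)
      · exact hrp (h.disjoint r p _ (hocc r hrp h2) (Sketch.head_mem_occ _))
    intro r s v h1 h2
    by_cases hrp : r = p
    · by_contra hrs
      subst hrp
      exact key s (Ne.symm hrs) v h1 h2
    · by_cases hsp : s = p
      · subst hsp; exact (key r hrp v h2 h1).elim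
      · exact h.disjoint r s v (hocc r hrp h1) (hocc s hsp h2)
  refine h.of_change ?_ ?_ ?_ ?_ ?_ hdisj ?_ ?_ ?_
  · intro r h1 _
    exact hne r (by rintro rfl; exact h1 hpa) (by rintro rfl; exact h1 hq)
  · intro r hr'
    by_cases hrp : r = p
    · subst hrp; exact hactp.1
    · rw [hrole r hrp]; rcases hr' with h | h
      · exact h.1
      · simp [h]
  · intro r hr'
    by_cases hrp : r = p
    · subst hrp; exact hactp.2
    · rw [hrole r hrp]; rcases hr' with h | h
      · simp [h]
      · exact h.2
  · intro r hr'
    exact hne r (by rintro rfl; exact hpa.1 hr') (by rintro rfl; exact hq.1 hr')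
  · rintro z ⟨r, hz⟩ hz'
    rcases hkeep z r hz with hz | ⟨-, -, hz⟩
    · exact absurd ⟨r, hz⟩ hz'
    · exact absurd ⟨p, hz⟩ hz'
  · intro r v hv
    by_cases hrp : r = p
    · subst hrp
      obtain rfl := hptsp v hv
      exact ⟨q, hpq.symm, hactq, (hoccq _).2 rfl⟩
    · rw [hpts r hrp] at hv
      obtain ⟨s, h1, h2, h3⟩ := h.target r v hv
      rcases hkeep v s h3 with h4 | ⟨-, -, h4⟩
      · exact ⟨s, h1, hact s h2, h4⟩
      · exact ⟨p, Ne.symm hrp, hactp, h4⟩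
  · obtain ⟨rk, hrk⟩ := h.rank
    -- The rank of `p` gets in between the rank of `q` and the ranks of those that pointed to `q`.
    refine ⟨fun r => if r = p then (if (a q).IsFollower then 2 * rk q + 3 else 0)
      else 2 * rk r + 2, fun r t v h1 h2 h3 => ?_⟩
    have h3' := hfol t h3
    by_cases hrp : r = p
    · subst hrp
      obtain rfl := hptsp v h1
      obtain rfl : t = q := hdisj t q _ h2 ((hoccq _).2 rfl)
      simp [hpq.symm, h3']
    · rw [hpts r hrp] at h1
      by_cases htp : t = p
      · subst htp
        simp only [hrp, if_true, if_false]
        split_ifs with hqf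
        · rcases (hoccp v).1 h2 with rfl | rfl
          · have := hrk r q _ h1 (Sketch.tail_mem_occ _) hqf
            omega
          · have e1 := hrk r t _ h1 (Sketch.head_mem_occ _) h3'
            obtain ⟨g', hg'⟩ := h3'
            have e2 : rk q < rk t := by
              refine hrk t q (a q).tail ⟨g, ?_, hw⟩ (Sketch.tail_mem_occ _) hqf
              rcases hρ with ⟨hl, -⟩ | ⟨hf, -⟩
              · rw [hl] at hg'; cases hg'
              · exact hf
            omega
        · omega
      · simp only [hrp, htp, if_false]
        have := hrk r t v h1 (hocc t htp h2) h3'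
        omega
  · intro r hr' v hv
    by_cases hrp : r = p
    · subst hrp
      rw [hp'] at hr'
      rcases hρ with ⟨h1, -, h2⟩ | ⟨-, b, -, rfl⟩
      · rcases (hoccp v).1 hv with rfl | rfl
        · rwa [← hw]
        · exact h.lead_mem r h1 _ (Sketch.head_mem_occ _)
      · cases hr'
    · rw [hrole r hrp] at hr'
      exact h.lead_mem r hr' v (hocc r hrp hv)

lemma Inv.not_mem (h : Inv C a) {p : ι} (hp : (a p).role ≠ .object) {v : Node}
    (hv : v ∈ (a p).occ) : v ∉ C := by
  intro hvC
  obtain ⟨r, hr, rfl⟩ := (h.object _).1 hvC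
  obtain rfl := h.disjoint p r _ hv (Sketch.head_mem_occ _)
  exact hp hr

lemma Inv.head_mem_surface (h : Inv C a) {p : ι} (hp : (a p).role ≠ .object)
    (hs : OnSurf C (a p).head) : (a p).head ∈ surface C :=
  mem_surface.2 ⟨h.not_mem hp (Sketch.head_mem_occ _), hs⟩

theorem Inv.step (h : Inv C a) (hS : SurfaceLine C sd pos) (hstep : AStep C sd a K S a' K') :
    Inv C a' := by
  have hlead (p : ι) (hp : (a p).role = .lead) : next sd (a p).head ∈ surface C :=
    hS.next_mem _ (h.lead_mem p hp _ (Sketch.head_mem_occ _))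
  cases hstep with
  | toLead p hr hx hs =>
    refine h.update_role hx hr (.inl ⟨rfl, h.head_mem_surface ?_ hs⟩)
    rcases hr with hr | ⟨g, hr⟩ <;> simp [hr]
  | toFollow p g r hr hx hs ha hg =>
    exact h.update_role hx (.inl hr) (.inr ⟨hr, g, r, rfl, ha, hg⟩)
  | complain p hr hx hv hm => exact h
  | expand p hr hx hv hf => exact h.update_expand hx hr (hlead p hr) hf
  | contract q hx hq ht hi => exact h.update_contract hq ht hi
  | handoverLead p q hpq hr hx hv hxq hq hpt hm =>
    exact h.update_handover hpq hx hxq hq (active_of_lead hr) hpt (.inl ⟨hr, rfl, hlead p hr⟩)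
  | handoverFollow p q g b hpq hr hx hs hxq hq hpt =>
    exact h.update_handover hpq hx (by simp [hxq]) hq (Sketch.IsFollower.active ⟨g, hr⟩) hpt
      (.inr ⟨hr, b, hxq, rfl⟩)

/-- Leaders are adjacent to the object, followers are connected to leaders via their directions,
and inactive particles are connected to these. -/
theorem Inv.connected (h : Inv C a) (hC : (triGraph.induce C).Connected) :
    (triGraph.induce (covered a)).Connected := by
  have hCcov : C ⊆ covered a := by
    intro v hv
    obtain ⟨p, -, rfl⟩ := (h.object v).1 hv
    exact ⟨p, Sketch.head_mem_occ _⟩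
  obtain ⟨⟨x, hx⟩⟩ := hC.nonempty
  refine induce_connected_of_closed (hCcov hx) fun T hT hxT hclosed => ?_
  have hCT : C ⊆ T := fun y hy => induce_connected_induction hC (P := (· ∈ T)) hx hxT
    (fun u _ w hw huw hu => hclosed u hu w (hCcov hw) huw) hy
  have hocc (p : ι) (hp : (a p).head ∈ T) : (a p).occ ⊆ T := by
    rintro v (rfl | rfl)
    · exact hp
    · cases hax : (a p).axis with
      | none => rwa [Sketch.tail_of_none hax]
      | some b =>
        refine hclosed _ hp _ ⟨p, Sketch.tail_mem_occ _⟩ ⟨b + 3, ?_⟩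
        rw [Sketch.tail_of_some hax, vec_add_three, sub_eq_add_neg]
  have hlead (p : ι) (hp : (a p).role = .lead) : (a p).occ ⊆ T := by
    refine hocc p ?_
    obtain ⟨d, hd⟩ := (mem_surface.1 (h.lead_mem p hp _ (Sketch.head_mem_occ _))).2
    exact hclosed _ (hCT hd) _ ⟨p, Sketch.head_mem_occ _⟩ (adj_add_vec _ d).symm
  have hfollow (p : ι) (hp : (a p).IsFollower) : (a p).occ ⊆ T := by
    obtain ⟨rk, hrk⟩ := h.rank
    induction hn : rk p using Nat.strong_induction_on generalizing p with
    | _ n ih =>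
      refine hocc p ?_
      obtain ⟨g, hg⟩ := hp
      have hpts : (a p).Points ((a p).head + vec g) := ⟨g, hg, rfl⟩
      obtain ⟨r, -, h2, h3⟩ := h.target p _ hpts
      have hr : (a r).occ ⊆ T := by
        rcases h2.cases with hf | hl
        · exact ih _ (hn ▸ hrk p r _ hpts h3 hf) r hf rfl
        · exact hlead r hl
      exact hclosed _ (hr h3) _ ⟨p, Sketch.head_mem_occ _⟩ (adj_add_vec _ g).symm
  by_contra hsub
  obtain ⟨y, hy, hyT⟩ := Set.not_subset.1 hsub
  obtain ⟨v, hv, z, hz, hz1, hz2⟩ := h.cut (covered a \ T) (by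
    rintro v ⟨⟨p, hp⟩, hvT⟩
    refine ⟨p, ?_, ?_⟩
    · cases hr : (a p).role with
      | object =>
        rw [Sketch.occ_of_none (h.contracted p (.inl hr))] at hp
        exact absurd (hCT ((h.object v).2 ⟨p, hr, hp⟩)) hvT
      | inactive => rfl
      | follow g => exact absurd (hfollow p ⟨g, hr⟩ hp) hvT
      | lead => exact absurd (hlead p hr hp) hvT
    · rcases hp with hp | hp
      · exact hp
      · by_cases hax : (a p).axis = none
        · rwa [Sketch.tail_of_none hax] at hp
        · exfalso
          have hact : (a p).Active := ⟨fun h1 => hax (h.contracted p (.inl h1)),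
            fun h1 => hax (h.contracted p (.inr h1))⟩
          have hp' : v ∈ (a p).occ := .inr hp
          rcases hact.cases with hf | hl
          · exact hvT (hfollow p hf hp')
          · exact hvT (hlead p hl hp')) ⟨y, hy, hyT⟩
  have hzT : z ∈ T := by
    by_contra h1
    exact hz1 ⟨hz, h1⟩
  exact hv.2 (hclosed z hzT v hv.1 hz2.symm)

end Invariants

/-! ### Configurations without possible movements -/

section Final

variable {ι : Type*} {C : Set Node} {sd : Node → Dir} {pos : Node → ℤ} {a a' : ι → Sketch}
  {K K' S : Set ι}

/-- If no inactive particle can be activated and no expanded particle may contract, then there are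
no inactive and no expanded particles. Indeed, the tail of an expanded particle that may not
contract is followed by expanded particles only, and in this way one gets an infinite sequence of
expanded followers of growing rank. -/
lemma Inv.calm (h : Inv C a) (hfin : {p | (a p).role ≠ .object}.Finite)
    (h1 : ∀ p, (a p).role = .inactive → ¬ OnSurf C (a p).head ∧
      ∀ g r, (a r).Active → (a p).head + vec g ∉ (a r).occ)
    (h2 : ∀ q, (a q).axis ≠ none → ¬ MayContract a q) :
    (∀ p, (a p).role ≠ .inactive) ∧ ∀ p, (a p).axis = none := by
  have hin : ∀ p, (a p).role ≠ .inactive := by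
    intro p₀ hp₀
    obtain ⟨_, ⟨p, hp, rfl⟩, z, ⟨r, hr⟩, hz, d, rfl⟩ := h.cut _ subset_rfl ⟨_, p₀, hp₀, rfl⟩
    obtain ⟨hs, ha⟩ := h1 p hp
    by_cases hact : (a r).Active
    · exact ha d r hact hr
    · by_cases hrole : (a r).role = .object
      · rw [Sketch.occ_of_none (h.contracted r (.inl hrole))] at hr
        exact hs ⟨d, (h.object _).2 ⟨r, hrole, hr⟩⟩
      · have hri : (a r).role = .inactive := by
          by_contra hri
          exact hact ⟨hrole, hri⟩
        rw [Sketch.occ_of_none (h.contracted r (.inr hri))] at hr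
        exact hz ⟨r, hri, hr⟩
  refine ⟨hin, ?_⟩
  have hfollow (q : ι) (hq : (a q).axis ≠ none) :
      ∃ p, (a p).axis ≠ none ∧ (a p).Points (a q).tail := by
    have hm := h2 q hq
    simp only [MayContract, not_or, not_and, not_not] at hm
    by_contra hno
    push Not at hno
    refine hin _ (hm.2 ?_).choose_spec.1
    rintro ⟨p, hp⟩
    refine hm.1 ⟨p, ?_, hp⟩
    by_contra hpx
    exact hno p hpx hp
  by_contra hex
  push Not at hex
  obtain ⟨q, hq⟩ := hex
  obtain ⟨rk, hrk⟩ := h.rank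
  have hfin' : {p | (a p).axis ≠ none ∧ (a p).IsFollower}.Finite :=
    hfin.subset fun p hp => hp.2.active.1
  obtain ⟨p, hp1, hp2⟩ := hfollow q hq
  obtain ⟨m, hm, hmax⟩ := Set.exists_max_image _ rk hfin' ⟨p, hp1, hp2.isFollower⟩
  obtain ⟨p', hp1', hp2'⟩ := hfollow m hm.1
  have e1 := hmax p' ⟨hp1', hp2'.isFollower⟩
  have e2 := hrk p' m _ hp2' (Sketch.tail_mem_occ _) hm.2
  omega

/-- In a calm configuration in which no leader is followed, all particles are leaders. -/
lemma Inv.all_lead (h : Inv C a) (hfin : {p | (a p).role ≠ .object}.Finite)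
    (hin : ∀ p, (a p).role ≠ .inactive) (hx : ∀ p, (a p).axis = none)
    (hl : ∀ p r, (a p).role = .lead → ¬ (a r).Points (a p).head) (p : ι) :
    (a p).role = .object ∨ (a p).role = .lead := by
  by_contra! hp
  have hpf : (a p).IsFollower := (Sketch.Active.cases ⟨hp.1, hin p⟩).resolve_right hp.2
  obtain ⟨rk, hrk⟩ := h.rank
  have hfin' : {p | (a p).IsFollower}.Finite := hfin.subset fun p hp => hp.active.1
  obtain ⟨m, hm, hmin⟩ := Set.exists_min_image _ rk hfin' ⟨p, hpf⟩
  obtain ⟨g, hg⟩ := hm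
  have hpts : (a m).Points ((a m).head + vec g) := ⟨g, hg, rfl⟩
  obtain ⟨r, -, hr, hr'⟩ := h.target m _ hpts
  rcases hr.cases with hf | hlead
  · have e1 := hmin r hf
    have e2 := hrk m r _ hpts hr' hf
    omega
  · rw [Sketch.occ_of_none (hx r)] at hr'
    obtain hr' : (a m).head + vec g = (a r).head := hr'
    exact hl r m hlead (hr' ▸ hpts)

end Final

/-! ### Runs come to rest -/

section Runs

variable {ι : Type*} {C : Set Node} {sd : Node → Dir} {pos : Node → ℤ}

/-- A run of the abstract system: a fair execution, as seen in the abstract configurations `a n` and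
the sets `K n` of complaining particles. -/
structure Run (C : Set Node) (sd : Node → Dir) (a : ℕ → ι → Sketch) (K : ℕ → Set ι) : Prop where
  inv : ∀ n, Inv C (a n)
  step : ∀ n, (∃ S, AStep C sd (a n) (K n) S (a (n + 1)) (K (n + 1))) ∨
    (a (n + 1) = a n ∧ K (n + 1) = K n)
  fair : ∀ p m, ∃ n ≥ m, (∀ S a' K', AStep C sd (a n) (K n) S a' K' → p ∉ S) ∨
    ∃ S, AStep C sd (a n) (K n) S (a (n + 1)) (K (n + 1)) ∧ p ∈ S
  finite : {p | (a 0 p).role ≠ .object}.Finite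

/-- The progress of a particle through the phases. -/
def Role.level : Role → ℕ
  | .inactive => 0
  | .follow _ => 1
  | .lead => 2
  | .object => 3

lemma Role.level_le (ρ : Role) : ρ.level ≤ 3 := by cases ρ <;> simp [level]

lemma Role.level_object {ρ : Role} : ρ.level = 3 ↔ ρ = .object := by cases ρ <;> simp [level]

lemma Role.level_lead {ρ : Role} : ρ.level = 2 ↔ ρ = .lead := by cases ρ <;> simp [level]

lemma Role.level_follow {ρ : Role} : ρ.level = 1 ↔ ∃ g, ρ = .follow g := by
  cases ρ <;> simp [level]

section Step

variable {a a' : ι → Sketch} {K K' S : Set ι}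

/-- The ways in which a single particle `x` can change to `x'` in a step in which its phase is the
same before and after. -/
lemma AStep.change (h : AStep C sd a K S a' K') (p : ι) :
    ((a p).role.level < (a' p).role.level ∧ (a' p).role ≠ .object) ∨ a' p = a p ∨
    ((a p).axis ≠ none ∧ a' p = ⟨(a p).role, (a p).head, none⟩) ∨
    ((a p).role = .lead ∧ (a p).axis = none ∧ Sees sd a K p ∧
      a' p = ⟨.lead, next sd (a p).head, some (sd (a p).head)⟩) ∨
    ∃ g b q, (a p).role = .follow g ∧ (a p).axis = none ∧ ¬ OnSurf C (a p).head ∧ q ≠ p ∧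
      (a q).axis = some b ∧ (a' q).axis = none ∧ (a q).tail = (a p).head + vec g ∧
      a' p = ⟨.follow b, (a p).head + vec g, some g⟩ := by
  cases h with
  | toLead r hr hx hs =>
    by_cases hpr : p = r
    · subst hpr
      left
      rcases hr with hr | ⟨g, hr⟩ <;> simp [hr, Role.level]
    · simp [hpr]
  | toFollow r g s hr hx hs ha hg =>
    by_cases hpr : p = r
    · subst hpr
      left
      simp [hr, Role.level]
    · simp [hpr]
  | complain r hr hx hv hm => exact .inr (.inl rfl)
  | expand r hr hx hv hf =>
    by_cases hpr : p = r
    · subst hpr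
      exact .inr (.inr (.inr (.inl ⟨hr, hx, hv, by simp⟩)))
    · simp [hpr]
  | contract q hx hq ht hi =>
    by_cases hpr : p = q
    · subst hpr
      exact .inr (.inr (.inl ⟨hx, by simp⟩))
    · simp [hpr]
  | handoverLead r q hrq hr hx hv hxq hq hpt hm =>
    by_cases hpq : p = q
    · subst hpq
      exact .inr (.inr (.inl ⟨hxq, by simp⟩))
    · by_cases hpr : p = r
      · subst hpr
        exact .inr (.inr (.inr (.inl ⟨hr, hx, hv, by simp [hpq]⟩)))
      · simp [hpr, hpq]
  | handoverFollow r q g b hrq hr hx hs hxq hq hpt =>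
    by_cases hpq : p = q
    · subst hpq
      exact .inr (.inr (.inl ⟨by simp [hxq], by simp⟩))
    · by_cases hpr : p = r
      · subst hpr
        exact .inr (.inr (.inr (.inr ⟨g, b, q, hr, hx, hs, Ne.symm hpq, hxq, by simp, hpt.symm,
          by simp [hpq]⟩)))
      · simp [hpr, hpq]

/-- A step that changes no particle is a complaint. -/
lemma AStep.complain_of_eq (h : AStep C sd a K S a' K') (ha : a' = a) :
    ∃ p, S = {p} ∧ K' = insert p K ∧ (a p).role = .lead ∧ (a p).axis = none ∧
      ¬ CanMove sd a p := by
  cases h with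
  | toLead r hr hx hs =>
    have := congrArg Sketch.role (congrFun ha r)
    simp only [Function.update_self] at this
    rcases hr with hr | ⟨g, hr⟩ <;> rw [hr] at this <;> cases this
  | toFollow r g s hr hx hs ha' hg =>
    have := congrArg Sketch.role (congrFun ha r)
    simp only [Function.update_self] at this
    rw [hr] at this; cases this
  | complain r hr hx hv hm => exact ⟨r, rfl, rfl, hr, hx, hm⟩
  | expand r hr hx hv hf =>
    have := congrArg Sketch.axis (congrFun ha r)
    simp [hx] at this
  | contract q hx hq ht hi =>
    have := congrArg Sketch.axis (congrFun ha q)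
    simp only [Function.update_self] at this
    exact absurd this.symm hx
  | handoverLead r q hrq hr hx hv hxq hq hpt hm =>
    have := congrArg Sketch.axis (congrFun ha q)
    simp only [Function.update_self] at this
    exact absurd this.symm hxq
  | handoverFollow r q g b hrq hr hx hs hxq hq hpt =>
    have := congrArg Sketch.axis (congrFun ha q)
    simp [hxq] at this

end Step

lemma eventually_const_of_bounded {f : ℕ → ℕ} {B : ℕ} (hf : Monotone f) (hB : ∀ n, f n ≤ B) :
    ∃ T, ∀ n ≥ T, f n = f T := by
  let g : ℕ →o Fin (B + 1) := ⟨fun n => ⟨f n, Nat.lt_succ_of_le (hB n)⟩, fun _ _ h => hf h⟩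
  obtain ⟨T, hT⟩ := WellFoundedGT.monotone_chain_condition g
  exact ⟨T, fun n hn => congrArg Fin.val (hT n hn).symm⟩

variable {a : ℕ → ι → Sketch} {K : ℕ → Set ι}

/-- The particle `p` does not change from the configuration `T` on. -/
def StaticFrom (a : ℕ → ι → Sketch) (T : ℕ) (p : ι) : Prop := ∀ n ≥ T, a n p = a T p

lemma StaticFrom.mono {T T' : ℕ} {p : ι} (h : StaticFrom a T p) (hT : T ≤ T') :
    StaticFrom a T' p := fun n hn => (h n (hT.trans hn)).trans (h T' hT).symm

namespace Run

lemma change (h : Run C sd a K) (n : ℕ) (p : ι) :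
    ((a n p).role.level < (a (n + 1) p).role.level ∧ (a (n + 1) p).role ≠ .object) ∨
    a (n + 1) p = a n p ∨
    ((a n p).axis ≠ none ∧ a (n + 1) p = ⟨(a n p).role, (a n p).head, none⟩) ∨
    ((a n p).role = .lead ∧ (a n p).axis = none ∧ Sees sd (a n) (K n) p ∧
      a (n + 1) p = ⟨.lead, next sd (a n p).head, some (sd (a n p).head)⟩) ∨
    ∃ g b q, (a n p).role = .follow g ∧ (a n p).axis = none ∧ ¬ OnSurf C (a n p).head ∧ q ≠ p ∧
      (a n q).axis = some b ∧ (a (n + 1) q).axis = none ∧ (a n q).tail = (a n p).head + vec g ∧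
      a (n + 1) p = ⟨.follow b, (a n p).head + vec g, some g⟩ := by
  rcases h.step n with ⟨S, hs⟩ | ⟨hs, -⟩
  · exact hs.change p
  · exact .inr (.inl (congrFun hs p))

lemma level_mono (h : Run C sd a K) (p : ι) : Monotone fun n => (a n p).role.level := by
  refine monotone_nat_of_le_succ fun n => ?_
  rcases h.change n p with ⟨h, -⟩ | h | ⟨-, h⟩ | ⟨h1, -, -, h⟩ | ⟨g, b, q, h1, -, -, -, -, -, -, h⟩
  · exact h.le
  · rw [h]
  · rw [h]
  · rw [h, h1]
  · rw [h, h1]; rfl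

lemma object_iff (h : Run C sd a K) (n : ℕ) (p : ι) :
    (a n p).role = .object ↔ (a 0 p).role = .object := by
  constructor
  · intro hn
    induction n with
    | zero => exact hn
    | succ n ih =>
      refine ih ?_
      rcases h.change n p with ⟨-, h1⟩ | h1 | ⟨-, h1⟩ | ⟨-, -, -, h1⟩ |
        ⟨g, b, q, -, -, -, -, -, -, -, h1⟩
      · exact absurd hn h1
      · rwa [← h1]
      · rw [h1] at hn; exact hn
      · rw [h1] at hn; cases hn
      · rw [h1] at hn; cases hn
  · intro h0
    rw [← Role.level_object] at h0 ⊢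
    exact le_antisymm (Role.level_le _) (h0 ▸ h.level_mono p (Nat.zero_le n))

lemma change_of_head (h : Run C sd a K) {p : ι} {n : ℕ}
    (hl : (a (n + 1) p).role.level = (a n p).role.level)
    (hh : (a (n + 1) p).head = (a n p).head) : a (n + 1) p = a n p ∨
      ((a n p).axis ≠ none ∧ a (n + 1) p = ⟨(a n p).role, (a n p).head, none⟩) := by
  have hv (v : Node) (d : Dir) : v + vec d ≠ v := fun h => vec_ne_zero d (add_eq_left.1 h)
  rcases h.change n p with ⟨h1, -⟩ | h1 | h1 | ⟨-, -, -, h1⟩ | ⟨g, b, q, -, -, -, -, -, -, -, h1⟩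
  · omega
  · exact .inl h1
  · exact .inr h1
  · rw [h1] at hh; exact absurd hh (hv _ _)
  · rw [h1] at hh; exact absurd hh (hv _ _)

/-- A particle whose head and phase do not change any more comes to rest. -/
lemma exists_static_of_head (h : Run C sd a K) {p : ι} {T : ℕ}
    (hl : ∀ n ≥ T, (a n p).role.level = (a T p).role.level)
    (hh : ∀ n ≥ T, (a n p).head = (a T p).head) : ∃ T', StaticFrom a T' p := by
  have key (n : ℕ) (hn : T ≤ n) := h.change_of_head (p := p) (n := n)
    (by rw [hl n hn, hl (n + 1) (by omega)]) (by rw [hh n hn, hh (n + 1) (by omega)])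
  have hstay (m : ℕ) (hm : T ≤ m) (hx : (a m p).axis = none) : StaticFrom a m p := by
    intro n hn
    induction n, hn using Nat.le_induction with
    | base => rfl
    | succ n hn ih =>
      rcases key n (hm.trans hn) with h1 | ⟨h1, -⟩
      · rw [h1, ih]
      · rw [ih] at h1; exact absurd hx h1
  by_cases hx : ∃ m ≥ T, (a m p).axis = none
  · obtain ⟨m, hm, hx⟩ := hx
    exact ⟨m, hstay m hm hx⟩
  · push Not at hx
    refine ⟨T, fun n hn => ?_⟩
    induction n, hn using Nat.le_induction with
    | base => rfl
    | succ n hn ih =>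
      rcases key n hn with h1 | ⟨-, h1⟩
      · rw [h1, ih]
      · exact absurd (by rw [h1]) (hx (n + 1) (by omega))

lemma static_of_object (h : Run C sd a K) {p : ι} (hp : (a 0 p).role = .object) :
    StaticFrom a 0 p := by
  intro n _
  induction n with
  | zero => rfl
  | succ n ih =>
    have hn := (h.object_iff n p).2 hp
    rcases h.change n p with ⟨h1, -⟩ | h1 | ⟨h1, -⟩ | ⟨h1, -⟩ | ⟨g, b, q, h1, -⟩
    · have := Role.level_le (a (n + 1) p).role
      rw [Role.level_object.2 hn] at h1
      omega
    · rw [h1, ih (Nat.zero_le _)]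
    · exact absurd ((h.inv n).contracted p (.inl hn)) h1
    · rw [hn] at h1; cases h1
    · rw [hn] at h1; cases h1

/-- A property of particles that is stable in time and eventually holds for each of the finitely
many particles outside of the object eventually holds for all of them at the same time. -/
lemma exists_uniform (h : Run C sd a K) {P : ℕ → ι → Prop}
    (hmono : ∀ p T T', T ≤ T' → P T p → P T' p)
    (hobj : ∀ p T, (a 0 p).role = .object → P T p) (T₀ : ℕ) :
    ∃ T ≥ T₀, ∀ p, (∃ T', P T' p) → P T p := by
  have : ∀ᶠ T in Filter.atTop, ∀ p ∈ {p | (a 0 p).role ≠ .object}, (∃ T', P T' p) → P T p := by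
    rw [Filter.eventually_all_finite h.finite]
    intro p _
    by_cases hp : ∃ T', P T' p
    · obtain ⟨T', hT'⟩ := hp
      filter_upwards [Filter.eventually_ge_atTop T'] with T hT _
      exact hmono p T' T hT hT'
    · exact .of_forall fun T hT => absurd hT hp
  obtain ⟨T, h1, h2⟩ := (this.and (Filter.eventually_ge_atTop T₀)).exists
  refine ⟨T, h2, fun p hp => ?_⟩
  by_cases ho : (a 0 p).role = .object
  · exact hobj p T ho
  · exact h1 p ho hp

lemma exists_level_const (h : Run C sd a K) :
    ∃ T, ∀ p, ∀ n ≥ T, (a n p).role.level = (a T p).role.level := by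
  obtain ⟨T, -, hT⟩ := h.exists_uniform
    (P := fun T p => ∀ n ≥ T, (a n p).role.level = (a T p).role.level)
    (fun p T T' hT hP n hn => by rw [hP n (hT.trans hn), hP T' hT])
    (fun p T ho n _ => by
      rw [h.static_of_object ho n (Nat.zero_le n), h.static_of_object ho T (Nat.zero_le T)]) 0
  exact ⟨T, fun p => hT p (eventually_const_of_bounded (h.level_mono p) fun n => Role.level_le _)⟩

lemma exists_static_of_inactive (h : Run C sd a K) {p : ι} {T : ℕ}
    (hl : ∀ n ≥ T, (a n p).role.level = (a T p).role.level) (hp : (a T p).role = .inactive) :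
    ∃ T', StaticFrom a T' p := by
  refine ⟨T, fun n hn => ?_⟩
  induction n, hn using Nat.le_induction with
  | base => rfl
  | succ n hn ih =>
    have hr : (a n p).role = .inactive := by rw [ih, hp]
    rcases h.change n p with ⟨h1, -⟩ | h1 | ⟨h1, -⟩ | ⟨h1, -⟩ | ⟨g, b, q, h1, -⟩
    · rw [hl n hn, hl (n + 1) (by omega)] at h1
      omega
    · rw [h1, ih]
    · exact absurd ((h.inv n).contracted p (.inr hr)) h1
    · rw [hr] at h1; cases h1
    · rw [hr] at h1; cases h1

/-- Followers come to rest. By induction on the rank, a follower can only move when a leader that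
it points to makes room. Then it gets to the surface, where it does not move as a follower. -/
lemma exists_static_of_follower (h : Run C sd a K) {T : ℕ}
    (hl : ∀ p, ∀ n ≥ T, (a n p).role.level = (a T p).role.level)
    (hT : ∀ p, (∃ T', StaticFrom a T' p) → StaticFrom a T p) (p : ι)
    (hp : (a T p).IsFollower) : ∃ T', StaticFrom a T' p := by
  obtain ⟨rk, hrk⟩ := (h.inv T).rank
  induction hn : rk p using Nat.strong_induction_on generalizing p with
  | _ k ih =>
    have hrolef (n : ℕ) (hn : T ≤ n) : ∃ g, (a n p).role = .follow g := by
      rw [← Role.level_follow, hl p n hn, Role.level_follow]; exact hp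
    by_cases hchg : ∀ n ≥ T, (a n p).head = (a T p).head
    · exact h.exists_static_of_head (hl p) hchg
    · -- The first time at which `p` expands, as part of a handover.
      push Not at hchg
      classical
      obtain ⟨hN1, hN2⟩ := Nat.find_spec hchg
      have hmin (m : ℕ) (hm : m < Nat.find hchg) (hTm : T ≤ m) :
          (a m p).head = (a T p).head := by
        by_contra hne
        exact Nat.find_min hchg hm ⟨hTm, hne⟩
      generalize Nat.find hchg = N at *
      obtain ⟨n, rfl⟩ : ∃ n, N = n + 1 := by
        cases N with
        | zero =>
          obtain rfl : T = 0 := by omega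
          exact absurd rfl hN2
        | succ n => exact ⟨n, rfl⟩
      have hTn : T ≤ n := by
        by_contra hlt
        obtain rfl : T = n + 1 := by omega
        exact hN2 rfl
      have hrole (m : ℕ) (hm : T ≤ m) (hmn : m ≤ n) : (a m p).role = (a T p).role := by
        induction m, hm using Nat.le_induction with
        | base => rfl
        | succ m hm ih =>
          rcases h.change_of_head (p := p) (n := m) (by rw [hl p m hm, hl p (m + 1) (by omega)])
            (by rw [hmin m (by omega) hm, hmin (m + 1) (by omega) (by omega)]) with h1 | ⟨-, h1⟩
          · rw [h1, ih (by omega)]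
          · rw [h1]; exact ih (by omega)
      have hlead (m : ℕ) (hm : T ≤ m) : (a m p).role ≠ .lead := by
        obtain ⟨g, hg⟩ := hrolef m hm
        rw [hg]; simp
      have hlevel (m : ℕ) (hm : T ≤ m) : ¬ (a m p).role.level < (a (m + 1) p).role.level := by
        rw [hl p m hm, hl p (m + 1) (by omega)]; exact lt_irrefl _
      have hhn := hmin n (by omega) hTn
      rcases h.change n p with ⟨h1, -⟩ | h1 | ⟨-, h1⟩ | ⟨h1, -⟩ |
        ⟨g, b, q, h1, -, -, -, hqb, hq', hqt, hpn⟩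
      · exact absurd h1 (hlevel n hTn)
      · rw [h1] at hN2; exact absurd hhn hN2
      · rw [h1] at hN2; exact absurd hhn hN2
      · exact absurd h1 (hlead n hTn)
      · have hpts : (a T p).Points ((a n p).head + vec g) :=
          ⟨g, by rw [← hrole n hTn le_rfl, h1], by rw [hhn]⟩
        obtain ⟨r, -, hr, hrv⟩ := (h.inv T).target p _ hpts
        rcases hr.cases with hf | hlr
        · have hst := hT r (ih _ (hn ▸ hrk p r _ hpts hrv hf) r hf rfl)
          rw [← hst n hTn, ← hqt] at hrv
          obtain rfl := (h.inv n).disjoint q r _ (Sketch.tail_mem_occ _) hrv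
          rw [hst n hTn] at hqb
          rw [hst (n + 1) hN1, hqb] at hq'
          cases hq'
        · have hsurf := (mem_surface.1 ((h.inv T).lead_mem r hlr _ hrv)).2
          refine h.exists_static_of_head (T := n + 1)
            (fun m hm => by rw [hl p m (hN1.trans hm), hl p (n + 1) hN1]) fun m hm => ?_
          induction m, hm using Nat.le_induction with
          | base => rfl
          | succ m hm ihm =>
            have hTm := hN1.trans hm
            rcases h.change m p with ⟨h2, -⟩ | h2 | ⟨-, h2⟩ | ⟨h2, -⟩ | ⟨_, _, _, -, -, h2, -⟩
            · exact absurd h2 (hlevel m hTm)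
            · rw [h2, ihm]
            · rw [h2, ← ihm]
            · exact absurd h2 (hlead m hTm)
            · rw [ihm, hpn] at h2
              exact absurd hsurf h2

/-- Leaders come to rest when all other particles rest. A leader that has passed all nodes that
followers point to only moves if there is another leader directly behind it. So its
position is bounded in terms of the number of leaders behind it. -/
lemma exists_static_of_lead (h : Run C sd a K) (hS : SurfaceLine C sd pos) {T : ℕ}
    (hl : ∀ p, ∀ n ≥ T, (a n p).role.level = (a T p).role.level)
    (hT : ∀ p, (a T p).IsFollower → StaticFrom a T p) (p : ι)
    (hp : (a T p).role = .lead) : ∃ T', StaticFrom a T' p := by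
  classical
  have hlead (n : ℕ) (hn : T ≤ n) (q : ι) : (a n q).role = .lead ↔ (a T q).role = .lead := by
    rw [← Role.level_lead, hl q n hn, Role.level_lead]
  have hfol (n : ℕ) (hn : T ≤ n) (q : ι) : (a n q).IsFollower ↔ (a T q).IsFollower := by
    unfold Sketch.IsFollower
    rw [← Role.level_follow, hl q n hn, Role.level_follow]
  have hfin : {q | (a T q).role ≠ .object}.Finite := by
    refine h.finite.subset fun q hq => ?_
    exact fun h0 => hq ((h.object_iff T q).2 h0)
  let F := hfin.toFinset
  have hF (q : ι) : q ∈ F ↔ (a T q).role ≠ .object := by simp [F]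
  let x : ℕ → ι → ℤ := fun n q => pos (a n q).head
  have hsurf (n : ℕ) (hn : T ≤ n) (q : ι) (hq : (a T q).role = .lead) :
      (a n q).head ∈ surface C :=
    (h.inv n).lead_mem q ((hlead n hn q).2 hq) _ (Sketch.head_mem_occ _)
  -- Leaders move by one step.
  have hmove (n : ℕ) (hn : T ≤ n) (q : ι) (hq : (a T q).role = .lead) :
      (a (n + 1) q).head = (a n q).head ∨
        (Sees sd (a n) (K n) q ∧ x (n + 1) q = x n q + 1) := by
    have hqn := (hlead n hn q).2 hq
    rcases h.change n q with ⟨h1, -⟩ | h1 | ⟨-, h1⟩ | ⟨-, -, h1, h2⟩ | ⟨g, b, q, h1, -⟩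
    · rw [hl q n hn, hl q (n + 1) (by omega)] at h1
      exact absurd h1 (lt_irrefl _)
    · exact .inl (by rw [h1])
    · exact .inl (by rw [h1])
    · exact .inr ⟨h1, by simp only [x]; rw [h2]; exact hS.pos_next _ (hsurf n hn q hq)⟩
    · rw [hqn] at h1; cases h1
  have hx1 (n : ℕ) (hn : T ≤ n) (q : ι) (hq : (a T q).role = .lead) :
      x (n + 1) q = x n q ∨ x (n + 1) q = x n q + 1 := by
    rcases hmove n hn q hq with h1 | ⟨-, h1⟩
    · left; simp only [x]; rw [h1]
    · exact .inr h1
  have hxinj (n : ℕ) (hn : T ≤ n) (q r : ι) (hq : (a T q).role = .lead)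
      (hr : (a T r).role = .lead) (hqr : x n q = x n r) : q = r := by
    have := hS.pos_injOn (hsurf n hn q hq) (hsurf n hn r hr) hqr
    exact (h.inv n).disjoint q r _ (Sketch.head_mem_occ _) (this ▸ Sketch.head_mem_occ _)
  have horder (n : ℕ) (hn : T ≤ n) (q r : ι) (hq : (a T q).role = .lead)
      (hr : (a T r).role = .lead) (hqr : x n q < x n r) : x (n + 1) q < x (n + 1) r := by
    have hne : x (n + 1) q ≠ x (n + 1) r := fun heq => by
      obtain rfl := hxinj (n + 1) (by omega) q r hq hr heq
      exact lt_irrefl _ hqr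
    rcases hx1 n hn q hq with h1 | h1 <;> rcases hx1 n hn r hr with h2 | h2 <;> omega
  -- The leaders behind a leader. Their number does not decrease, as leaders do not overtake.
  let B : ℕ → ι → Finset ι := fun n q =>
    F.filter fun r => (a T r).role = .lead ∧ x n r < x n q
  have hBmono (n : ℕ) (hn : T ≤ n) (q : ι) (hq : (a T q).role = .lead) :
      (B n q).card ≤ (B (n + 1) q).card := by
    refine Finset.card_le_card fun r hr => ?_
    simp only [B, Finset.mem_filter] at hr ⊢
    exact ⟨hr.1, hr.2.1, horder n hn r q hr.2.1 hq hr.2.2⟩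
  -- `M` bounds the initial positions of the leaders and the positions that followers point to.
  let tgt : ι → Node := fun q => match (a T q).role with
    | .follow g => (a T q).head + vec g
    | _ => (a T q).head
  obtain ⟨M, hM⟩ : ∃ M : ℤ, ∀ q ∈ F, x T q ≤ M ∧ pos (tgt q) ≤ M := by
    obtain ⟨M₁, h1⟩ := (F.image (x T)).bddAbove
    obtain ⟨M₂, h2⟩ := (F.image (fun q => pos (tgt q))).bddAbove
    exact ⟨max M₁ M₂, fun q hq =>
      ⟨(h1 (Finset.mem_coe.2 (Finset.mem_image_of_mem _ hq))).trans (le_max_left _ _),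
      (h2 (Finset.mem_coe.2 (Finset.mem_image_of_mem _ hq))).trans (le_max_right _ _)⟩⟩
  have hleadF (q : ι) (hq : (a T q).role = .lead) : q ∈ F := (hF q).2 (by simp [hq])
  have hbound (n : ℕ) (hn : T ≤ n) : ∀ q, (a T q).role = .lead →
      x n q ≤ M + 1 + 2 * (B n q).card := by
    induction n, hn using Nat.le_induction with
    | base =>
      intro q hq
      have := (hM q (hleadF q hq)).1
      omega
    | succ n hn ih =>
      intro q hq
      have hcard := hBmono n hn q hq
      rcases hmove n hn q hq with h1 | ⟨hsees, h1⟩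
      · have := ih q hq
        have h2 : x (n + 1) q = x n q := by simp only [x]; rw [h1]
        omega
      · rcases hsees with ⟨r, hr⟩ | ⟨r, -, hr, hr'⟩
        · have hrf := (hfol n hn r).1 hr.isFollower
          have hst := hT r hrf
          rw [hst n hn] at hr
          obtain ⟨g, hg, hg'⟩ := hr
          have htr : tgt r = (a n q).head := by simp only [tgt, hg]; exact hg'
          have h2 := (hM r ((hF r).2 (by simp [hg]))).2
          rw [htr] at h2
          have h3 : x n q ≤ M := h2
          omega
        · have hrl := (hlead n hn r).1 hr
          have h2 : x n q = x n r + 1 := by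
            simp only [x]
            rw [← hr']
            exact hS.pos_next _ (hsurf n hn r hrl)
          have h3 : (B n r).card + 1 ≤ (B n q).card := by
            rw [← Finset.card_insert_of_notMem (s := B n r) (a := r) (by simp [B])]
            refine Finset.card_le_card fun s hs => ?_
            rcases Finset.mem_insert.1 hs with rfl | hs
            · exact Finset.mem_filter.2 ⟨hleadF s hrl, hrl, by omega⟩
            · obtain ⟨h4, h5, h6⟩ := Finset.mem_filter.1 hs
              exact Finset.mem_filter.2 ⟨h4, h5, by omega⟩
          have := ih r hrl
          omega
  -- The position of `p` is monotone and bounded, hence eventually constant.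
  have hmono : Monotone fun n => x (T + n) p := monotone_nat_of_le_succ fun n => by
    rcases hx1 (T + n) (by omega) p hp with h1 | h1
    · exact h1.ge
    · rw [← add_assoc]; omega
  obtain ⟨N, hN⟩ := eventually_const_of_bounded
    (f := fun n => (x (T + n) p - x T p).toNat) (B := (M + 1 + 2 * F.card - x T p).toNat)
    (fun m n hmn => by
      have : x (T + m) p ≤ x (T + n) p := hmono hmn
      change (x (T + m) p - x T p).toNat ≤ (x (T + n) p - x T p).toNat
      omega)
    (fun n => by
      have h1 := hbound (T + n) (by omega) p hp
      have h2 : (B (T + n) p).card ≤ F.card := Finset.card_filter_le _ _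
      change (x (T + n) p - x T p).toNat ≤ _
      omega)
  refine h.exists_static_of_head (T := T + N)
    (fun n hn => by rw [hl p n (by omega), hl p (T + N) (by omega)]) fun n hn => ?_
  obtain ⟨k, rfl⟩ : ∃ k, n = T + k := ⟨n - T, by omega⟩
  refine hS.pos_injOn (hsurf _ (by omega) p hp) (hsurf _ (by omega) p hp) ?_
  have h1 := hN k (by omega)
  have h2 : x (T + 0) p ≤ x (T + k) p := hmono (Nat.zero_le k)
  have h3 : x (T + 0) p ≤ x (T + N) p := hmono (Nat.zero_le N)
  simp only [Nat.add_zero] at h1 h2 h3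
  change x (T + k) p = x (T + N) p
  omega

/-- All particles come to rest. -/
theorem exists_static (h : Run C sd a K) (hS : SurfaceLine C sd pos) :
    ∃ T, ∀ n ≥ T, a n = a T := by
  have hmono : ∀ p T T', T ≤ T' → StaticFrom a T p → StaticFrom a T' p :=
    fun p T T' hT hP => hP.mono hT
  have hobj : ∀ p T, (a 0 p).role = .object → StaticFrom a T p :=
    fun p T ho => (h.static_of_object ho).mono (Nat.zero_le T)
  obtain ⟨T₀, hT₀⟩ := h.exists_level_const
  obtain ⟨T₁, hT₁, hstatic⟩ := h.exists_uniform hmono hobj T₀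
  have hl : ∀ p, ∀ n ≥ T₁, (a n p).role.level = (a T₁ p).role.level := fun p n hn => by
    rw [hT₀ p n (hT₁.trans hn), hT₀ p T₁ hT₁]
  have hall (p : ι) : ∃ T', StaticFrom a T' p := by
    cases hr : (a T₁ p).role with
    | object => exact ⟨0, h.static_of_object ((h.object_iff _ p).1 hr)⟩
    | inactive => exact h.exists_static_of_inactive (hl p) hr
    | follow g => exact h.exists_static_of_follower hl hstatic p ⟨g, hr⟩
    | lead =>
      exact h.exists_static_of_lead hS hl
        (fun q hq => hstatic q (h.exists_static_of_follower hl hstatic q hq)) p hr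
  obtain ⟨T, -, hT⟩ := h.exists_uniform hmono hobj 0
  exact ⟨T, fun n hn => funext fun p => hT p (hall p) n hn⟩

/-- At some time all particles outside of the object are contracted leaders that read no indicator.
Once all particles rest, only complaints are possible, and they are never withdrawn. The leader
furthest along the surface that ever reads an indicator cannot expand, so it would complain to the
next particle, which is a leader that is further along. -/
theorem exists_final (h : Run C sd a K) (hS : SurfaceLine C sd pos) :
    ∃ n, ∀ p, (a n p).role = .object ∨
      ((a n p).role = .lead ∧ (a n p).axis = none ∧ ¬ Sees sd (a n) (K n) p) := by
  obtain ⟨T, hT⟩ := h.exists_static hS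
  obtain ⟨A, hA⟩ : ∃ A, A = a T := ⟨_, rfl⟩
  have hst (n : ℕ) (hn : T ≤ n) : a n = A := by rw [hT n hn, hA]
  have hinv : Inv C A := hA ▸ h.inv T
  have hfin : {p | (A p).role ≠ .object}.Finite := by
    refine h.finite.subset fun q hq h0 => hq ?_
    rw [hA]
    exact (h.object_iff T q).2 h0
  -- An action that stays enabled is a complaint, and it is executed at some point.
  have hpersist (p : ι) (m : ℕ) (hm : T ≤ m)
      (hen : ∀ n ≥ m, ∃ S a' K', AStep C sd A (K n) S a' K' ∧ p ∈ S) :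
      (A p).role = .lead ∧ (A p).axis = none ∧ ¬ CanMove sd A p ∧
        ∃ n ≥ m, p ∈ K (n + 1) := by
    obtain ⟨n, hn, hf | ⟨S, hs, hpS⟩⟩ := h.fair p m
    · obtain ⟨S, a', K', h1, h2⟩ := hen n hn
      rw [hst n (hm.trans hn)] at hf
      exact absurd h2 (hf S a' K' h1)
    · rw [hst n (hm.trans hn), hst (n + 1) (by omega)] at hs
      obtain ⟨r, rfl, hK, h1, h2, h3⟩ := hs.complain_of_eq rfl
      obtain rfl : p = r := hpS
      exact ⟨h1, h2, h3, n, hn, by rw [hK]; exact Set.mem_insert _ _⟩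
  have hKmono (m n : ℕ) (hm : T ≤ m) (hmn : m ≤ n) : K m ⊆ K n := by
    induction n, hmn using Nat.le_induction with
    | base => exact subset_rfl
    | succ n hn ih =>
      refine ih.trans ?_
      rcases h.step n with ⟨S, hs⟩ | ⟨-, hK⟩
      · rw [hst n (hm.trans hn), hst (n + 1) (by omega)] at hs
        obtain ⟨r, -, hK, -⟩ := hs.complain_of_eq rfl
        rw [hK]; exact Set.subset_insert _ _
      · rw [hK]
  have h1 (p : ι) (hp : (A p).role = .inactive) : ¬ OnSurf C (A p).head ∧
      ∀ g r, (A r).Active → (A p).head + vec g ∉ (A r).occ := by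
    have hx := hinv.contracted p (.inr hp)
    have hs : ¬ OnSurf C (A p).head := fun hs => by
      have := (hpersist p T le_rfl fun n _ => ⟨_, _, _, .toLead p (.inl hp) hx hs, rfl⟩).1
      rw [hp] at this; cases this
    refine ⟨hs, fun g r hr hg => ?_⟩
    have := (hpersist p T le_rfl fun n _ => ⟨_, _, _, .toFollow p g r hp hx hs hr hg, rfl⟩).1
    rw [hp] at this; cases this
  have h2 (p : ι) (hp : (A p).IsFollower) (hx : (A p).axis = none) :
      ¬ OnSurf C (A p).head := fun hs =>
    hp.ne_lead (hpersist p T le_rfl fun n _ => ⟨_, _, _, .toLead p (.inr hp) hx hs, rfl⟩).1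
  have h3 (q : ι) (hq : (A q).axis ≠ none) : ¬ MayContract A q := by
    have hqa : (A q).Active := ⟨fun h => hq (hinv.contracted q (.inl h)),
      fun h => hq (hinv.contracted q (.inr h))⟩
    rintro (⟨p, hpx, hp⟩ | ⟨ht, hi⟩)
    · obtain ⟨b, hb⟩ := Option.ne_none_iff_exists'.1 hq
      have hs := h2 p hp.isFollower hpx
      obtain ⟨g, hg, hpt⟩ := hp
      have hpq : p ≠ q := by rintro rfl; exact hq hpx
      exact hq (hpersist q T le_rfl fun n _ =>
        ⟨_, _, _, .handoverFollow p q g b hpq hg hpx hs hb hqa hpt, .inr rfl⟩).2.1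
    · exact hq (hpersist q T le_rfl fun n _ => ⟨_, _, _, .contract q hq hqa ht hi, rfl⟩).2.1
  obtain ⟨hin, hx⟩ := hinv.calm hfin h1 h3
  -- Otherwise the leader furthest along the surface that reads an indicator complains to the next.
  have h4 : ∀ n ≥ T, ∀ p, (A p).role = .lead → ¬ Sees sd A (K n) p := by
    by_contra! hex
    obtain ⟨n₀, hn₀, p₀, hp₀, hs₀⟩ := hex
    obtain ⟨p, ⟨hp, n, hn, hs⟩, hmax⟩ := Set.exists_max_image
      {p | (A p).role = .lead ∧ ∃ n ≥ T, Sees sd A (K n) p} (fun p => pos (A p).head)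
      (hfin.subset fun p hp => show (A p).role ≠ .object by simp [hp.1]) ⟨p₀, hp₀, n₀, hn₀, hs₀⟩
    have hsm (m : ℕ) (hm : n ≤ m) : Sees sd A (K m) p := by
      rcases hs with hs | ⟨r, hr, hs⟩
      · exact .inl hs
      · exact .inr ⟨r, hKmono n m hn hm hr, hs⟩
    have hps := hinv.lead_mem p hp _ (Sketch.head_mem_occ _)
    by_cases hfree : next sd (A p).head ∈ covered A
    · have hm : ¬ CanMove sd A p := by
        rintro (h5 | ⟨r, h5, -⟩)
        · exact h5 hfree
        · exact h5 (hx r)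
      obtain ⟨-, -, -, m, hm', hmK⟩ := hpersist p n hn fun m hm' =>
        ⟨_, _, _, .complain p hp (hx p) (hsm m hm') hm, rfl⟩
      obtain ⟨r, hr⟩ := hfree
      rw [Sketch.occ_of_none (hx r)] at hr
      have hr : next sd (A p).head = (A r).head := hr
      have hrs : (A r).head ∈ surface C := hr ▸ hS.next_mem _ hps
      have hrl : (A r).role = .lead := by
        cases hrole : (A r).role with
        | object => exact absurd ((hinv.object _).2 ⟨r, hrole, rfl⟩) hrs.1
        | inactive => exact absurd hrole (hin r)
        | follow g => exact absurd (mem_surface.1 hrs).2 (h2 r ⟨g, hrole⟩ (hx r))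
        | lead => rfl
      have := hmax r ⟨hrl, m + 1, by omega, .inr ⟨p, hmK, hp, hr⟩⟩
      have h5 := hS.pos_next _ hps
      change pos (next sd (A p).head) = _ at h5
      rw [hr] at h5
      omega
    · exact (hpersist p n hn fun m hm' =>
        ⟨_, _, _, .expand p hp (hx p) (hsm m hm') hfree, rfl⟩).2.2.1 (.inl hfree)
  refine ⟨T, fun p => ?_⟩
  rw [← hA]
  rcases hinv.all_lead hfin hin hx (fun p r hp hr => h4 T le_rfl p hp (.inl ⟨r, hr⟩)) p with hp | hp
  · exact .inl hp
  · exact .inr ⟨hp, hx p, h4 T le_rfl p hp⟩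

end Run

end Runs

/-! ### Executions of the coating algorithm -/

section Executions

variable {ι : Type*} {c : Config ι State Flag} {C : Set Node} {sd : Node → Dir} {pos : Node → ℤ}
  {pick : View → Finset (Fin 10) → Fin 10}

lemma Inv.readable (h : Inv C (sketches c)) (hc : ∀ p, Consistent sd (c p)) : Readable sd c := by
  refine ⟨h.disjoint, hc, fun p v hv hv' => ?_⟩
  obtain ⟨r, hrp, -, hr⟩ := h.target p v hv
  exact hrp (h.disjoint r p v hr hv')

lemma Inv.objectNodes_eq (h : Inv C (sketches c)) (hc : ∀ p, Consistent sd (c p)) :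
    objectNodes c = C := by
  ext v
  rw [mem_objectNodes (h.readable hc), h.object]
  rfl

lemma Inv.regular (h : Inv C (sketches c)) (hc : ∀ p, Consistent sd (c p))
    (hS : SurfaceLine C sd pos) : Regular sd pos c := by
  have ho := h.objectNodes_eq hc
  refine ⟨h.readable hc, ho ▸ hS, fun p hp => ?_⟩
  rw [ho]
  exact h.lead_mem p hp _ (Sketch.head_mem_occ _)

lemma Inv.connectedConfig (h : Inv C (sketches c)) (hC : (triGraph.induce C).Connected) :
    ConnectedConfig c :=
  ⟨fun p q hpq => Set.disjoint_left.2 fun v hv hv' => hpq (h.disjoint p q v hv hv'),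
    h.connected hC⟩

lemma InitialConfig.inv (h : InitialConfig c) : Inv (objectNodes c) (sketches c) := by
  obtain ⟨⟨⟨hdisj, hconn⟩, hcontr, hvalid, hinf, hfin⟩, hstate⟩ := h
  have hrole (p : ι) : (sketches c p).role = .object ∨ (sketches c p).role = .inactive := by
    rcases hstate p with ⟨h1, -⟩ | ⟨h1, -⟩ <;> simp [sketches, sketch, h1, roleOf]
  have hnf (p : ι) : ¬ (sketches c p).IsFollower := by
    rintro ⟨g, hg⟩
    rcases hrole p with h1 | h1 <;> rw [hg] at h1 <;> cases h1
  have hd : ∀ p q v, v ∈ (sketches c p).occ → v ∈ (sketches c q).occ → p = q := by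
    intro p q v hp hq
    by_contra hpq
    exact Set.disjoint_left.1 (hdisj p q hpq) hp hq
  refine ⟨hd, fun v => ?_, fun p _ => hcontr p, fun p v hv => absurd hv.isFollower (hnf p),
    ⟨0, fun p r v hv => absurd hv.isFollower (hnf p)⟩, fun p hp => ?_, fun T hT hne => ?_⟩
  · refine exists_congr fun p => and_congr role_eq_object.symm ?_
    have hx : (sketch (c p)).axis = none := hcontr p
    rw [occupied_eq, Sketch.occ_of_none hx]
    rfl
  · rcases hrole p with h1 | h1 <;> rw [hp] at h1 <;> cases h1
  · by_contra! hno
    obtain ⟨x, hx⟩ := hne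
    have hTcov : T ⊆ covered (sketches c) := by
      intro v hv
      obtain ⟨p, -, rfl⟩ := hT hv
      exact ⟨p, Sketch.head_mem_occ _⟩
    obtain ⟨⟨y, p, hp, hy⟩⟩ := hvalid.1.nonempty
    have hyT : y ∈ T := by
      refine induce_connected_induction hconn (P := (· ∈ T)) (hTcov hx) hx
        (fun u _ w hw huw hu => ?_) ⟨p, hy⟩
      by_contra hwT
      exact hno u hu w hw hwT huw
    obtain ⟨q, hq, rfl⟩ := hT hyT
    obtain rfl := hd p q _ hy (Sketch.head_mem_occ _)
    have hp' : (sketches c p).role = .object := role_eq_object.2 hp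
    rw [hq] at hp'
    cases hp'

lemma InitialConfig.consistent (h : InitialConfig c) (p : ι) : Consistent sd (c p) := by
  have hx := h.1.2.1 p
  unfold Consistent
  rcases h.2 p with ⟨h1, h2⟩ | ⟨h1, h2⟩
  · simp only [h1]
    exact ⟨fun i => by rw [h2], hx⟩
  · simp only [h1]
    exact ⟨(localAxis_of_none hx).symm, fun _ => hx, none, h2, fun i hi => by cases hi⟩

/-- All reachable configurations satisfy the invariants. -/
lemma inv_conf (hpick : IsTieBreak pick) (hS : SurfaceLine C sd pos)
    (E : Execution (coatingAlgorithm pick) ι) (h0 : Inv C (sketches (E.conf 0)))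
    (hc0 : ∀ p, Consistent sd (E.conf 0 p)) (n : ℕ) :
    Inv C (sketches (E.conf n)) ∧ ∀ p, Consistent sd (E.conf n p) := by
  induction n with
  | zero => exact ⟨h0, hc0⟩
  | succ n ih =>
    have hstep := E.step n
    cases hact : E.act n with
    | none =>
      rw [hact] at hstep
      rw [hstep.2]
      exact ih
    | some act =>
      rw [hact] at hstep
      obtain ⟨hen, heq⟩ := hstep
      obtain ⟨S, -, hs, hc⟩ := exists_aStep hpick (ih.1.regular ih.2 hS) hen
      rw [ih.1.objectNodes_eq ih.2] at hs
      rw [heq]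
      exact ⟨ih.1.step hS hs, hc⟩

lemma run_of_execution (hpick : IsTieBreak pick) (hS : SurfaceLine C sd pos)
    (E : Execution (coatingAlgorithm pick) ι) (hfair : E.Fair)
    (hinv : ∀ n, Inv C (sketches (E.conf n)) ∧ ∀ p, Consistent sd (E.conf n p))
    (hfin : {p | ¬ IsObject (E.conf 0) p}.Finite) :
    Run C sd (fun n => sketches (E.conf n)) (fun n => complainers (E.conf n)) := by
  have hreg (n : ℕ) := (hinv n).1.regular (hinv n).2 hS
  have hobj (n : ℕ) := (hinv n).1.objectNodes_eq (hinv n).2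
  have hact (n : ℕ) (act : Action ι State Flag) (ha : E.act n = some act) :
      ∃ S, (∀ r, act.Affects r ↔ r ∈ S) ∧ AStep C sd (sketches (E.conf n)) (complainers (E.conf n))
        S (sketches (E.conf (n + 1))) (complainers (E.conf (n + 1))) := by
    have hstep := E.step n
    rw [ha] at hstep
    obtain ⟨hen, heq⟩ := hstep
    obtain ⟨S, h1, hs, -⟩ := exists_aStep hpick (hreg n) hen
    rw [hobj n] at hs
    rw [heq]
    exact ⟨S, h1, hs⟩
  refine ⟨fun n => (hinv n).1, fun n => ?_, fun p m => ?_, ?_⟩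
  · cases ha : E.act n with
    | none =>
      have hstep := E.step n
      rw [ha] at hstep
      right
      rw [hstep.2]
      exact ⟨rfl, rfl⟩
    | some act =>
      obtain ⟨S, -, hs⟩ := hact n act ha
      exact .inl ⟨S, hs⟩
  · obtain ⟨n, hn, hf | ⟨act, ha, hp⟩⟩ := hfair p m
    · refine ⟨n, hn, .inl fun S a' K' hs hpS => ?_⟩
      rw [← hobj n] at hs
      obtain ⟨act, hen, haff⟩ := exists_enabled_of_aStep hpick (hreg n) hs
      exact hf act hen ((haff p).2 hpS)
    · obtain ⟨S, h1, hs⟩ := hact n act ha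
      exact ⟨n, hn, .inr ⟨S, hs, (h1 p).1 hp⟩⟩
  · exact hfin.subset fun p hp h0 => hp (role_eq_object.2 h0)

lemma terminated_of_final (hpick : IsTieBreak pick) (h : Regular sd pos c)
    (hfinal : ∀ p, (sketches c p).role = .object ∨ ((sketches c p).role = .lead ∧
      (sketches c p).axis = none ∧ ¬ Sees sd (sketches c) (complainers c) p)) :
    Terminated (coatingAlgorithm pick) c := by
  intro p
  rcases hfinal p with hp | ⟨hp, hx, hs⟩
  · exact turns_object hp
  · exact Set.eq_empty_iff_forall_notMem.2 fun t ht =>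
      hs ((mem_turns_lead hpick h hp hx).1 ht).1

lemma final_of_terminated (hpick : IsTieBreak pick) (hinv : Inv C (sketches c))
    (h : Regular sd pos c) (hC : objectNodes c = C)
    (hfin : {p | (sketches c p).role ≠ .object}.Finite)
    (ht : Terminated (coatingAlgorithm pick) c) (p : ι) :
    (sketches c p).axis = none ∧
      ((sketches c p).role = .object ∨ (sketches c p).role = .lead) := by
  have hread := h.toReadable
  have hempty (p : ι) : ¬ (coatingTurns pick c p).Nonempty := by
    rw [Set.not_nonempty_iff_eq_empty]; exact ht p
  obtain ⟨hin, hx⟩ := hinv.calm hfin (fun p hp => by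
    rw [← hC]
    have hs : ¬ OnSurf (objectNodes c) (c p).head := fun hs =>
      hempty p ⟨_, by rw [turns_inactive_surface hread hp hs]; rfl⟩
    exact ⟨hs, fun g r hr hg => hempty p (turns_inactive_nonempty hpick hread hp hs hr hg)⟩)
    (fun q hq hm => by
      obtain ⟨t, ht, -⟩ := exists_turn_of_mayContract (pick := pick) hread hq hm
      exact hempty q ⟨t, ht⟩)
  refine ⟨hx p, hinv.all_lead hfin hin hx (fun p r hp hr => ?_) p⟩
  have hi := edgeAt_labelOf (x := none) (e := .head) (d := sd (c p).head - (c p).orient) rfl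
  by_cases hm : CanMove sd (sketches c) p
  · exact hempty p ⟨_, (mem_turns_lead hpick h hp (hx p)).2
      ⟨.inl ⟨r, hr⟩, _, hi, .inr ⟨hm, rfl⟩⟩⟩
  · exact hempty p ⟨_, (mem_turns_lead hpick h hp (hx p)).2
      ⟨.inl ⟨r, hr⟩, _, hi, .inl ⟨hm, rfl⟩⟩⟩

end Executions

end Amoebot

theorem theorem1 {ι : Type*}
    (pick : Amoebot.View → Finset (Fin 10) → Fin 10) (hpick : Amoebot.IsTieBreak pick) :
    Amoebot.Solves (Amoebot.coatingAlgorithm pick) (Amoebot.infiniteObjectCoating ι) := by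
  open Amoebot in
  intro E hfair (hinit : InitialConfig (E.conf 0))
  obtain ⟨hvalid, hinf, hfin⟩ := hinit.1.2.2
  obtain ⟨sd, pos, hS⟩ := hvalid.exists_surfaceLine hinf
  have hinv := inv_conf hpick hS E hinit.inv hinit.consistent
  have hrun := run_of_execution hpick hS E hfair hinv hfin
  have hreg (n : ℕ) := (hinv n).1.regular (hinv n).2 hS
  have hobj (n : ℕ) := (hinv n).1.objectNodes_eq (hinv n).2
  have hconn (n : ℕ) := (hinv n).1.connectedConfig hvalid.1
  refine ⟨hconn, ?_, fun n ht => ?_⟩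
  · obtain ⟨n, hn⟩ := hrun.exists_final hS
    exact ⟨n, terminated_of_final hpick (hreg n) hn⟩
  · have hfin' : {p | (sketches (E.conf n) p).role ≠ .object}.Finite :=
      hrun.finite.subset fun p hp h0 => hp ((hrun.object_iff n p).2 h0)
    have hfinal := final_of_terminated hpick (hinv n).1 (hreg n) (hobj n) hfin' ht
    refine ⟨⟨hconn n, fun p => (hfinal p).1, (hobj n).symm ▸ hvalid, (hobj n).symm ▸ hinf,
      hfin'.subset fun p hp h0 => hp (role_eq_object.1 h0)⟩, fun p hp => ?_⟩
    have hlead := (hfinal p).2.resolve_left fun h0 => hp (role_eq_object.1 h0)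
    obtain ⟨d, hd⟩ := (mem_surface.1 ((hreg n).lead_mem p hlead)).2
    exact ⟨_, Or.inl rfl, _, hd, adj_add_vec _ d⟩
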